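/- Let $M$ be a connected smooth manifold of dimension $n\ge 3$ with a Riemannian metric $g$ of constant sectional curvature $\kappa$, with Levi-Civita connection $\nabla^g$, Ricci tensor $\mathrm{Ric}^g$ and Schouten tensor $P=\frac1{n-2}\bigl(\mathrm{Ric}^g-\frac{\mathrm{tr}_g\mathrm{Ric}^g}{2(n-1)}g\bigr)$. Let $S$ be a smooth totally symmetric trace-free $(0,3)$-tensor field and $t$ a smooth function on $M$. Write $g(\hat S(X,Y),Z)=S(X,Y,Z)$, $S_X=\hat S(X,\cdot)$, $\mathscr S(X,Y)=\mathrm{tr}(S_XS_Y)$, and $B^\circ=B-\frac1n(\mathrm{tr}_gB)\,g$ for a bilinear form $B$. The structure tensors $(S,t)$ of an abundant second-order (maximally conformally) superintegrable system make $(M,g,S,t)$ an *abundant manifold*. This means that $g$ is conformally flat and (i) $(\nabla^g)^2t=3P+\frac13\bigl(dt^2-\frac12|\mathrm{grad}\,t|^2g\bigr)+\frac1{3(n-2)}\Bigl(\mathscr S+\frac{(n-6)|S|^2}{2(n-1)(n+2)}g\Bigr)$; (ii) $\nabla^gS=\frac13\,\Pi S_1$, where $S_1(X,Y,Z,W)=g(S_XS_YZ,W)+3S(X,Y,W)\,dt(Z)+S(X,Y,Z)\,dt(W)+\bigl(\frac4{n-2}\mathscr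 S(Y,Z)-3S(Y,Z,\mathrm{grad}\,t)\bigr)g(X,W)$, the last argument of $\nabla^gS$ is the direction of differentiation, and $\Pi$ is the orthogonal projection onto tensors that are totally symmetric and trace-free in the first three arguments; (iii) the algebraic Weyl (totally trace-free) part of the curvature-type tensor $\frac12\bigl(g(S_XZ,S_YW)-g(S_XW,S_YZ)\bigr)$ vanishes. The system is *proper* (properly superintegrable) if $\tau=0$, where $$\tau=\tfrac{2}{3(n-2)}\mathscr S^\circ-\tfrac23\bigl(dt\circ\hat S+dt\otimes dt\bigr)^\circ+2P^\circ .$$ Put $C(X,Y,Z)=\frac13\bigl(S(X,Y,Z)+dt(X)g(Y,Z)+dt(Y)g(X,Z)+dt(Z)g(X,Y)\bigr)$ and $g(\hat C(X,Y),Z)=C(X,Y,Z)$. For an immersion $f:M\to\mathbb R^{n+1}$ with transversal field $\xi$, the structure equations (with $\bar\nabla$ the flat connection of $\mathbb R^{n+1}$) $$\bar\nabla_X f_*Y=f_*(\nabla_XY)+G(X,Y)\,\xi,\qquad \bar\nabla_X\xi=-f_*(\hat A X)+\Theta(X)\,\xi$$ define the induced connection $\nabla$, the metric $G$, the Weingarten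 operator $\hat A$ and the $1$-form $\Theta$; the normalisation $(f,\xi)$ is *relative* if $\Theta=0$. The relative normalisation $(f,\xi)$ is *associated* with $(M,g,S,t)$ if $G=g$ and its cubic $G(\nabla_XY-\nabla^G_XY,Z)$ equals $C(X,Y,Z)$; its Weingarten tensor $A=G(\hat A\cdot,\cdot)$ is then determined by $(n-1)A=\mathrm{Ric}^*$, where $\mathrm{Ric}^*$ is the Ricci tensor of the dual connection $\nabla^*=\nabla^g-\hat C$. **Proposition.** If $(M,g,S,t)$ is abundant and proper and $g$ has constant sectional curvature, then $\mathrm{Ric}^*=0$ on $M$, and every relative normalisation $(f,\xi)$ of $M$ in $\mathbb R^{n+1}$ associated with $(M,g,S,t)$ is an improper relative sphere, i.e. $\xi$ is a nonzero constant vector, and has vanishing Weingarten operator, $\hat A=0$. -/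

import Mathlib

open scoped Manifold ContDiff

noncomputable section

namespace Abundant

/-- The model space `ℝᵐ`. -/
abbrev Euc (m : ℕ) : Type := EuclideanSpace ℝ (Fin m)

/-! ### Tensor calculus in local coordinates

Everything in this section takes place on an open subset of `ℝⁿ`. A tensor field is given by its
components, which are functions of the point `y`; `h` stands for the components of a Riemannian
metric and `Γ y k i j` for the Christoffel symbols of a connection,
`∇_{∂ᵢ} ∂ⱼ = ∑ₖ Γ y k i j • ∂ₖ`. -/

section Local

variable {n : ℕ}

/-- The partial derivative `∂ᵢ f` at `y`. -/
def pd {F : Type*} [NormedAddCommGroup F] [NormedSpace ℝ F]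
    (f : Euc n → F) (i : Fin n) (y : Euc n) : F :=
  fderiv ℝ f y (EuclideanSpace.single i 1)

/-- The components `h^{ij}` of the inverse metric. -/
def invMetric (h : Euc n → Matrix (Fin n) (Fin n) ℝ) (y : Euc n) : Matrix (Fin n) (Fin n) ℝ :=
  (h y)⁻¹

/-- The Christoffel symbols of the Levi-Civita connection of `h`. -/
def christoffel (h : Euc n → Matrix (Fin n) (Fin n) ℝ) (y : Euc n) (k i j : Fin n) : ℝ :=
  (1 / 2) * ∑ l, invMetric h y k l *
    (pd (fun z => h z j l) i y + pd (fun z => h z i l) j y - pd (fun z => h z i j) l y)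

/-- The curvature of a connection: `curvature Γ y i j k l` is the `∂ₗ`-component of
`R(∂ᵢ, ∂ⱼ) ∂ₖ`, where `R(X, Y) = [∇_X, ∇_Y] - ∇_{[X, Y]}`. -/
def curvature (Γ : Euc n → Fin n → Fin n → Fin n → ℝ) (y : Euc n) (i j k l : Fin n) : ℝ :=
  pd (fun z => Γ z l j k) i y - pd (fun z => Γ z l i k) j y
    + ∑ a, (Γ y l i a * Γ y a j k - Γ y l j a * Γ y a i k)

/-- The Ricci tensor of a connection, `Ric(X, Y) = tr (Z ↦ R(Z, X) Y)`. -/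
def ricci (Γ : Euc n → Fin n → Fin n → Fin n → ℝ) (y : Euc n) (i j : Fin n) : ℝ :=
  ∑ a, curvature Γ y a i j a

/-- The trace `tr_h B` of a bilinear form. -/
def trace (h : Euc n → Matrix (Fin n) (Fin n) ℝ) (y : Euc n) (B : Fin n → Fin n → ℝ) : ℝ :=
  ∑ i, ∑ j, invMetric h y i j * B i j

/-- The trace-free part of a bilinear form. -/
def traceFree (h : Euc n → Matrix (Fin n) (Fin n) ℝ) (y : Euc n) (B : Fin n → Fin n → ℝ)
    (i j : Fin n) : ℝ :=
  B i j - (1 / (n : ℝ)) * trace h y B * h y i j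

/-- The Schouten tensor `P = (Ric - (tr Ric) / (2 (n - 1)) h) / (n - 2)` of the metric `h`. -/
def schouten (h : Euc n → Matrix (Fin n) (Fin n) ℝ) (y : Euc n) (i j : Fin n) : ℝ :=
  1 / ((n : ℝ) - 2) * (ricci (christoffel h) y i j
    - trace h y (ricci (christoffel h) y) / (2 * ((n : ℝ) - 1)) * h y i j)

/-- The gradient of `t`. -/
def grad (h : Euc n → Matrix (Fin n) (Fin n) ℝ) (t : Euc n → ℝ) (y : Euc n) (k : Fin n) : ℝ :=
  ∑ l, invMetric h y k l * pd t l y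

/-- `|grad t|²`. -/
def gradSq (h : Euc n → Matrix (Fin n) (Fin n) ℝ) (t : Euc n → ℝ) (y : Euc n) : ℝ :=
  ∑ k, grad h t y k * pd t k y

/-- The Hessian `∇² t` with respect to the Levi-Civita connection. -/
def hessian (h : Euc n → Matrix (Fin n) (Fin n) ℝ) (t : Euc n → ℝ) (y : Euc n)
    (i j : Fin n) : ℝ :=
  pd (pd t j) i y - ∑ k, christoffel h y k i j * pd t k y

/-- `covDeriv h S y i j k l = (∇_{∂ₗ} S)(∂ᵢ, ∂ⱼ, ∂ₖ)` for the Levi-Civita connection: the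
direction of differentiation is the last argument. -/
def covDeriv (h : Euc n → Matrix (Fin n) (Fin n) ℝ) (S : Euc n → Fin n → Fin n → Fin n → ℝ)
    (y : Euc n) (i j k l : Fin n) : ℝ :=
  pd (fun z => S z i j k) l y
    - ∑ m, (christoffel h y m l i * S y m j k + christoffel h y m l j * S y i m k
      + christoffel h y m l k * S y i j m)

/-- `raise h S y i j k` is the `∂ₖ`-component of `Ŝ(∂ᵢ, ∂ⱼ)`, where
`h(Ŝ(X, Y), Z) = S(X, Y, Z)`. -/
def raise (h : Euc n → Matrix (Fin n) (Fin n) ℝ) (S : Euc n → Fin n → Fin n → Fin n → ℝ)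
    (y : Euc n) (i j k : Fin n) : ℝ :=
  ∑ l, S y i j l * invMetric h y l k

/-- `𝒮(X, Y) = tr (S_X S_Y)`, where `S_X = Ŝ(X, ·)`. -/
def scrS (h : Euc n → Matrix (Fin n) (Fin n) ℝ) (S : Euc n → Fin n → Fin n → Fin n → ℝ)
    (y : Euc n) (i j : Fin n) : ℝ :=
  ∑ a, ∑ b, raise h S y i a b * raise h S y j b a

/-- `|S|²`, the full contraction of `S` with itself. -/
def normSq (h : Euc n → Matrix (Fin n) (Fin n) ℝ) (S : Euc n → Fin n → Fin n → Fin n → ℝ)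
    (y : Euc n) : ℝ :=
  ∑ i, ∑ j, ∑ k, ∑ a, ∑ b, ∑ c,
    invMetric h y i a * invMetric h y j b * invMetric h y k c * S y i j k * S y a b c

/-- The tensor
`S₁(X, Y, Z, W) = h(S_X S_Y Z, W) + 3 S(X, Y, W) dt(Z) + S(X, Y, Z) dt(W)
  + (4 / (n - 2) 𝒮(Y, Z) - 3 S(Y, Z, grad t)) h(X, W)`. -/
def tensorS₁ (h : Euc n → Matrix (Fin n) (Fin n) ℝ) (S : Euc n → Fin n → Fin n → Fin n → ℝ)
    (t : Euc n → ℝ) (y : Euc n) (i j k l : Fin n) : ℝ :=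
  (∑ a, raise h S y j k a * S y i a l) + 3 * S y i j l * pd t k y + S y i j k * pd t l y
    + (4 / ((n : ℝ) - 2) * scrS h S y j k - 3 * ∑ m, S y j k m * grad h t y m) * h y i l

/-- Symmetrisation in the first three of four arguments. -/
def sym₃ (Φ : Fin n → Fin n → Fin n → Fin n → ℝ) (i j k l : Fin n) : ℝ :=
  (1 / 6) * (Φ i j k l + Φ j k i l + Φ k i j l + Φ j i k l + Φ i k j l + Φ k j i l)

/-- The projection onto the part that is totally symmetric and trace-free in the first three
arguments: `Sym Φ - 3 / (n + 2) Sym (h ⊗ φ)`, where `φ(X, W)` is the trace of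
`(Sym Φ)(·, ·, X, W)`. -/
def symTraceFree₃ (h : Euc n → Matrix (Fin n) (Fin n) ℝ) (y : Euc n)
    (Φ : Fin n → Fin n → Fin n → Fin n → ℝ) (i j k l : Fin n) : ℝ :=
  sym₃ Φ i j k l - 3 / ((n : ℝ) + 2) *
    sym₃ (fun a b c d => h y a b * trace h y (fun p q => sym₃ Φ p q c d)) i j k l

/-- The Kulkarni-Nomizu product of two symmetric bilinear forms. -/
def kulkarniNomizu (A B : Fin n → Fin n → ℝ) (i j k l : Fin n) : ℝ :=
  A i k * B j l + A j l * B i k - A i l * B j k - A j k * B i l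

/-- The part of a four-index tensor with the symmetries of a curvature tensor. -/
def curvaturePart (B : Fin n → Fin n → Fin n → Fin n → ℝ) (i j k l : Fin n) : ℝ :=
  (1 / 4) * (B i k j l - B i l j k - B j k i l + B j l i k)

/-- The contraction `(n - 2)⁻¹ tr_h (B₁(·, X, ·, Y))` of the curvature part `B₁` of `B`. -/
def curvatureContraction (h : Euc n → Matrix (Fin n) (Fin n) ℝ) (y : Euc n)
    (B : Fin n → Fin n → Fin n → Fin n → ℝ) (i j : Fin n) : ℝ :=
  1 / ((n : ℝ) - 2) * trace h y (fun p q => curvaturePart B p i q j)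

/-- The algebraic Weyl part (totally trace-free curvature part) of a four-index tensor. -/
def weylPart (h : Euc n → Matrix (Fin n) (Fin n) ℝ) (y : Euc n)
    (B : Fin n → Fin n → Fin n → Fin n → ℝ) (i j k l : Fin n) : ℝ :=
  curvaturePart B i j k l - kulkarniNomizu
    (fun p q => curvatureContraction h y B p q
      - trace h y (curvatureContraction h y B) / (2 * ((n : ℝ) - 1)) * h y p q)
    (h y) i j k l

/-- `𝔖(X, Y, Z, W) = h(S_X Y, S_Z W)`. -/
def frakS (h : Euc n → Matrix (Fin n) (Fin n) ℝ) (S : Euc n → Fin n → Fin n → Fin n → ℝ)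
    (y : Euc n) (i j k l : Fin n) : ℝ :=
  ∑ a, ∑ b, h y a b * raise h S y i j a * raise h S y k l b

/-- The trace-free symmetric tensor
`τ = 2 / (3 (n - 2)) 𝒮° - (2 / 3) (dt ∘ Ŝ + dt ⊗ dt)° + 2 P°`. -/
def tau (h : Euc n → Matrix (Fin n) (Fin n) ℝ) (S : Euc n → Fin n → Fin n → Fin n → ℝ)
    (t : Euc n → ℝ) (y : Euc n) (i j : Fin n) : ℝ :=
  2 / (3 * ((n : ℝ) - 2)) * traceFree h y (scrS h S y) i j
    - (2 / 3) * traceFree h y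
        (fun p q => (∑ k, pd t k y * raise h S y p q k) + pd t p y * pd t q y) i j
    + 2 * traceFree h y (schouten h y) i j

/-- The cubic `C(X, Y, Z) = (S(X, Y, Z) + dt(X) h(Y, Z) + dt(Y) h(X, Z) + dt(Z) h(X, Y)) / 3`. -/
def cubicOf (h : Euc n → Matrix (Fin n) (Fin n) ℝ) (S : Euc n → Fin n → Fin n → Fin n → ℝ)
    (t : Euc n → ℝ) (y : Euc n) (i j k : Fin n) : ℝ :=
  (1 / 3) * (S y i j k + pd t i y * h y j k + pd t j y * h y i k + pd t k y * h y i j)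

/-- The Christoffel symbols of the dual connection `∇* = ∇ʰ - Ĉ`. -/
def dualChristoffel (h : Euc n → Matrix (Fin n) (Fin n) ℝ)
    (C : Euc n → Fin n → Fin n → Fin n → ℝ) (y : Euc n) (k i j : Fin n) : ℝ :=
  christoffel h y k i j - raise h C y i j k

/-! ### A hypersurface with transversal field, in local coordinates -/

/-- `(v, a) ↦ F_* v + a ξ`; the pair `(F, ξ)` is a hypersurface with transversal field near `y`
precisely when this is bijective. -/
def frameMap (F X : Euc n → Euc (n + 1)) (y : Euc n) (p : Euc n × ℝ) : Euc (n + 1) :=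
  fderiv ℝ F y p.1 + p.2 • X y

/-- The decomposition of an ambient vector into its tangential part and its coefficient along the
transversal field (the inverse of the bijection `frameMap F X y`). -/
def splitting (F X : Euc n → Euc (n + 1)) (y : Euc n) : Euc (n + 1) → Euc n × ℝ :=
  Function.invFun (frameMap F X y)

/-- The Christoffel symbols of the induced connection, the tangential part of
`∂ᵢ ∂ⱼ F = F_* (∇_{∂ᵢ} ∂ⱼ) + G(∂ᵢ, ∂ⱼ) ξ`. -/
def inducedChristoffel (F X : Euc n → Euc (n + 1)) (y : Euc n) (k i j : Fin n) : ℝ :=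
  (splitting F X y (pd (pd F j) i y)).1 k

/-- The affine fundamental form `G`, the transversal part of
`∂ᵢ ∂ⱼ F = F_* (∇_{∂ᵢ} ∂ⱼ) + G(∂ᵢ, ∂ⱼ) ξ`. -/
def fundamentalForm (F X : Euc n → Euc (n + 1)) (y : Euc n) : Matrix (Fin n) (Fin n) ℝ :=
  fun i j => (splitting F X y (pd (pd F j) i y)).2

/-- The Weingarten operator: `weingarten F X y k i` is the `∂ₖ`-component of `Â(∂ᵢ)`, where
`∂ᵢ ξ = - F_* (Â(∂ᵢ)) + Θ(∂ᵢ) ξ`. -/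
def weingarten (F X : Euc n → Euc (n + 1)) (y : Euc n) (k i : Fin n) : ℝ :=
  -(splitting F X y (pd X i y)).1 k

/-- The `1`-form `Θ` in `∂ᵢ ξ = - F_* (Â(∂ᵢ)) + Θ(∂ᵢ) ξ`. -/
def transversalForm (F X : Euc n → Euc (n + 1)) (y : Euc n) (i : Fin n) : ℝ :=
  (splitting F X y (pd X i y)).2

/-- The cubic `C(X, Y, Z) = G(∇_X Y - ∇ᴳ_X Y, Z)` of a normalised hypersurface. -/
def hypersurfaceCubic (F X : Euc n → Euc (n + 1)) (y : Euc n) (i j k : Fin n) : ℝ :=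
  ∑ l, (inducedChristoffel F X y l i j - christoffel (fundamentalForm F X) y l i j)
    * fundamentalForm F X y l k

end Local

/-! ### Global objects -/

section Global

variable {n : ℕ} {M : Type*} [TopologicalSpace M] [ChartedSpace (Euc n) M]

/-- The charts of the smooth structure of `M` (all of them, not only those of a chosen atlas). -/
def charts (n : ℕ) (M : Type*) [TopologicalSpace M] [ChartedSpace (Euc n) M] :
    Set (OpenPartialHomeomorph M (Euc n)) :=
  IsManifold.maximalAtlas (𝓡 n) ∞ M

/-- The coordinate vector field `∂ᵢ` of a chart, at the point with coordinates `y`. -/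
def coordVec (φ : OpenPartialHomeomorph M (Euc n)) (y : Euc n) (i : Fin n) :
    TangentSpace (𝓡 n) (φ.symm y) :=
  mfderiv (𝓡 n) (𝓡 n) φ.symm y
    (show TangentSpace (𝓡 n) y from (EuclideanSpace.single i 1 : Euc n))

/-- A function on `M`, read in a chart. -/
def inChart {F : Type*} (φ : OpenPartialHomeomorph M (Euc n)) (f : M → F) : Euc n → F :=
  f ∘ φ.symm

/-- A field of trilinear forms on the tangent spaces of `M`. -/
abbrev CubicField (n : ℕ) (M : Type*) [TopologicalSpace M] [ChartedSpace (Euc n) M] : Type _ :=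
  (x : M) → TangentSpace (𝓡 n) x →L[ℝ] TangentSpace (𝓡 n) x →L[ℝ] TangentSpace (𝓡 n) x →L[ℝ] ℝ

/-- The components `Sᵢⱼₖ` of a cubic field in a chart. -/
def CubicField.comp (S : CubicField n M) (φ : OpenPartialHomeomorph M (Euc n)) (y : Euc n)
    (i j k : Fin n) : ℝ :=
  S (φ.symm y) (coordVec φ y i) (coordVec φ y j) (coordVec φ y k)

variable [IsManifold (𝓡 n) ∞ M]

/-- A smooth Riemannian metric on `M`. -/
abbrev Metric (n : ℕ) (M : Type*) [TopologicalSpace M] [ChartedSpace (Euc n) M]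
    [IsManifold (𝓡 n) ∞ M] : Type _ :=
  Bundle.ContMDiffRiemannianMetric (𝓡 n) ∞ (Euc n) (fun x : M => TangentSpace (𝓡 n) x)

/-- The components `gᵢⱼ` of a Riemannian metric in a chart. -/
def metricComp (g : Metric n M) (φ : OpenPartialHomeomorph M (Euc n)) (y : Euc n) :
    Matrix (Fin n) (Fin n) ℝ :=
  fun i j => g.inner (φ.symm y) (coordVec φ y i) (coordVec φ y j)

/-- All sectional curvatures are equal to `κ`:
`g(R(v, w) w, v) = κ (|v|² |w|² - g(v, w)²)` for all tangent vectors `v`, `w`. -/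
def HasConstantSectionalCurvature (g : Metric n M) (κ : ℝ) : Prop :=
  ∀ φ ∈ charts n M, ∀ y ∈ φ.target, ∀ v w : Fin n → ℝ,
    ∑ i, ∑ j, ∑ k, ∑ l, ∑ m, v i * w j * w k * v m * metricComp g φ y l m
        * curvature (christoffel (metricComp g φ)) y i j k l
      = κ * ((∑ i, ∑ j, metricComp g φ y i j * v i * v j)
            * (∑ i, ∑ j, metricComp g φ y i j * w i * w j)
          - (∑ i, ∑ j, metricComp g φ y i j * v i * w j) ^ 2)

/-- Near every point there are coordinates in which `g = exp (2 σ) ∑ᵢ dxᵢ²`. -/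
def IsConformallyFlat (g : Metric n M) : Prop :=
  ∀ x : M, ∃ φ ∈ charts n M, x ∈ φ.source ∧ ∃ σ : Euc n → ℝ, ContDiffOn ℝ ∞ σ φ.target ∧
    ∀ y ∈ φ.target, ∀ i j, metricComp g φ y i j = if i = j then Real.exp (2 * σ y) else 0

/-- `(M, g, S, t)` is an abundant manifold (in dimension at least three). -/
structure IsAbundantManifold (g : Metric n M) (S : CubicField n M) (t : M → ℝ) : Prop where
  conformallyFlat : IsConformallyFlat g
  smooth_S : ∀ φ ∈ charts n M, ∀ i j k, ContDiffOn ℝ ∞ (fun y => S.comp φ y i j k) φ.target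
  symm_left : ∀ (x : M) (X Y Z : TangentSpace (𝓡 n) x), S x X Y Z = S x Y X Z
  symm_right : ∀ (x : M) (X Y Z : TangentSpace (𝓡 n) x), S x X Y Z = S x X Z Y
  traceFree_S : ∀ φ ∈ charts n M, ∀ y ∈ φ.target, ∀ k,
    trace (metricComp g φ) y (fun i j => S.comp φ y i j k) = 0
  smooth_t : ContMDiff (𝓡 n) 𝓘(ℝ) ∞ t
  /-- `∇² t = 3 P + (dt² - |grad t|² g / 2) / 3
    + (𝒮 + (n - 6) |S|² g / (2 (n - 1) (n + 2))) / (3 (n - 2))`. -/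
  hessian_t : ∀ φ ∈ charts n M, ∀ y ∈ φ.target, ∀ i j,
    hessian (metricComp g φ) (inChart φ t) y i j
      = 3 * schouten (metricComp g φ) y i j
        + (1 / 3) * (pd (inChart φ t) i y * pd (inChart φ t) j y
          - (1 / 2) * gradSq (metricComp g φ) (inChart φ t) y * metricComp g φ y i j)
        + 1 / (3 * ((n : ℝ) - 2)) * (scrS (metricComp g φ) (S.comp φ) y i j
          + ((n : ℝ) - 6) * normSq (metricComp g φ) (S.comp φ) y * metricComp g φ y i j
            / (2 * ((n : ℝ) - 1) * ((n : ℝ) + 2)))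
  /-- `∇ S` is one third of the projection of `S₁`. -/
  covDeriv_S : ∀ φ ∈ charts n M, ∀ y ∈ φ.target, ∀ i j k l,
    covDeriv (metricComp g φ) (S.comp φ) y i j k l
      = (1 / 3) * symTraceFree₃ (metricComp g φ) y
          (tensorS₁ (metricComp g φ) (S.comp φ) (inChart φ t) y) i j k l
  /-- The algebraic Weyl part of `𝔖` vanishes. -/
  weyl_S : ∀ φ ∈ charts n M, ∀ y ∈ φ.target, ∀ i j k l,
    weylPart (metricComp g φ) y (frakS (metricComp g φ) (S.comp φ) y) i j k l = 0

/-- The abundant structure is proper: `τ = 0`. -/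
def IsProper (g : Metric n M) (S : CubicField n M) (t : M → ℝ) : Prop :=
  ∀ φ ∈ charts n M, ∀ y ∈ φ.target, ∀ i j,
    tau (metricComp g φ) (S.comp φ) (inChart φ t) y i j = 0

/-- The Ricci tensor `Ric*` of the dual connection `∇* = ∇ᵍ - Ĉ` of `(g, S, t)` vanishes. For the
relative normalisation with metric `g` and cubic `C` the Weingarten tensor `A` is determined by
`(n - 1) A = Ric*`. -/
def DualRicciVanishes (g : Metric n M) (S : CubicField n M) (t : M → ℝ) : Prop :=
  ∀ φ ∈ charts n M, ∀ y ∈ φ.target, ∀ i j,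
    ricci (dualChristoffel (metricComp g φ)
      (cubicOf (metricComp g φ) (S.comp φ) (inChart φ t))) y i j = 0

end Global

/-! ### Affine hypersurface normalisations -/

section Hypersurface

variable {n : ℕ} {M : Type*} [TopologicalSpace M] [ChartedSpace (Euc n) M]

/-- `f : M → ℝⁿ⁺¹` is an immersion and `ξ` is a transversal field along `f`. -/
structure IsNormalisation (f ξ : M → Euc (n + 1)) : Prop where
  smooth_f : ContMDiff (𝓡 n) (𝓡 (n + 1)) ∞ f
  smooth_ξ : ContMDiff (𝓡 n) (𝓡 (n + 1)) ∞ ξ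
  immersion : ∀ x : M, Function.Injective (mfderiv (𝓡 n) (𝓡 (n + 1)) f x)
  transversal : ∀ x : M, ξ x ∉ Set.range (mfderiv (𝓡 n) (𝓡 (n + 1)) f x)

/-- A relative normalisation: the `1`-form `Θ` vanishes. -/
structure IsRelativeNormalisation (f ξ : M → Euc (n + 1)) : Prop
    extends IsNormalisation f ξ where
  relative : ∀ φ ∈ charts n M, ∀ y ∈ φ.target, ∀ i,
    transversalForm (inChart φ f) (inChart φ ξ) y i = 0

/-- An improper relative sphere: a relative normalisation with constant (nonzero) transversal
field. -/
def IsImproperRelativeSphere (f ξ : M → Euc (n + 1)) : Prop :=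
  IsRelativeNormalisation f ξ ∧ ∃ c₀ : Euc (n + 1), c₀ ≠ 0 ∧ ∀ x, ξ x = c₀

/-- The Weingarten operator `Â` of `(f, ξ)` vanishes identically. -/
def WeingartenVanishes (f ξ : M → Euc (n + 1)) : Prop :=
  ∀ φ ∈ charts n M, ∀ y ∈ φ.target, ∀ k i,
    weingarten (inChart φ f) (inChart φ ξ) y k i = 0

/-- `(f, ξ)` is the relative normalisation associated with `(M, g, S, t)`: its metric is `g` and
its cubic is `C = (S + dt ⊗ g + …) / 3`. -/
structure IsAssociatedNormalisation [IsManifold (𝓡 n) ∞ M] (g : Metric n M) (S : CubicField n M)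
    (t : M → ℝ) (f ξ : M → Euc (n + 1)) : Prop extends IsRelativeNormalisation f ξ where
  metric_eq : ∀ φ ∈ charts n M, ∀ y ∈ φ.target,
    fundamentalForm (inChart φ f) (inChart φ ξ) y = metricComp g φ y
  cubic_eq : ∀ φ ∈ charts n M, ∀ y ∈ φ.target, ∀ i j k,
    hypersurfaceCubic (inChart φ f) (inChart φ ξ) y i j k
      = cubicOf (metricComp g φ) (S.comp φ) (inChart φ t) y i j k

end Hypersurface

end Abundant

end

/-! Constant curvature gives `P = (κ/2) g`, so properness becomes the algebraic identity `𝒮 =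
(n-2)(S(·,·,grad t) + dt²) + ρ g` (`gram_eq`). Combined with the Weyl condition (iii), it expresses
the skew part of `g(S_X Y, S_Z W)` through `S(·,·,grad t)`, `dt²` and `g` (`weyl_normal_form`).
Consequently the prolongation formula for `∇S` loses its terms in `𝒮` and takes the normal form
`properDeriv`; the Hessian of `t` reduces to `S(·,·,grad t)/3 + (2/3) dt²` plus a multiple of `g`.

The identity for `𝒮` holds on open sets and may be differentiated. Inserting the expressions for
`∇S` and `∇²t`, and removing the quadratic contractions of `S` by the Weyl identity contracted with
`grad t`, leaves `c (S(X,Y,Z) + g(X,Z) dt(Y) + g(Y,Z) dt(X)) = g(X,Y) v(Z)`. Here `c` is a nonzero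
constant times `|S|² - (n-1)(n+2)|grad t|² - 9n(n-1)κ`, the scalar `obstruction`
(`properness_deriv`, `coeff_cubic_eq`, `coeff_gradient_eq`). Two different traces give `c dt = 0`
and `c S = 0`. If the scalar were nonzero at a point, `dt` and `S` would vanish nearby, the Hessian
equation would give `κ = 0`, and the scalar would be zero after all (`obstruction_eq_zero`).

The Ricci tensor of `∇* = ∇ᵍ - Ĉ` is `Ric` plus first derivatives of `C` and quadratic terms in `C`.
By properness its components along `S(·,·,grad t)` and `dt²` cancel, and the remaining multiple of
`g` vanishes with the obstruction (`dual_ricci_algebra`).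

On a hypersurface, total symmetry of `C` makes the induced connection and `∇*` dual with respect to
`g`, so their curvatures are negatively adjoint. The Gauss equation then gives `(n-1) A = Ric* = 0`
(`weingarten_eq_zero`). With `Θ = 0` this yields `dξ = 0`, and connectedness makes `ξ` constant. -/

noncomputable section

namespace Abundant

/-! ### Contractions with an inverse metric at a point -/

section Contraction

variable {n : ℕ}

/-- The contraction of a bilinear form with a matrix. -/
def ctr (G : Matrix (Fin n) (Fin n) ℝ) (B : Fin n → Fin n → ℝ) : ℝ := ∑ i, ∑ j, G i j * B i j

/-- The full contraction of two bilinear forms with a matrix. -/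
def ctr₂ (G : Matrix (Fin n) (Fin n) ℝ) (A B : Fin n → Fin n → ℝ) : ℝ :=
  ctr G fun a c => ctr G fun b d => A a b * B c d

/-- `h` and `G` are mutually inverse symmetric matrices. -/
structure IsDualPair (h G : Matrix (Fin n) (Fin n) ℝ) : Prop where
  symm : ∀ i j, h i j = h j i
  symm_inv : ∀ i j, G i j = G j i
  inv_mul : ∀ a c, ∑ b, G a b * h b c = if a = c then 1 else 0

variable {h G : Matrix (Fin n) (Fin n) ℝ}

theorem ctr_add (X Y : Fin n → Fin n → ℝ) :
    ctr G (fun a b => X a b + Y a b) = ctr G (fun a b => X a b) + ctr G (fun a b => Y a b) := by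
  simp only [ctr, mul_add, Finset.sum_add_distrib]

theorem ctr_sub (X Y : Fin n → Fin n → ℝ) :
    ctr G (fun a b => X a b - Y a b) = ctr G (fun a b => X a b) - ctr G (fun a b => Y a b) := by
  simp only [ctr, mul_sub, Finset.sum_sub_distrib]

theorem ctr_const_mul (c : ℝ) (X : Fin n → Fin n → ℝ) :
    ctr G (fun a b => c * X a b) = c * ctr G (fun a b => X a b) := by
  simp only [ctr, Finset.mul_sum, mul_left_comm c]

theorem ctr_mul_const (c : ℝ) (X : Fin n → Fin n → ℝ) :
    ctr G (fun a b => X a b * c) = ctr G (fun a b => X a b) * c := by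
  simp only [ctr, Finset.sum_mul, mul_assoc]

theorem ctr_comm (X : Fin n → Fin n → Fin n → Fin n → ℝ) :
    ctr G (fun a b => ctr G (fun c d => X a b c d))
      = ctr G (fun c d => ctr G (fun a b => X a b c d)) := by
  have key : ∀ Y : Fin n → Fin n → Fin n → Fin n → ℝ,
      ∑ a, ∑ b, ∑ c, ∑ d, Y a b c d = ∑ c, ∑ d, ∑ a, ∑ b, Y a b c d := by
    intro Y
    have h1 : ∀ a, ∑ b, ∑ c, ∑ d, Y a b c d = ∑ c, ∑ d, ∑ b, Y a b c d := fun a => by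
      rw [Finset.sum_comm]; exact Finset.sum_congr rfl fun c _ => Finset.sum_comm
    rw [Finset.sum_congr rfl fun a _ => h1 a, Finset.sum_comm]
    exact Finset.sum_congr rfl fun c _ => Finset.sum_comm
  simp only [ctr, Finset.mul_sum]
  rw [key]
  simp only [mul_left_comm]

theorem ctr_congr {X Y : Fin n → Fin n → ℝ} (e : ∀ a b, X a b = Y a b) : ctr G X = ctr G Y := by
  simp only [ctr, e]

namespace IsDualPair

variable (H : IsDualPair h G)
include H

theorem mul_inv (a c : Fin n) : ∑ b, h a b * G b c = if a = c then 1 else 0 := by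
  have := H.inv_mul c a
  simp only [H.symm_inv c, H.symm _ a, mul_comm (G _ _)] at this
  rw [this]
  simp only [eq_comm]

theorem ctr_swap (X : Fin n → Fin n → ℝ) : ctr G (fun a b => X b a) = ctr G X := by
  simp only [ctr]
  rw [Finset.sum_comm]
  simp only [H.symm_inv]

/-- The inverse metric contracts the metric to the identity, so a contracted metric merely renames
an index. Most metrics inside contractions are eliminated through this rule. -/
theorem ctr_h_mul (i : Fin n) (f : Fin n → ℝ) : ctr G (fun a b => h i a * f b) = f i := by
  have h1 : ∀ b, ∑ a, G a b * (h i a * f b) = if b = i then f b else 0 := fun b => by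
    have h2 : (if b = i then f b else 0) = (if b = i then (1 : ℝ) else 0) * f b := by
      split_ifs <;> simp
    rw [h2, ← H.inv_mul, Finset.sum_mul]
    exact Finset.sum_congr rfl fun a _ => by rw [H.symm_inv, H.symm i]; ring
  simp only [ctr]
  rw [Finset.sum_comm]
  simp only [h1, Finset.sum_ite_eq', Finset.mem_univ, if_true]

theorem ctr_mul_h (i : Fin n) (f : Fin n → ℝ) : ctr G (fun a b => f a * h i b) = f i := by
  rw [← H.ctr_swap]
  simp only [mul_comm (f _)]
  exact H.ctr_h_mul i f

theorem ctr_self : ctr G (fun a b => h a b) = n := by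
  have h1 : ∀ a, ∑ b, G a b * h a b = 1 := fun a => by
    have := H.inv_mul a a
    simp only [H.symm _ a, if_true] at this
    exact this
  simp only [ctr, h1]
  simp

/-- Lowering an index and then tracing with the inverse metric is the trace of the endomorphism. It
links Ricci tensors to curvature tensors with all indices lowered. -/
theorem ctr_mul_metric (A : Fin n → Fin n → ℝ) :
    ctr G (fun i j => ∑ m, A i m * h m j) = ∑ i, A i i := by
  simp only [ctr]
  refine Finset.sum_congr rfl fun i _ => ?_
  simp only [Finset.mul_sum]
  rw [Finset.sum_comm]
  have h3 : ∀ m, ∑ j, G i j * (A i m * h m j) = A i m * if i = m then 1 else 0 := by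
    intro m
    rw [← H.inv_mul, Finset.mul_sum]
    exact Finset.sum_congr rfl fun j _ => by rw [H.symm m j]; ring
  simp [h3]

end IsDualPair

theorem ctr₂_add (A B C : Fin n → Fin n → ℝ) :
    ctr₂ G (fun a b => A a b + B a b) C = ctr₂ G (fun a b => A a b) C
      + ctr₂ G (fun a b => B a b) C := by
  simp only [ctr₂, add_mul, ctr_add]

theorem ctr₂_sub (A B C : Fin n → Fin n → ℝ) :
    ctr₂ G (fun a b => A a b - B a b) C = ctr₂ G (fun a b => A a b) C
      - ctr₂ G (fun a b => B a b) C := by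
  simp only [ctr₂, sub_mul, ctr_sub]

theorem ctr₂_const_mul (c : ℝ) (A C : Fin n → Fin n → ℝ) :
    ctr₂ G (fun a b => c * A a b) C = c * ctr₂ G (fun a b => A a b) C := by
  simp only [ctr₂, mul_assoc, ctr_const_mul]

theorem ctr₂_mul (f g : Fin n → ℝ) (C : Fin n → Fin n → ℝ) :
    ctr₂ G (fun a b => f a * g b) C
      = ctr G (fun a c => f a * ctr G (fun b d => g b * C c d)) := by
  simp only [ctr₂, mul_assoc, ctr_const_mul]

theorem ctr₂_transpose (A C : Fin n → Fin n → ℝ) (hC : ∀ i j, C i j = C j i) :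
    ctr₂ G (fun a b => A b a) C = ctr₂ G A C := by
  simp only [ctr₂]
  rw [ctr_comm]
  exact ctr_congr fun a b => ctr_congr fun c d => by rw [hC]

namespace IsDualPair

variable (H : IsDualPair h G)
include H

theorem ctr₂_comm (A C : Fin n → Fin n → ℝ) : ctr₂ G A C = ctr₂ G C A := by
  simp only [ctr₂]
  rw [← H.ctr_swap]
  refine ctr_congr fun a b => ?_
  rw [← H.ctr_swap]
  simp only [mul_comm]

theorem ctr₂_h_mul (i : Fin n) (g : Fin n → ℝ) (C : Fin n → Fin n → ℝ) :
    ctr₂ G (fun a b => h i a * g b) C = ctr G (fun b d => g b * C i d) := by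
  rw [ctr₂_mul]
  exact H.ctr_h_mul i fun c => ctr G (fun b d => g b * C c d)

theorem ctr₂_mul_h (i : Fin n) (f : Fin n → ℝ) (C : Fin n → Fin n → ℝ) :
    ctr₂ G (fun a b => f a * h i b) C = ctr G (fun a c => f a * C c i) := by
  rw [ctr₂_mul]
  simp only [H.ctr_h_mul]

theorem ctr₂_self (C : Fin n → Fin n → ℝ) : ctr₂ G (fun a b => h a b) C = ctr G C := by
  simp only [ctr₂, H.ctr_h_mul]
  exact H.ctr_swap C

end IsDualPair
end Contraction

/-! ### Quadratic contractions of a harmonic cubic form -/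

section CubicForm

variable {n : ℕ}

/-- `h(S_X Y, S_Z W)`, where `G` is the inverse metric. -/
def quad (G : Matrix (Fin n) (Fin n) ℝ) (S : Fin n → Fin n → Fin n → ℝ) (i j k l : Fin n) : ℝ :=
  ctr G fun a b => S i j a * S k l b

/-- The trace form `tr (S_X S_Y)`. -/
def gram (G : Matrix (Fin n) (Fin n) ℝ) (S : Fin n → Fin n → Fin n → ℝ) (i j : Fin n) : ℝ :=
  ctr G fun a b => quad G S i a j b

/-- The bilinear form `S(X, Y, grad t)`. -/
def along (G : Matrix (Fin n) (Fin n) ℝ) (S : Fin n → Fin n → Fin n → ℝ) (t : Fin n → ℝ)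
    (i j : Fin n) : ℝ :=
  ctr G fun a b => S i j a * t b

/-- A totally symmetric trace-free cubic form. -/
structure IsHarmonicCubic (G : Matrix (Fin n) (Fin n) ℝ) (S : Fin n → Fin n → Fin n → ℝ) :
    Prop where
  left : ∀ i j k, S i j k = S j i k
  right : ∀ i j k, S i j k = S i k j
  traceless : ∀ k, ctr G (fun i j => S i j k) = 0

variable {h G : Matrix (Fin n) (Fin n) ℝ} {S : Fin n → Fin n → Fin n → ℝ} {t : Fin n → ℝ}

namespace IsHarmonicCubic

variable (K : IsHarmonicCubic G S)
include K

theorem cyc (i j k : Fin n) : S i j k = S k i j := by rw [K.right, K.left]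

theorem traceless₁₃ (i : Fin n) : ctr G (fun a b => S a i b) = 0 := by
  simp only [K.right _ i]; exact K.traceless i

theorem traceless₂₃ (i : Fin n) : ctr G (fun a b => S i a b) = 0 := by
  simp only [K.left i]; exact K.traceless₁₃ i

theorem quad_left (i j k l : Fin n) : quad G S i j k l = quad G S j i k l := by
  simp only [quad, K.left i j]

theorem quad_right (i j k l : Fin n) : quad G S i j k l = quad G S i j l k := by
  simp only [quad, K.left k l]

theorem along_symm (i j : Fin n) : along G S t i j = along G S t j i := by
  simp only [along, K.left i j]

theorem quad_trace_left (c d : Fin n) : ctr G (fun p q => quad G S p q c d) = 0 := by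
  simp only [quad]
  rw [ctr_comm]
  simp only [ctr_mul_const, K.traceless]
  simp [ctr]

theorem along_trace : ctr G (fun p q => along G S t p q) = 0 := by
  simp only [along]
  rw [ctr_comm]
  simp only [ctr_mul_const, K.traceless]
  simp [ctr]

theorem quad_trace₁₃ (c d : Fin n) : ctr G (fun p q => quad G S p c q d) = gram G S c d := by
  simp only [K.quad_left _ c, K.quad_right _ _ _ d]
  rfl

theorem quad_trace₁₄ (c d : Fin n) : ctr G (fun p q => quad G S p c d q) = gram G S c d := by
  simp only [K.quad_left _ c]
  rfl

theorem quad_trace₂₃ (c d : Fin n) : ctr G (fun p q => quad G S c p q d) = gram G S c d := by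
  simp only [K.quad_right _ _ _ d]
  rfl

end IsHarmonicCubic

theorem gram_eq_ctr₂ (i j : Fin n) : gram G S i j = ctr₂ G (S i) (S j) := rfl

theorem IsDualPair.quad_swap (H : IsDualPair h G) (i j k l : Fin n) :
    quad G S i j k l = quad G S k l i j := by
  simp only [quad]
  rw [← H.ctr_swap]
  simp only [mul_comm]

theorem IsDualPair.gram_symm (H : IsDualPair h G) (i j : Fin n) :
    gram G S i j = gram G S j i := by
  simp only [gram]
  rw [← H.ctr_swap]
  simp only [H.quad_swap i]

namespace IsHarmonicCubic

variable (K : IsHarmonicCubic G S) (H : IsDualPair h G)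
include K H

theorem quad_trace_right (c d : Fin n) : ctr G (fun p q => quad G S c d p q) = 0 := by
  simp only [H.quad_swap c d]
  exact K.quad_trace_left c d

/-- Reordering the contractions pairs two factors `S` along two indices first, which is a Gram
matrix. A cubic expression in `S` thus becomes one that properness can reduce. -/
theorem ctr₂_quad (i j l : Fin n) : ctr₂ G (fun a b => quad G S a b i l) (S j)
    = ctr G (fun a b => gram G S j a * S i l b) := by
  have h1 : ∀ a c, ctr G (fun b d => quad G S a b i l * S j c d)
      = ctr G (fun e f => ctr G (fun b d => S e a b * S i l f * S j c d)) := fun a c => by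
    simp only [quad, ← ctr_mul_const]
    rw [ctr_comm]
    simp only [← K.cyc]
  simp only [ctr₂, h1]
  rw [ctr_comm]
  refine ctr_congr fun e f => ?_
  rw [H.gram_symm j, gram_eq_ctr₂]
  simp only [ctr₂, ← ctr_mul_const]
  refine ctr_congr fun a c => ctr_congr fun b d => ?_
  ring

end IsHarmonicCubic
end CubicForm

/-! ### The derivative of the properness condition as a pointwise identity -/

section PointwiseAlgebra

variable {n : ℕ} {h G : Matrix (Fin n) (Fin n) ℝ} {S : Fin n → Fin n → Fin n → ℝ} {t : Fin n → ℝ}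

/-- The normal form of `3 ∇S` for a proper abundant structure. -/
def properDeriv (h G : Matrix (Fin n) (Fin n) ℝ) (S : Fin n → Fin n → Fin n → ℝ) (t : Fin n → ℝ)
    (ν χ : ℝ) (i j k l : Fin n) : ℝ :=
  quad G S j k i l + S i j l * t k + t i * S l j k + S i l k * t j + t l * S i j k
    + h i l * (along G S t j k + 2 * (t j * t k) + χ * h j k)
    + t i * (t j * h l k + h l j * t k)
    + ν * (h i j * h l k + h l j * h i k)
    - h i j * along G S t l k - t l * (h i j * t k) - along G S t l j * h i k - t l * (t j * h i k)

theorem ctr_along_mul (H : IsDualPair h G) (j i l : Fin n) : ctr G (fun a b => S i l a * along G S t j b)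
    = ctr G (fun a b => along G S t j a * S i l b) := by
  rw [← H.ctr_swap]
  simp only [mul_comm]

variable (K : IsHarmonicCubic G S) (H : IsDualPair h G)
include K H

/-- One half of `3 ∇𝒮`. Every term is a contraction against `S_j`; those producing a Gram matrix are
reduced by `hg`. The only contractions left that involve two factors `S` and no second `dt` are
`S(j,·,grad t)` against `S(i,l,·)` and the same with `j` and `l` exchanged. -/
theorem ctr₂_properDeriv {ρ ν χ : ℝ}
    (hg : ∀ i j, gram G S i j = ((n : ℝ) - 2) * (along G S t i j + t i * t j) + ρ * h i j)
    (i j l : Fin n) :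
    ctr₂ G (fun a b => properDeriv h G S t ν χ i a b l) (S j)
      = (n : ℝ) * ctr G (fun a b => along G S t j a * S i l b)
        - 2 * ctr G (fun a b => along G S t l a * S i j b)
        + ((n : ℝ) - 2) * (t j * along G S t i l) + (ρ + 2 * ν) * S i j l
        + (((n : ℝ) - 2) * (along G S t l j + t l * t j) + ρ * h l j) * t i
        + (((n : ℝ) - 2) * (along G S t i j + t i * t j) + ρ * h i j) * t l
        + h i l * ((n : ℝ) * ctr G (fun a b => along G S t j a * t b)
          + (((n : ℝ) - 2) * ctr G (fun a b => t a * t b) + ρ) * t j)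
        + 2 * (t i * along G S t j l) - 2 * (t l * along G S t i j) := by
  have hS : ∀ a b, S j a b = S j b a := K.right j
  have e1 := K.ctr₂_quad H i j l
  simp only [hg, add_mul, mul_assoc, ctr_add, ctr_const_mul, H.ctr_h_mul] at e1
  have e1' : ctr G (fun a b => t a * S i l b) = along G S t i l := by
    rw [← H.ctr_swap]; simp only [along, mul_comm]
  have e2 : ctr₂ G (fun a b => S i a l * t b) (S j)
      = ctr G (fun a b => along G S t j a * S i l b) := by
    rw [ctr₂_mul, ← ctr_along_mul H]
    refine ctr_congr fun a b => ?_
    rw [K.right i a l]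
    congr 1
    rw [along, ← H.ctr_swap]
    simp only [mul_comm]
  have e3 : ctr₂ G (fun a b => S i l b * t a) (S j)
      = ctr G (fun a b => along G S t j a * S i l b) := by
    rw [← e2, ← ctr₂_transpose _ _ hS]
    simp only [K.right i]
  have e4 : ctr₂ G (fun a b => S l a b) (S j) = gram G S l j := rfl
  have e5 : ctr₂ G (fun a b => S i a b) (S j) = gram G S i j := rfl
  have e6 : ctr₂ G (fun a b => along G S t a b) (S j) = ctr G (fun a b => gram G S j a * t b) := by
    have : ∀ a b, along G S t a b = ctr G (fun e f => S a b e * t f) := fun a b => rfl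
    have h1 : ∀ a c, ctr G (fun b d => along G S t a b * S j c d)
        = ctr G (fun e f => ctr G (fun b d => S e a b * t f * S j c d)) := fun a c => by
      simp only [along, ← ctr_mul_const]
      rw [ctr_comm]
      simp only [← K.cyc]
    simp only [ctr₂, h1]
    rw [ctr_comm]
    refine ctr_congr fun e f => ?_
    rw [H.gram_symm j, gram_eq_ctr₂]
    simp only [ctr₂, ← ctr_mul_const]
    refine ctr_congr fun a c => ctr_congr fun b d => ?_
    ring
  simp only [hg, add_mul, mul_assoc, ctr_add, ctr_const_mul, H.ctr_h_mul] at e6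
  have e7 : ctr₂ G (fun a b => t a * t b) (S j) = ctr G (fun a b => along G S t j a * t b) := by
    rw [ctr₂_mul, ← H.ctr_swap]
    refine ctr_congr fun a b => ?_
    rw [mul_comm, along, ← H.ctr_swap]
    simp only [mul_comm]
  have e8 : ctr₂ G (fun a b => χ * h a b) (S j) = 0 := by
    have h1 : ctr G (S j) = 0 := K.traceless₂₃ j
    rw [ctr₂_const_mul χ (fun a b => h a b), H.ctr₂_self, h1, mul_zero]
  have e9 : ctr₂ G (fun a b => t a * h l b) (S j) = along G S t j l := by
    rw [H.ctr₂_mul_h, ← H.ctr_swap]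
    simp only [along, mul_comm, K.right j l]
  have e10 : ctr₂ G (fun a b => h l a * t b) (S j) = along G S t j l := by
    rw [H.ctr₂_h_mul, ← H.ctr_swap]
    simp only [along, mul_comm]
  have e11 : ctr₂ G (fun a b => h i a * h l b) (S j) = S i j l := by
    rw [H.ctr₂_mul_h]
    simp only [H.ctr_h_mul]
    rw [K.left]
  have e12 : ctr₂ G (fun a b => h l a * h i b) (S j) = S i j l := by
    rw [H.ctr₂_mul_h]
    simp only [H.ctr_h_mul]
    rw [K.right, K.cyc, K.right]
    exact (K.cyc i j l).symm
  have e13 : ctr₂ G (fun a b => h i a * along G S t l b) (S j)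
      = ctr G (fun a b => along G S t l a * S i j b) := by
    rw [H.ctr₂_h_mul]
    simp only [K.left j]
  have e14 : ctr₂ G (fun a b => h i a * t b) (S j) = along G S t i j := by
    rw [H.ctr₂_h_mul, ← H.ctr_swap]
    simp only [along, mul_comm, K.left j]
  have e15 : ctr₂ G (fun a b => along G S t l a * h i b) (S j)
      = ctr G (fun a b => along G S t l a * S i j b) := by
    rw [H.ctr₂_mul_h]
    simp only [K.right _ _ i, K.left j]
  have e16 : ctr₂ G (fun a b => t a * h i b) (S j) = along G S t i j := by
    rw [H.ctr₂_mul_h, ← H.ctr_swap]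
    simp only [along, mul_comm, K.right _ _ i, K.left j]
  simp only [properDeriv, mul_add, ctr₂_add, ctr₂_sub, ctr₂_const_mul, e1, e2, e3, e4, e5, e6, e7,
    e8, e9, e10, e11, e12, e13, e14, e15, e16, e1', hg, K.right i l j, K.along_symm l j]
  ring

theorem ctr_properDeriv {ν χ : ℝ} (i j l : Fin n) :
    ctr G (fun a b => t a * properDeriv h G S t ν χ i j b l)
      = ctr G (fun a b => along G S t j a * S i l b) + ctr G (fun a b => t a * t b) * S i j l
        + t i * along G S t l j + t j * along G S t i l + t l * along G S t i j
        + h i l * (ctr G (fun a b => along G S t j a * t b)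
          + (2 * ctr G (fun a b => t a * t b) + χ) * t j)
        + t i * (t j * t l + h l j * ctr G (fun a b => t a * t b))
        + ν * (h i j * t l + h l j * t i)
        - h i j * (ctr G (fun a b => along G S t l a * t b) + ctr G (fun a b => t a * t b) * t l)
        - (along G S t l j + t l * t j) * t i := by
  have hsw : ∀ f : Fin n → ℝ, ctr G (fun a b => t a * f b) = ctr G (fun a b => f a * t b) := by
    intro f; rw [← H.ctr_swap]; simp only [mul_comm]
  have e1 : ctr G (fun a b => t a * quad G S j b i l)
      = ctr G (fun a b => along G S t j a * S i l b) := by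
    simp only [quad, along, ← ctr_mul_const, ← ctr_const_mul]
    rw [ctr_comm]
    refine ctr_congr fun a b => ?_
    rw [← H.ctr_swap]
    refine ctr_congr fun c d => ?_
    rw [K.right j c a]
    ring
  have e2 : ∀ j, ctr G (fun a b => t a * h j b) = t j := fun j => H.ctr_mul_h j t
  have e3 : ∀ i j, ctr G (fun a b => t a * S i j b) = along G S t i j := fun i j => by
    rw [hsw]; rfl
  have e4 : ∀ i l, ctr G (fun a b => t a * S i l b) = along G S t i l := fun i l => by
    rw [hsw]; rfl
  have e5 : ∀ j, ctr G (fun a b => t a * along G S t j b)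
      = ctr G (fun a b => along G S t j a * t b) := fun j => hsw _
  have c1 : ∀ (c : ℝ) (f : Fin n → ℝ), ctr G (fun a b => t a * (c * f b))
      = c * ctr G (fun a b => t a * f b) := fun c f => by
    simp only [mul_left_comm (t _) c, ctr_const_mul]
  have c2 : ∀ (c : ℝ) (f : Fin n → ℝ), ctr G (fun a b => t a * (f b * c))
      = ctr G (fun a b => t a * f b) * c := fun c f => by
    simp only [← mul_assoc, ctr_mul_const]
  simp only [properDeriv, mul_add, mul_sub, ctr_add, ctr_sub, c1, c2, e1, e2, e3, e5]
  simp only [K.along_symm l j]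
  ring

/-- The Weyl identity contracted with `grad t` in its first slot. It permutes the indices of the
contraction of `S(·,·,grad t)` with `S` up to terms of lower degree in `S` and terms with the metric
as a factor. -/
theorem along_weyl {μ : ℝ}
    (hW : ∀ i j k l, quad G S i k j l - quad G S i l j k
      = (μ * h i k - (along G S t i k + t i * t k)) * h j l
        + (μ * h j l - (along G S t j l + t j * t l)) * h i k
        - (μ * h i l - (along G S t i l + t i * t l)) * h j k
        - (μ * h j k - (along G S t j k + t j * t k)) * h i l) (j i l : Fin n) :
    ctr G (fun a b => along G S t j a * S i l b) - ctr G (fun a b => along G S t l a * S i j b)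
      = (2 * μ * t j - ctr G (fun a b => along G S t j a * t b)
          - ctr G (fun a b => t a * t b) * t j) * h i l
        - (2 * μ * t l - ctr G (fun a b => along G S t l a * t b)
          - ctr G (fun a b => t a * t b) * t l) * h i j
        - (along G S t i l + t i * t l) * t j + (along G S t i j + t i * t j) * t l := by
  have hsw : ∀ f : Fin n → ℝ, ctr G (fun a b => t a * f b) = ctr G (fun a b => f a * t b) := by
    intro f; rw [← H.ctr_swap]; simp only [mul_comm]
  have e1 : ∀ j i l, ctr G (fun a b => t a * quad G S b j i l)
      = ctr G (fun a b => along G S t j a * S i l b) := fun j i l => by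
    simp only [quad, along, ← ctr_mul_const, ← ctr_const_mul]
    rw [ctr_comm]
    refine ctr_congr fun a b => ?_
    rw [← H.ctr_swap]
    refine ctr_congr fun c d => ?_
    rw [K.left c j a, K.right j c a]
    ring
  have e2 : ∀ j, ctr G (fun a b => t a * h b j) = t j := fun j => by
    simp only [H.symm _ j]
    exact H.ctr_mul_h j t
  have e5 : ∀ j, ctr G (fun a b => t a * along G S t b j)
      = ctr G (fun a b => along G S t j a * t b) := fun j => by
    simp only [K.along_symm _ j]
    exact hsw _
  have c1 : ∀ (c : ℝ) (f : Fin n → ℝ), ctr G (fun a b => t a * (c * f b))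
      = c * ctr G (fun a b => t a * f b) := fun c f => by
    simp only [mul_left_comm (t _) c, ctr_const_mul]
  have c2 : ∀ (c : ℝ) (f : Fin n → ℝ), ctr G (fun a b => t a * (f b * c))
      = ctr G (fun a b => t a * f b) * c := fun c f => by
    simp only [← mul_assoc, ctr_mul_const]
  have key := ctr_congr (G := G) fun a b => congrArg (t a * ·) (hW b i j l)
  simp only [mul_add, mul_sub, add_mul, sub_mul, ctr_add, ctr_sub, mul_assoc, c1, c2, e1, e2,
    e5] at key
  linear_combination key

/-- The consequence of differentiating the properness condition once. -/
theorem properness_deriv {ρ ν μ lam : ℝ} {L : Fin n → ℝ}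
    (hg : ∀ i j, gram G S i j = ((n : ℝ) - 2) * (along G S t i j + t i * t j) + ρ * h i j)
    (hW : ∀ i j k l, quad G S i k j l - quad G S i l j k
      = (μ * h i k - (along G S t i k + t i * t k)) * h j l
        + (μ * h j l - (along G S t j l + t j * t l)) * h i k
        - (μ * h i l - (along G S t i l + t i * t l)) * h j k
        - (μ * h j k - (along G S t j k + t j * t k)) * h i l)
    {Hs : Fin n → Fin n → ℝ} {D : Fin n → Fin n → Fin n → Fin n → ℝ}
    (hD : ∀ i j k l, D i j k l = (1 / 3) * properDeriv h G S t ν (ν - 2 * μ) i j k l)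
    (hHs : ∀ i j, Hs i j = (1 / 3) * along G S t i j + (2 / 3) * (t i * t j) + lam * h i j)
    (hL : ∀ i j l, ctr₂ G (fun a b => D i a b l) (S j) + ctr₂ G (S i) (fun a b => D j a b l)
      - ((n : ℝ) - 2) * (ctr G (fun a b => Hs l a * S i j b)
        + ctr G (fun a b => t a * D i j b l) + Hs l i * t j + t i * Hs l j) = L l * h i j)
    : ∃ v : Fin n → ℝ, ∀ i j l,
      (2 * ρ + 4 * ν - ((n : ℝ) - 2) * (ctr G (fun a b => t a * t b) + 3 * lam))
          * S i j l
        + (2 * ρ - 2 * ctr G (fun a b => t a * t b) + 2 * n * μ - ((n : ℝ) - 2) *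
          (ν + ctr G (fun a b => t a * t b) + 3 * lam)) * (h i l * t j + h j l * t i)
      = h i j * v l := by
  have hS : ∀ j a b, S j a b = S j b a := K.right
  refine ⟨fun l => 3 * L l - (2 * ρ * t l - ((n : ℝ) + 2) * (2 * μ * t l
    - ctr G (fun a b => along G S t l a * t b) - ctr G (fun a b => t a * t b) * t l)
    - ((n : ℝ) - 2) * (ν * t l - ctr G (fun a b => along G S t l a * t b)
    - ctr G (fun a b => t a * t b) * t l)), fun i j l => ?_⟩
  have a1 := ctr₂_properDeriv K H (ν := ν) (χ := ν - 2 * μ) hg i j l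
  have a2 := ctr₂_properDeriv K H (ν := ν) (χ := ν - 2 * μ) hg j i l
  have a3 := ctr_properDeriv K H (t := t) (ν := ν) (χ := ν - 2 * μ) i j l
  have a4 : ctr G (fun a b => Hs l a * S i j b) = (1 / 3) * ctr G (fun a b => along G S t l a * S i j b)
      + (2 / 3) * (t l * along G S t i j) + lam * S i j l := by
    have e : ctr G (fun a b => t a * S i j b) = along G S t i j := by
      rw [← H.ctr_swap]; simp only [along, mul_comm]
    simp only [hHs, add_mul, mul_assoc, ctr_add, ctr_const_mul, H.ctr_h_mul, e]
  have w1 := along_weyl K H hW j i l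
  have w2 := along_weyl K H hW i j l
  have key := hL i j l
  rw [H.ctr₂_comm (S i)] at key
  have c1 : ctr G (fun a b => t a * D i j b l)
      = (1 / 3) * ctr G (fun a b => t a * properDeriv h G S t ν (ν - 2 * μ) i j b l) := by
    simp only [hD, mul_left_comm (t _), ctr_const_mul]
  simp only [c1, a4] at key
  simp only [hD, ctr₂_const_mul, a1, a2, a3, hHs] at key
  simp only [K.along_symm j i, K.along_symm l i, K.along_symm l j, H.symm l i, H.symm l j, H.symm j i, K.left j i] at *
  -- The factor 3 clears the `1/3` in `hD`. Writing `Q(j; i l)` for the contraction of `S(j,·,grad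
  -- t)` with `S(i,l,·)`, what occurs is `2 Q(j; i l) + n Q(i; j l) - (n+2) Q(l; i j)`. Its
  -- coefficients add up to zero, so `2 w1 + n w2` removes it completely.
  linear_combination 3 * key - 2 * w1 - n * w2

/-- `S` is trace-free, so the trace over `i, j` gives `2 q t = n v` and the trace over `i, l` gives
`(n+1) q t = v`. Hence `(n(n+1) - 2) q t = 0`, and the factor `(n-1)(n+2)` is positive. Then `v = 0`
as well, and only the term in `S` survives. -/
theorem cubic_eq_zero_of_mul_trace (hn : 2 ≤ n) {p q : ℝ} {v : Fin n → ℝ}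
    (hv : ∀ i j l, p * S i j l + q * (h i l * t j + h j l * t i) = h i j * v l) :
    (∀ i, q * t i = 0) ∧ ∀ i j k, p * S i j k = 0 := by
  have hn' : (2 : ℝ) ≤ n := by exact_mod_cast hn
  have e1 : ∀ l, 2 * (q * t l) = n * v l := fun l => by
    have key := ctr_congr (G := G) fun a b => hv a b l
    have h1 : ctr G (fun a b => h a l * t b) = t l := by
      simp only [H.symm _ l]; exact H.ctr_h_mul l t
    have h2 : ctr G (fun a b => h b l * t a) = t l := by
      rw [H.ctr_swap fun a b => h a l * t b]; exact h1
    rw [ctr_add, ctr_const_mul, K.traceless, ctr_const_mul, ctr_add, h1, h2,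
      ctr_mul_const (v l) fun a b => h a b, H.ctr_self] at key
    linarith
  have e2 : ∀ j, q * ((n + 1) * t j) = v j := fun j => by
    have key := ctr_congr (G := G) fun a b => hv a j b
    have h1 : ctr G (fun a b => h j b * t a) = t j := by
      rw [H.ctr_swap fun a b => h j a * t b]; exact H.ctr_h_mul j t
    have h3 : ctr G (fun a b => h a j * v b) = v j := by
      simp only [H.symm _ j]; exact H.ctr_h_mul j v
    rw [ctr_add, ctr_const_mul, K.traceless₁₃, ctr_const_mul, ctr_add, h1, h3,
      ctr_mul_const (t j) fun a b => h a b, H.ctr_self] at key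
    linarith
  have e3 : ∀ i, q * t i = 0 := fun i => by
    have h1 : (q * t i) * ((n : ℝ) * (n + 1) - 2) = 0 := by
      linear_combination (n : ℝ) * e2 i - e1 i
    refine (mul_eq_zero.1 h1).resolve_right (ne_of_gt ?_)
    nlinarith
  refine ⟨e3, fun i j k => ?_⟩
  have h1 := hv i j k
  have h2 := e2 k
  have h3 := e3 k
  have h4 := e3 j
  have h5 := e3 i
  linear_combination h1 - h i k * h4 - h j k * h5 - h i j * h2 + h i j * (n + 1) * h3

end PointwiseAlgebra

/-! ### Translation of the coordinate formulas into contractions -/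

section Components

variable {n : ℕ} {h : Euc n → Matrix (Fin n) (Fin n) ℝ}
  {S : Euc n → Fin n → Fin n → Fin n → ℝ} {t : Euc n → ℝ} {y : Euc n}

theorem trace_eq_ctr (B : Fin n → Fin n → ℝ) : trace h y B = ctr (invMetric h y) B := rfl

theorem sum_raise_mul (i j : Fin n) (x : Fin n → ℝ) :
    ∑ k, raise h S y i j k * x k = ctr (invMetric h y) (fun a b => S y i j a * x b) := by
  simp only [raise, ctr, Finset.sum_mul]
  rw [Finset.sum_comm]
  exact Finset.sum_congr rfl fun a _ => Finset.sum_congr rfl fun b _ => by ring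

variable (K : IsHarmonicCubic (invMetric h y) (S y)) (H : IsDualPair (h y) (invMetric h y))

theorem gradSq_eq : gradSq h t y
    = ctr (invMetric h y) (fun a b => pd t a y * pd t b y) := by
  simp only [gradSq, grad, ctr, Finset.sum_mul]
  exact Finset.sum_congr rfl fun a _ => Finset.sum_congr rfl fun b _ => by ring

theorem sum_mul_grad (i j : Fin n) :
    ∑ m, S y i j m * grad h t y m = along (invMetric h y) (S y) (fun a => pd t a y) i j := by
  simp only [grad, along, ctr, Finset.mul_sum]
  exact Finset.sum_congr rfl fun a _ => Finset.sum_congr rfl fun b _ => by ring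

/-- Two different fields are allowed because differentiating `tr (S_X S_Y)` produces mixed traces of
`S` with `∇S`. -/
theorem sum_raise_mul_raise (H : IsDualPair (h y) (invMetric h y))
    {T : Euc n → Fin n → Fin n → Fin n → ℝ} {i : Fin n} (hS : ∀ a b, S y i a b = S y i b a)
    (j : Fin n) : ∑ a, ∑ b, raise h S y i a b * raise h T y j b a
      = ctr₂ (invMetric h y) (S y i) (T y j) := by
  have h1 : ∀ a, ∑ b, raise h S y i a b * raise h T y j b a
      = ctr (invMetric h y) (fun b d => S y i a b * raise h T y j d a) :=
    fun a => sum_raise_mul i a fun b => raise h T y j b a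
  have h2 : ∑ a, ctr (invMetric h y) (fun b d => S y i a b * raise h T y j d a)
      = ctr (invMetric h y) (fun b d => ∑ a, raise h T y j d a * S y i a b) := by
    simp only [ctr]
    rw [Finset.sum_comm]
    refine Finset.sum_congr rfl fun b _ => ?_
    rw [Finset.sum_comm]
    refine Finset.sum_congr rfl fun d _ => ?_
    rw [Finset.mul_sum]
    exact Finset.sum_congr rfl fun a _ => by ring
  simp only [h1]
  rw [h2]
  simp only [sum_raise_mul, ctr₂]
  refine ctr_congr fun a b => ?_
  rw [← H.ctr_swap]
  refine ctr_congr fun c d => ?_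
  rw [hS c a, mul_comm]

include K H in
theorem scrS_eq (i j : Fin n) : scrS h S y i j = gram (invMetric h y) (S y) i j :=
  sum_raise_mul_raise H (K.right i) j

theorem normSq_eq : normSq h S y = ctr (invMetric h y) (gram (invMetric h y) (S y)) := by
  simp only [normSq, gram, quad, ctr, Finset.mul_sum]
  refine Finset.sum_congr rfl fun i _ => ?_
  have e1 : ∀ F : Fin n → Fin n → Fin n → Fin n → Fin n → ℝ,
      ∑ j, ∑ k, ∑ a, ∑ b, ∑ c, F j k a b c = ∑ a, ∑ j, ∑ b, ∑ k, ∑ c, F j k a b c := fun F => by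
    have h1 : ∀ j, ∑ k, ∑ a, ∑ b, ∑ c, F j k a b c = ∑ a, ∑ b, ∑ k, ∑ c, F j k a b c := fun j => by
      rw [Finset.sum_comm]
      exact Finset.sum_congr rfl fun a _ => Finset.sum_comm
    rw [Finset.sum_congr rfl fun j _ => h1 j, Finset.sum_comm]
  rw [e1]
  refine Finset.sum_congr rfl fun a _ => Finset.sum_congr rfl fun j _ =>
    Finset.sum_congr rfl fun b _ => Finset.sum_congr rfl fun k _ =>
    Finset.sum_congr rfl fun c _ => by ring

include H in
theorem frakS_eq (i j k l : Fin n) :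
    frakS h S y i j k l = quad (invMetric h y) (S y) i j k l := by
  have h1 : ∀ a, ∑ b, h y a b * raise h S y i j a * raise h S y k l b
      = raise h S y i j a * S y k l a := fun a => by
    have h2 := sum_raise_mul (h := h) (S := S) (y := y) k l fun b => h y a b
    rw [H.ctr_mul_h] at h2
    rw [← h2, Finset.mul_sum]
    exact Finset.sum_congr rfl fun b _ => by ring
  simp only [frakS, h1, sum_raise_mul, quad]

/-- The coefficient of the metric in the tensor `S₁`. -/
def coeffForm (G : Matrix (Fin n) (Fin n) ℝ) (S : Fin n → Fin n → Fin n → ℝ) (t : Fin n → ℝ)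
    (i j : Fin n) : ℝ :=
  4 / ((n : ℝ) - 2) * gram G S i j - 3 * along G S t i j

/-- The trace of the symmetrisation of `S₁`. -/
def traceForm (h G : Matrix (Fin n) (Fin n) ℝ) (S : Fin n → Fin n → Fin n → ℝ) (t : Fin n → ℝ)
    (i j : Fin n) : ℝ :=
  2 / 3 * gram G S i j + 2 * along G S t i j + 2 / 3 * coeffForm G S t i j
    + 1 / 3 * ctr G (coeffForm G S t) * h i j

include K in
theorem tensorS₁_eq (hS : scrS h S y = gram (invMetric h y) (S y)) (i j k l : Fin n) :
    tensorS₁ h S t y i j k l = quad (invMetric h y) (S y) j k i l + 3 * S y i j l * pd t k y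
      + S y i j k * pd t l y
      + coeffForm (invMetric h y) (S y) (fun a => pd t a y) j k * h y i l := by
  simp only [tensorS₁, sum_raise_mul, sum_mul_grad, hS, coeffForm, quad, K.right i _ l]

include K H in
theorem sym₃_tensorS₁ (hS : scrS h S y = gram (invMetric h y) (S y)) (i j k l : Fin n) :
    sym₃ (tensorS₁ h S t y) i j k l
      = 1 / 3 * (quad (invMetric h y) (S y) j k i l + quad (invMetric h y) (S y) i j k l
          + quad (invMetric h y) (S y) i k j l)
        + S y i j l * pd t k y + S y j k l * pd t i y + S y i k l * pd t j y + S y i j k * pd t l y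
        + 1 / 3 * (coeffForm (invMetric h y) (S y) (fun a => pd t a y) j k * h y i l
          + coeffForm (invMetric h y) (S y) (fun a => pd t a y) i k * h y j l
          + coeffForm (invMetric h y) (S y) (fun a => pd t a y) i j * h y k l) := by
  have hc : ∀ i j, coeffForm (invMetric h y) (S y) (fun a => pd t a y) i j
      = coeffForm (invMetric h y) (S y) (fun a => pd t a y) j i := fun i j => by
    simp only [coeffForm, H.gram_symm i j, K.along_symm i j]
  have s1 : S y j k i = S y i j k := (K.cyc j k i).trans rfl
  have s4 : S y i k j = S y i j k := K.right i k j
  simp only [sym₃, tensorS₁_eq K hS, hc j i, hc k i, hc k j, K.quad_left j i, K.quad_left k i,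
    K.quad_left k j, K.left j i, K.left k i, K.left k j, s1, s4]
  ring

include K H in
theorem trace_sym₃_tensorS₁ (hS : scrS h S y = gram (invMetric h y) (S y)) (c d : Fin n) :
    trace h y (fun p q => sym₃ (tensorS₁ h S t y) p q c d)
      = traceForm (h y) (invMetric h y) (S y) (fun a => pd t a y) c d := by
  have hc : ∀ i j, coeffForm (invMetric h y) (S y) (fun a => pd t a y) i j
      = coeffForm (invMetric h y) (S y) (fun a => pd t a y) j i := fun i j => by
    simp only [coeffForm, H.gram_symm i j, K.along_symm i j]
  have e1 : ctr (invMetric h y) (fun a b => quad (invMetric h y) (S y) b c a d)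
      = gram (invMetric h y) (S y) c d := by
    rw [H.ctr_swap fun a b => quad (invMetric h y) (S y) a c b d]; exact K.quad_trace₁₃ c d
  have e2 : ctr (invMetric h y) (fun a b => S y b c d * pd t a y)
      = along (invMetric h y) (S y) (fun a => pd t a y) c d := by
    rw [H.ctr_swap fun a b => S y a c d * pd t b y]
    simp only [← K.cyc]; rfl
  have e3 : ctr (invMetric h y) (fun a b => S y a c d * pd t b y)
      = along (invMetric h y) (S y) (fun a => pd t a y) c d := by
    simp only [← K.cyc]; rfl
  have e4 : ctr (invMetric h y) (fun a b =>
      coeffForm (invMetric h y) (S y) (fun a => pd t a y) b c * h y a d)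
      = coeffForm (invMetric h y) (S y) (fun a => pd t a y) c d := by
    simp only [H.symm _ d, mul_comm _ (h y d _)]
    rw [H.ctr_h_mul, hc]
  have e5 : ctr (invMetric h y) (fun a b =>
      coeffForm (invMetric h y) (S y) (fun a => pd t a y) a c * h y b d)
      = coeffForm (invMetric h y) (S y) (fun a => pd t a y) c d := by
    simp only [H.symm _ d]
    rw [H.ctr_mul_h d fun a => coeffForm (invMetric h y) (S y) (fun a => pd t a y) a c, hc]
  simp only [trace_eq_ctr, sym₃_tensorS₁ K H hS, ctr_add, ctr_const_mul, ctr_mul_const, e1, e2, e3,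
    e4, e5, K.quad_trace_left, K.quad_trace₁₃, K.traceless, traceForm]
  ring

/-- The components of the projection of `S₁`. -/
def prolong (h G : Matrix (Fin n) (Fin n) ℝ) (S : Fin n → Fin n → Fin n → ℝ) (t : Fin n → ℝ)
    (i j k l : Fin n) : ℝ :=
  1 / 3 * (quad G S j k i l + quad G S i j k l + quad G S i k j l)
    + S i j l * t k + S j k l * t i + S i k l * t j + S i j k * t l
    + 1 / 3 * (coeffForm G S t j k * h i l + coeffForm G S t i k * h j l
      + coeffForm G S t i j * h k l)
    - 1 / ((n : ℝ) + 2) * (h i j * traceForm h G S t k l + h j k * traceForm h G S t i l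
      + h i k * traceForm h G S t j l)

include K H in
theorem symTraceFree₃_tensorS₁ (hS : scrS h S y = gram (invMetric h y) (S y)) (i j k l : Fin n) :
    symTraceFree₃ h y (tensorS₁ h S t y) i j k l
      = prolong (h y) (invMetric h y) (S y) (fun a => pd t a y) i j k l := by
  simp only [symTraceFree₃, trace_sym₃_tensorS₁ K H hS]
  rw [sym₃_tensorS₁ K H hS]
  simp only [prolong, sym₃, H.symm j i, H.symm k i, H.symm k j]
  ring

/-- The curvature part of `𝔖` is half of the skew part of `quad`. In its Ricci contraction one of
the two terms dies because `S` is trace-free and the other is the Gram matrix. Vanishing of the Weyl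
part therefore leaves a Kulkarni-Nomizu product built from `𝒮` and the metric. -/
theorem weyl_quad (K : IsHarmonicCubic (invMetric h y) (S y))
    (H : IsDualPair (h y) (invMetric h y)) {i j k l : Fin n}
    (hW : weylPart h y (frakS h S y) i j k l = 0) :
    quad (invMetric h y) (S y) i k j l - quad (invMetric h y) (S y) i l j k
      = kulkarniNomizu (fun p q => -1 / ((n : ℝ) - 2) * (gram (invMetric h y) (S y) p q
        - ctr (invMetric h y) (gram (invMetric h y) (S y)) / (2 * ((n : ℝ) - 1)) * h y p q))
        (h y) i j k l := by
  have e0 : frakS h S y = quad (invMetric h y) (S y) := by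
    funext i j k l; exact frakS_eq H i j k l
  have e1 : ∀ i j k l, curvaturePart (frakS h S y) i j k l
      = 1 / 2 * (quad (invMetric h y) (S y) i k j l - quad (invMetric h y) (S y) i l j k) := by
    intro i j k l
    simp only [curvaturePart, e0, H.quad_swap j k i l, H.quad_swap j l i k]
    ring
  have e2 : ∀ i j, curvatureContraction h y (frakS h S y) i j
      = 1 / 2 * (-1 / ((n : ℝ) - 2)) * gram (invMetric h y) (S y) i j := by
    intro i j
    have e3 : ctr (invMetric h y) (fun a b => quad (invMetric h y) (S y) a j i b)
        = gram (invMetric h y) (S y) i j := by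
      rw [K.quad_trace₁₄, H.gram_symm]
    simp only [curvatureContraction, trace_eq_ctr, e1, ctr_const_mul, ctr_sub, K.quad_trace_left, e3]
    ring
  have e4 : ctr (invMetric h y) (curvatureContraction h y (frakS h S y))
      = 1 / 2 * (-1 / ((n : ℝ) - 2)) * ctr (invMetric h y) (gram (invMetric h y) (S y)) := by
    rw [← ctr_const_mul]; exact ctr_congr e2
  simp only [weylPart, e1, trace_eq_ctr, e4, kulkarniNomizu, e2] at hW
  simp only [kulkarniNomizu]
  linear_combination 2 * hW

end Components

/-! ### Algebraic consequences of properness and the scalar obstruction -/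

section ProperAlgebra

variable {n : ℕ} {h G : Matrix (Fin n) (Fin n) ℝ} {S : Fin n → Fin n → Fin n → ℝ} {t : Fin n → ℝ}

/-- The scalar `|S|²`. -/
def normS (G : Matrix (Fin n) (Fin n) ℝ) (S : Fin n → Fin n → Fin n → ℝ) : ℝ := ctr G (gram G S)

/-- The scalar `|grad t|²`. -/
def normT (G : Matrix (Fin n) (Fin n) ℝ) (t : Fin n → ℝ) : ℝ := ctr G fun a b => t a * t b

/-- `|S|² - (n - 1) (n + 2) |grad t|² - 9 n (n - 1) κ`. -/
def obstruction (G : Matrix (Fin n) (Fin n) ℝ) (S : Fin n → Fin n → Fin n → ℝ) (t : Fin n → ℝ)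
    (κ : ℝ) : ℝ :=
  normS G S - ((n : ℝ) - 1) * (n + 2) * normT G t - 9 * n * ((n : ℝ) - 1) * κ

/-- The coefficient of the metric in `𝒮` for a proper structure. -/
def rhoOf (G : Matrix (Fin n) (Fin n) ℝ) (S : Fin n → Fin n → Fin n → ℝ) (t : Fin n → ℝ) : ℝ :=
  (normS G S - ((n : ℝ) - 2) * normT G t) / n

/-- The coefficient of the metric in the Ricci-type contraction of the quadratic form of `S`. -/
def muOf (G : Matrix (Fin n) (Fin n) ℝ) (S : Fin n → Fin n → Fin n → ℝ) (t : Fin n → ℝ) : ℝ :=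
  normT G t / n - normS G S / (2 * n * ((n : ℝ) - 1))

/-- The coefficient of the metric-metric term in the normal form of `3 ∇S`. -/
def nuOf (G : Matrix (Fin n) (Fin n) ℝ) (S : Fin n → Fin n → Fin n → ℝ) (t : Fin n → ℝ) : ℝ :=
  2 / 3 / ((n : ℝ) - 2) * rhoOf G S t
    - 4 / (3 * ((n : ℝ) - 2) * (n + 2)) * normS G S + 2 / 3 * muOf G S t

/-- The coefficient of the metric in the Hessian of `t`. -/
def lamOf (G : Matrix (Fin n) (Fin n) ℝ) (S : Fin n → Fin n → Fin n → ℝ) (t : Fin n → ℝ)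
    (κ : ℝ) : ℝ :=
  3 * κ / 2 - normT G t / 6 + 1 / (3 * ((n : ℝ) - 2)) * (rhoOf G S t
    + ((n : ℝ) - 6) * normS G S / (2 * ((n : ℝ) - 1) * (n + 2)))

/-- The coefficient of `S` in `properness_deriv`, with the actual values of `ρ`, `ν` and `lam`. This
is the origin of `obstruction`; the coefficient of the symmetric product of the metric with `dt`
turns out to be the same scalar. -/
theorem coeff_cubic_eq (hn : 3 ≤ n) (κ : ℝ) :
    2 * rhoOf G S t + 4 * nuOf G S t - ((n : ℝ) - 2) * (normT G t + 3 * lamOf G S t κ)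
      = ((n : ℝ) - 2) / (2 * n * ((n : ℝ) - 1)) * obstruction G S t κ := by
  have hn' : (3 : ℝ) ≤ n := by exact_mod_cast hn
  have h1 : (n : ℝ) - 1 ≠ 0 := by linarith
  have h2 : (n : ℝ) - 2 ≠ 0 := by linarith
  have h3 : (n : ℝ) + 2 ≠ 0 := by linarith
  have h4 : (n : ℝ) ≠ 0 := by linarith
  simp only [lamOf, nuOf, rhoOf, muOf, obstruction]
  field_simp
  ring

theorem coeff_gradient_eq (hn : 3 ≤ n) (κ : ℝ) :
    2 * rhoOf G S t - 2 * normT G t + 2 * n * muOf G S t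
        - ((n : ℝ) - 2) * (nuOf G S t + normT G t + 3 * lamOf G S t κ)
      = ((n : ℝ) - 2) / (2 * n * ((n : ℝ) - 1)) * obstruction G S t κ := by
  have hn' : (3 : ℝ) ≤ n := by exact_mod_cast hn
  have h1 : (n : ℝ) - 1 ≠ 0 := by linarith
  have h2 : (n : ℝ) - 2 ≠ 0 := by linarith
  have h3 : (n : ℝ) + 2 ≠ 0 := by linarith
  have h4 : (n : ℝ) ≠ 0 := by linarith
  simp only [lamOf, nuOf, rhoOf, muOf, obstruction]
  field_simp
  ring

/-- Properness replaces `𝒮`. The factor `n - 2` cancels, so `S(·,·,grad t) + dt²` enters with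
coefficient `-1`, and `muOf` collects all multiples of the metric. -/
theorem weyl_normal_form (hn : 3 ≤ n)
    (hg : ∀ i j, gram G S i j = ((n : ℝ) - 2) * (along G S t i j + t i * t j)
      + rhoOf G S t * h i j)
    {i j k l : Fin n}
    (hW : quad G S i k j l - quad G S i l j k
      = kulkarniNomizu (fun p q => -1 / ((n : ℝ) - 2) * (gram G S p q
        - ctr G (gram G S) / (2 * ((n : ℝ) - 1)) * h p q)) h i j k l) :
    quad G S i k j l - quad G S i l j k
      = (muOf G S t * h i k - (along G S t i k + t i * t k)) * h j l
        + (muOf G S t * h j l - (along G S t j l + t j * t l)) * h i k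
        - (muOf G S t * h i l - (along G S t i l + t i * t l)) * h j k
        - (muOf G S t * h j k - (along G S t j k + t j * t k)) * h i l := by
  have hn' : (3 : ℝ) ≤ n := by exact_mod_cast hn
  have h1 : (n : ℝ) - 1 ≠ 0 := by linarith
  have h2 : (n : ℝ) - 2 ≠ 0 := by linarith
  have h4 : (n : ℝ) ≠ 0 := by linarith
  have e1 : ∀ p q, -1 / ((n : ℝ) - 2) * (gram G S p q
      - ctr G (gram G S) / (2 * ((n : ℝ) - 1)) * h p q)
      = muOf G S t * h p q - (along G S t p q + t p * t q) := fun p q => by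
    have e2 : ctr G (gram G S) = normS G S := rfl
    rw [hg, e2, muOf, rhoOf]
    field_simp
    ring
  rw [hW]
  simp only [kulkarniNomizu, e1]

variable (K : IsHarmonicCubic G S) (H : IsDualPair h G)
include K H

/-- The three pairings in `prolong` differ by skew parts of `quad`. Two uses of the Weyl identity
turn them all into `quad G S j k i l`, while properness removes `𝒮` from `coeffForm` and
`traceForm`. -/
theorem prolong_eq_properDeriv (hn : 3 ≤ n)
    (hg : ∀ i j, gram G S i j = ((n : ℝ) - 2) * (along G S t i j + t i * t j)
      + rhoOf G S t * h i j)
    (hW : ∀ i j k l, quad G S i k j l - quad G S i l j k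
      = (muOf G S t * h i k - (along G S t i k + t i * t k)) * h j l
        + (muOf G S t * h j l - (along G S t j l + t j * t l)) * h i k
        - (muOf G S t * h i l - (along G S t i l + t i * t l)) * h j k
        - (muOf G S t * h j k - (along G S t j k + t j * t k)) * h i l)
    (i j k l : Fin n) :
    prolong h G S t i j k l
      = properDeriv h G S t (nuOf G S t) (nuOf G S t - 2 * muOf G S t) i j k l := by
  have hn' : (3 : ℝ) ≤ n := by exact_mod_cast hn
  have h2 : (n : ℝ) - 2 ≠ 0 := by linarith
  have h3 : (n : ℝ) + 2 ≠ 0 := by linarith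
  have e1 : ctr G (coeffForm G S t) = 4 / ((n : ℝ) - 2) * normS G S := by
    have : ctr G (coeffForm G S t)
        = ctr G (fun a b => 4 / ((n : ℝ) - 2) * gram G S a b - 3 * along G S t a b) := rfl
    rw [this, ctr_sub, ctr_const_mul, ctr_const_mul, K.along_trace]
    simp only [normS]
    ring
  have e2 : ∀ i j, coeffForm G S t i j = along G S t i j + 4 * (t i * t j)
      + 4 / ((n : ℝ) - 2) * rhoOf G S t * h i j := fun i j => by
    rw [coeffForm, hg]
    field_simp
    ring
  have e3 : ∀ i j, 1 / ((n : ℝ) + 2) * traceForm h G S t i j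
      = 2 / 3 * (along G S t i j + t i * t j) + (2 / 3 / ((n : ℝ) - 2) * rhoOf G S t
        + 4 / (3 * ((n : ℝ) - 2) * (n + 2)) * normS G S) * h i j := fun i j => by
    rw [traceForm, hg, e1, e2]
    field_simp
    ring
  have q1 := hW i k j l
  have q2 := hW i j k l
  rw [H.quad_swap i l k j, K.quad_left k j, K.quad_left j k, K.quad_left k j] at q1
  rw [H.quad_swap i l j k] at q2
  have q3 : 1 / ((n : ℝ) + 2) * (h i j * traceForm h G S t k l + h j k * traceForm h G S t i l
      + h i k * traceForm h G S t j l) = h i j * (1 / ((n : ℝ) + 2) * traceForm h G S t k l)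
      + h j k * (1 / ((n : ℝ) + 2) * traceForm h G S t i l)
      + h i k * (1 / ((n : ℝ) + 2) * traceForm h G S t j l) := by ring
  rw [prolong, q3]
  simp only [e2, e3]
  simp only [properDeriv, nuOf]
  simp only [K.along_symm l k, K.along_symm l j, H.symm l k, H.symm l j,
    K.right i l k, K.left l j, K.right j l k, H.symm k j, K.along_symm k j] at *
  linear_combination (1 / 3) * q1 + (1 / 3) * q2

/-- Properness and its first derivative force the scalar obstruction to annihilate `S` and `dt`. -/
theorem obstruction_mul_eq_zero (hn : 3 ≤ n) {κ : ℝ} {L : Fin n → ℝ}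
    (hg : ∀ i j, gram G S i j = ((n : ℝ) - 2) * (along G S t i j + t i * t j)
      + rhoOf G S t * h i j)
    (hW : ∀ i j k l, quad G S i k j l - quad G S i l j k
      = (muOf G S t * h i k - (along G S t i k + t i * t k)) * h j l
        + (muOf G S t * h j l - (along G S t j l + t j * t l)) * h i k
        - (muOf G S t * h i l - (along G S t i l + t i * t l)) * h j k
        - (muOf G S t * h j k - (along G S t j k + t j * t k)) * h i l)
    {Hs : Fin n → Fin n → ℝ} {D : Fin n → Fin n → Fin n → Fin n → ℝ}
    (hD : ∀ i j k l, D i j k l = (1 / 3) * prolong h G S t i j k l)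
    (hHs : ∀ i j, Hs i j = 3 * (κ / 2 * h i j) + (1 / 3) * (t i * t j - (1 / 2) * normT G t * h i j)
      + 1 / (3 * ((n : ℝ) - 2)) * (gram G S i j + ((n : ℝ) - 6) * normS G S * h i j
        / (2 * ((n : ℝ) - 1) * ((n : ℝ) + 2))))
    (hL : ∀ i j l, ctr₂ G (fun a b => D i a b l) (S j) + ctr₂ G (S i) (fun a b => D j a b l)
      - ((n : ℝ) - 2) * (ctr G (fun a b => Hs l a * S i j b)
        + ctr G (fun a b => t a * D i j b l) + Hs l i * t j + t i * Hs l j) = L l * h i j) :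
    (∀ i, obstruction G S t κ * t i = 0) ∧ ∀ i j k, obstruction G S t κ * S i j k = 0 := by
  have hn' : (3 : ℝ) ≤ n := by exact_mod_cast hn
  have h1 : (n : ℝ) - 1 ≠ 0 := by linarith
  have h2 : (n : ℝ) - 2 ≠ 0 := by linarith
  have h4 : (n : ℝ) ≠ 0 := by linarith
  have hD' : ∀ i j k l, D i j k l
      = (1 / 3) * properDeriv h G S t (nuOf G S t) (nuOf G S t - 2 * muOf G S t) i j k l :=
    fun i j k l => by rw [hD, prolong_eq_properDeriv K H hn hg hW]
  have hHs' : ∀ i j, Hs i j = (1 / 3) * along G S t i j + (2 / 3) * (t i * t j)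
      + lamOf G S t κ * h i j := fun i j => by
    rw [hHs, hg, lamOf]
    field_simp
    ring
  obtain ⟨v, hv⟩ := properness_deriv K H hg hW hD' hHs' hL
  have c1 := coeff_cubic_eq (G := G) (S := S) (t := t) hn κ
  have c2 := coeff_gradient_eq (G := G) (S := S) (t := t) hn κ
  simp only [normT] at c1 c2
  simp only [c1, c2] at hv
  obtain ⟨r1, r2⟩ := cubic_eq_zero_of_mul_trace K H (by omega) hv
  have hc : ((n : ℝ) - 2) / (2 * n * ((n : ℝ) - 1)) ≠ 0 := by positivity
  refine ⟨fun i => ?_, fun i j k => ?_⟩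
  · exact (mul_eq_zero.1 ((mul_assoc _ _ _).symm.trans (r1 i))).resolve_left hc
  · exact (mul_eq_zero.1 ((mul_assoc _ _ _).symm.trans (r2 i j k))).resolve_left hc

/-- The divergence of `S`. -/
theorem prolong_divergence (i j : Fin n) :
    ctr G (fun a b => prolong h G S t i j a b)
      = 2 / 3 * gram G S i j + 2 * along G S t i j + ((n : ℝ) + 2) / 3 * coeffForm G S t i j
        - 1 / ((n : ℝ) + 2) * (h i j * ctr G (traceForm h G S t) + 2 * traceForm h G S t i j) := by
  have hc : ∀ i j, coeffForm G S t i j = coeffForm G S t j i := fun i j => by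
    simp only [coeffForm, H.gram_symm i j, K.along_symm i j]
  have hf : ∀ i j, traceForm h G S t i j = traceForm h G S t j i := fun i j => by
    simp only [traceForm, hc i j, H.gram_symm i j, K.along_symm i j, H.symm i j]
  have e1 : ctr G (fun a b => S i j b * t a) = along G S t i j := by
    rw [H.ctr_swap fun a b => S i j a * t b]; rfl
  have e2 : ∀ i j, ctr G (fun a b => coeffForm G S t i a * h j b) = coeffForm G S t i j :=
    fun i j => H.ctr_mul_h j _
  have e3 : ctr G (fun a b => coeffForm G S t i j * h a b) = coeffForm G S t i j * n := by
    rw [ctr_const_mul _ fun a b => h a b, H.ctr_self]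
  have e4 : ∀ i j, ctr G (fun a b => h j a * traceForm h G S t i b) = traceForm h G S t i j :=
    fun i j => H.ctr_h_mul j _
  have e5 : ctr G (fun a b => traceForm h G S t a b) = ctr G (traceForm h G S t) := rfl
  have e6 : ∀ i j, ctr G (fun a b => quad G S i a j b) = gram G S i j := fun i j => rfl
  have e7 : ctr G (fun a b => quad G S i j a b) = 0 := K.quad_trace_right H i j
  have e8 : ctr G (fun a b => S i j a * t b) = along G S t i j := rfl
  simp only [prolong, ctr_add, ctr_sub, ctr_const_mul, ctr_mul_const, K.traceless₂₃, e1, e2, e3,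
    e4, e5, e6, e7, e8]
  rw [hc j i, hf j i, H.gram_symm j i]
  ring

/-- The three metric terms have total trace `n + 2` times `traceForm`, which the factor `1/(n+2)`
normalises. As a consequence only the Hessian of `t` survives in the derivative of the trace of `C`.
-/
theorem prolong_traceless (j l : Fin n) : ctr G (fun a b => prolong h G S t a j b l) = 0 := by
  have hc : ∀ i j, coeffForm G S t i j = coeffForm G S t j i := fun i j => by
    simp only [coeffForm, H.gram_symm i j, K.along_symm i j]
  have e1 : ctr G (fun a b => S a j l * t b) = along G S t j l := by
    simp only [← K.cyc]; rfl
  have e2 : ctr G (fun a b => S j b l * t a) = along G S t j l := by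
    rw [H.ctr_swap fun a b => S j a l * t b]; simp only [K.right j _ l]; rfl
  have e3 : ctr G (fun a b => coeffForm G S t j b * h a l) = coeffForm G S t j l := by
    rw [H.ctr_swap fun a b => coeffForm G S t j a * h b l]
    simp only [H.symm _ l]
    exact H.ctr_mul_h l _
  have e4 : ctr G (fun a b => coeffForm G S t a j * h b l) = coeffForm G S t j l := by
    simp only [H.symm _ l, hc _ j]
    exact H.ctr_mul_h l _
  have e5 : ctr G (fun a b => h a j * traceForm h G S t b l) = traceForm h G S t j l := by
    simp only [H.symm _ j]
    exact H.ctr_h_mul j fun b => traceForm h G S t b l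
  have e6 : ctr G (fun a b => h j b * traceForm h G S t a l) = traceForm h G S t j l := by
    rw [H.ctr_swap fun a b => h j a * traceForm h G S t b l]
    exact H.ctr_h_mul j fun b => traceForm h G S t b l
  have e7 : ctr G (fun a b => h a b * traceForm h G S t j l) = n * traceForm h G S t j l := by
    rw [ctr_mul_const _ fun a b => h a b, H.ctr_self]
  have e8 : ctr G (fun a b => coeffForm G S t a b * h j l) = ctr G (coeffForm G S t) * h j l :=
    ctr_mul_const _ _
  have e9 : ctr G (fun a b => quad G S j b a l) = gram G S j l := by
    rw [H.ctr_swap fun a b => quad G S j a b l]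
    exact K.quad_trace₂₃ j l
  have h3 : (n : ℝ) + 2 ≠ 0 := by positivity
  simp only [prolong, ctr_add, ctr_sub, ctr_const_mul, ctr_mul_const, K.traceless₁₃, e1, e2, e3, e4,
    e5, e6, e7, e8, e9, K.traceless, K.quad_trace₁₃, K.quad_trace_left]
  simp only [traceForm]
  field_simp
  ring

/-- The cubic form of an affine normalisation, in terms of `S` and `dt`. -/
def cubicForm (h : Matrix (Fin n) (Fin n) ℝ) (S : Fin n → Fin n → Fin n → ℝ) (t : Fin n → ℝ)
    (i j k : Fin n) : ℝ :=
  1 / 3 * (S i j k + t i * h j k + t j * h i k + t k * h i j)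

theorem trace_cubicForm (j : Fin n) :
    ctr G (fun a b => cubicForm h S t a j b) = ((n : ℝ) + 2) / 3 * t j := by
  have e1 : ctr G (fun a b => t a * h j b) = t j := H.ctr_mul_h j t
  have e2 : ctr G (fun a b => t b * h a j) = t j := by
    rw [H.ctr_swap fun a b => t a * h b j]
    simp only [H.symm _ j]
    exact e1
  have e3 : ctr G (fun a b => t j * h a b) = t j * n := by
    rw [ctr_const_mul _ fun a b => h a b, H.ctr_self]
  simp only [cubicForm, ctr_const_mul, ctr_add, K.traceless₁₃, e1, e2, e3]
  ring

omit K in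
theorem along_cubicForm (i j : Fin n) : along G (cubicForm h S t) t i j
    = 1 / 3 * (along G S t i j + 2 * (t i * t j) + normT G t * h i j) := by
  have e1 : ∀ i j, ctr G (fun a b => t i * h j a * t b) = t i * t j := fun i j => by
    simp only [mul_assoc, ctr_const_mul, H.ctr_h_mul]
  have e2 : ctr G (fun a b => t a * h i j * t b) = normT G t * h i j := by
    simp only [mul_right_comm _ (h i j), ctr_mul_const]
    rfl
  have e3 : ctr G (fun a b => S i j a * t b) = along G S t i j := rfl
  simp only [along, cubicForm, add_mul, mul_assoc (1 / 3 : ℝ), ctr_const_mul, ctr_add] at *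
  rw [e1, e1, e2]
  ring

theorem gram_cubicForm (i j : Fin n) : gram G (cubicForm h S t) i j
    = 1 / 9 * (gram G S i j + 4 * along G S t i j + (n + 6) * (t i * t j)
      + 2 * normT G t * h i j) := by
  have hcub : ∀ i, (fun a b => cubicForm h S t i a b)
      = fun a b => 1 / 3 * (S i a b + t i * h a b + t a * h i b + h i a * t b) := fun i => by
    funext a b; simp only [cubicForm]; ring
  -- Expanding a single factor against an arbitrary symmetric `B` serves twice: with `B` a slice of
  -- `S`, then with `B` a slice of the cubic form itself.
  have key : ∀ B : Fin n → Fin n → ℝ, (∀ a b, B a b = B b a) → ∀ i,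
      ctr₂ G (fun a b => cubicForm h S t i a b) B = 1 / 3 * (ctr₂ G (S i) B + t i * ctr G B
        + 2 * ctr G (fun a b => t a * B b i)) := fun B hB i => by
    have e1 : ctr₂ G (fun a b => t i * h a b) B = t i * ctr G B := by
      rw [ctr₂_const_mul _ fun a b => h a b, H.ctr₂_self]
    have e2 : ctr₂ G (fun a b => S i a b) B = ctr₂ G (S i) B := rfl
    rw [hcub]
    simp only [ctr₂_const_mul, ctr₂_add, e1, e2, H.ctr₂_mul_h, H.ctr₂_h_mul, hB i]
    ring
  have hsym : ∀ i a b, cubicForm h S t i a b = cubicForm h S t i b a := fun i a b => by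
    simp only [cubicForm, K.right i a b, H.symm a b]; ring
  have hS : ∀ i a b, S i a b = S i b a := K.right
  have hal : ∀ i j, ctr G (fun a b => t a * S j b i) = along G S t i j := fun i j => by
    rw [← H.ctr_swap]; simp only [along, mul_comm, K.right j _ i, K.left j i]
  have e3 : ctr₂ G (S i) (cubicForm h S t j)
      = 1 / 3 * (gram G S i j + 2 * along G S t i j) := by
    have h0 : ctr G (S i) = 0 := K.traceless₂₃ i
    rw [H.ctr₂_comm]
    have := key (S i) (hS i) j
    rw [hal, h0, ← gram_eq_ctr₂, H.gram_symm, K.along_symm] at this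
    exact this.trans (by ring)
  have e4 : ctr G (cubicForm h S t j) = ((n : ℝ) + 2) / 3 * t j := by
    rw [← trace_cubicForm K H (t := t) j]
    refine ctr_congr fun a b => ?_
    simp only [cubicForm, K.left j a, H.symm j a]; ring
  have e5 : ctr G (fun a b => t a * cubicForm h S t j b i)
      = 1 / 3 * (along G S t i j + 2 * (t i * t j) + normT G t * h i j) := by
    rw [← along_cubicForm H, along, ← H.ctr_swap]
    refine ctr_congr fun a b => ?_
    simp only [cubicForm, K.right j a i, K.left j i, H.symm a i, H.symm j i, H.symm j a]; ring
  have h1 := key (cubicForm h S t j) (hsym j) i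
  rw [gram_eq_ctr₂]
  refine h1.trans ?_
  rw [e3, e4, e5]
  ring

/-- The algebraic identity behind the vanishing of the dual Ricci tensor. -/
theorem dual_ricci_algebra (hn : 3 ≤ n) {κ : ℝ}
    (hg : ∀ i j, gram G S i j = ((n : ℝ) - 2) * (along G S t i j + t i * t j)
      + rhoOf G S t * h i j)
    {Hs : Fin n → Fin n → ℝ} {D : Fin n → Fin n → Fin n → Fin n → ℝ}
    (hD : ∀ i j k l, D i j k l = (1 / 3) * prolong h G S t i j k l)
    (hHs : ∀ i j, Hs i j = 3 * (κ / 2 * h i j) + (1 / 3) * (t i * t j - (1 / 2) * normT G t * h i j)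
      + 1 / (3 * ((n : ℝ) - 2)) * (gram G S i j + ((n : ℝ) - 6) * normS G S * h i j
        / (2 * ((n : ℝ) - 1) * ((n : ℝ) + 2))))
    (hF : obstruction G S t κ = 0) (i j : Fin n) :
    ((n : ℝ) - 1) * κ * h i j
      - ctr G (fun a b => 1 / 3 * (D i j a b + Hs b i * h j a + Hs b j * h i a + Hs b a * h i j))
      + ((n : ℝ) + 2) / 3 * Hs i j
      + (((n : ℝ) + 2) / 3 * along G (cubicForm h S t) t i j - gram G (cubicForm h S t) i j) = 0 := by
  have hn' : (3 : ℝ) ≤ n := by exact_mod_cast hn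
  have h1 : (n : ℝ) - 1 ≠ 0 := by linarith
  have h2 : (n : ℝ) - 2 ≠ 0 := by linarith
  have h3 : (n : ℝ) + 2 ≠ 0 := by linarith
  have h4 : (n : ℝ) ≠ 0 := by linarith
  have e0 : ctr G (fun a b => gram G S a b) = normS G S := rfl
  have e0' : ctr G (fun a b => t a * t b) = normT G t := rfl
  have hsymm : ∀ i j, Hs i j = Hs j i := fun i j => by
    rw [hHs, hHs, H.gram_symm, H.symm, mul_comm (t i)]
  have e1 : ∀ i j, ctr G (fun a b => Hs b i * h j a) = Hs i j := fun i j => by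
    simp only [mul_comm _ (h _ _)]
    rw [H.ctr_h_mul, hsymm]
  have e2 : ctr G (fun a b => Hs b a * h i j)
      = (3 * κ / 2 * n + (1 / 3) * (normT G t - (1 / 2) * normT G t * n)
        + 1 / (3 * ((n : ℝ) - 2)) * (normS G S + ((n : ℝ) - 6) * normS G S * n
        / (2 * ((n : ℝ) - 1) * ((n : ℝ) + 2)))) * h i j := by
    have : ∀ a b, Hs b a = (3 * κ / 2 - 1 / 6 * normT G t + 1 / (3 * ((n : ℝ) - 2)) *
        (((n : ℝ) - 6) * normS G S / (2 * ((n : ℝ) - 1) * ((n : ℝ) + 2)))) * h a b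
        + 1 / 3 * (t a * t b) + 1 / (3 * ((n : ℝ) - 2)) * gram G S a b := fun a b => by
      rw [hsymm, hHs]; ring
    rw [ctr_mul_const]
    simp only [this, ctr_add]
    rw [ctr_const_mul _ fun a b => h a b, ctr_const_mul, ctr_const_mul, H.ctr_self, e0, e0']
    ring
  have e3 : ctr G (coeffForm G S t) = 4 / ((n : ℝ) - 2) * normS G S := by
    have : ctr G (coeffForm G S t)
        = ctr G (fun a b => 4 / ((n : ℝ) - 2) * gram G S a b - 3 * along G S t a b) := rfl
    rw [this, ctr_sub, ctr_const_mul, ctr_const_mul, K.along_trace, e0]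
    ring
  have e4 : ctr G (traceForm h G S t) = 2 / 3 * normS G S
      + 4 * (2 / 3 / ((n : ℝ) - 2)) * normS G S + 1 / 3 * (4 / ((n : ℝ) - 2) * normS G S) * n := by
    have e5 : ctr G (traceForm h G S t) = ctr G (fun i j => 2 / 3 * gram G S i j
        + 2 * along G S t i j + 2 / 3 * coeffForm G S t i j
        + 1 / 3 * ctr G (coeffForm G S t) * h i j) := rfl
    have e6 : ctr G (fun a b => coeffForm G S t a b) = ctr G (coeffForm G S t) := rfl
    rw [e5]
    simp only [ctr_add]
    rw [ctr_const_mul, ctr_const_mul, ctr_const_mul, ctr_const_mul _ fun a b => h a b, H.ctr_self,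
      e6, e3, e0, K.along_trace]
    ring
  have e7 : ctr G (fun a b => D i j a b) = 1 / 3 * ctr G (fun a b => prolong h G S t i j a b) := by
    simp only [hD, ctr_const_mul]
  simp only [ctr_const_mul, ctr_add, e1, e2, e7, prolong_divergence K H, along_cubicForm H,
    gram_cubicForm K H, e4]
  rw [hsymm j i, hHs i j]
  simp only [traceForm, e3, coeffForm, hg]
  -- With `𝒮` replaced by properness, the coefficients of `S(·,·,grad t)` and of `dt²` cancel
  -- identically. What remains is a multiple of the metric, which vanishes once `|S|²` is eliminated
  -- through the obstruction.
  have hs : normS G S = ((n : ℝ) - 1) * (n + 2) * normT G t + 9 * n * ((n : ℝ) - 1) * κ := by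
    rw [obstruction] at hF; linarith
  rw [rhoOf, hs]
  field_simp
  ring

end ProperAlgebra

/-! ### Rules for partial derivatives -/

section PartialDerivatives

variable {n : ℕ} {F : Type*} [NormedAddCommGroup F] [NormedSpace ℝ F] {U : Set (Euc n)} {y : Euc n}

theorem pd_add {f g : Euc n → F} (hf : DifferentiableAt ℝ f y) (hg : DifferentiableAt ℝ g y)
    (i : Fin n) : pd (fun z => f z + g z) i y = pd f i y + pd g i y := by
  simp only [pd, fderiv_fun_add hf hg, add_apply]

theorem pd_sub {f g : Euc n → F} (hf : DifferentiableAt ℝ f y) (hg : DifferentiableAt ℝ g y)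
    (i : Fin n) : pd (fun z => f z - g z) i y = pd f i y - pd g i y := by
  simp only [pd, fderiv_fun_sub hf hg, sub_apply]

theorem pd_sum {ι : Type*} {s : Finset ι} {f : ι → Euc n → F}
    (hf : ∀ a ∈ s, DifferentiableAt ℝ (f a) y) (i : Fin n) :
    pd (fun z => ∑ a ∈ s, f a z) i y = ∑ a ∈ s, pd (f a) i y := by
  simp only [pd, fderiv_fun_sum hf, sum_apply]

theorem pd_smul {c : Euc n → ℝ} {f : Euc n → F} (hc : DifferentiableAt ℝ c y)
    (hf : DifferentiableAt ℝ f y) (i : Fin n) :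
    pd (fun z => c z • f z) i y = pd c i y • f y + c y • pd f i y := by
  simp only [pd, fderiv_fun_smul hc hf, add_apply,
    smul_apply, ContinuousLinearMap.smulRight_apply]
  exact add_comm _ _

theorem pd_mul {f g : Euc n → ℝ} (hf : DifferentiableAt ℝ f y) (hg : DifferentiableAt ℝ g y)
    (i : Fin n) : pd (fun z => f z * g z) i y = pd f i y * g y + f y * pd g i y :=
  pd_smul hf hg i

theorem pd_sum_mul {ι : Type*} {s : Finset ι} {f g : ι → Euc n → ℝ}
    (hf : ∀ a, DifferentiableAt ℝ (f a) y) (hg : ∀ a, DifferentiableAt ℝ (g a) y) (i : Fin n) :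
    pd (fun z => ∑ a ∈ s, f a z * g a z) i y
      = ∑ a ∈ s, (pd (f a) i y * g a y + f a y * pd (g a) i y) := by
  rw [pd_sum fun a _ => (hf a).fun_mul (hg a)]
  exact Finset.sum_congr rfl fun a _ => pd_mul (hf a) (hg a) i

theorem pd_const_mul {f : Euc n → ℝ} (hf : DifferentiableAt ℝ f y) (c : ℝ) (i : Fin n) :
    pd (fun z => c * f z) i y = c * pd f i y := by
  rw [pd_mul (differentiableAt_const c) hf]
  simp [pd]

theorem pd_congr {f g : Euc n → F} (hU : IsOpen U) (hy : y ∈ U) (e : ∀ z ∈ U, f z = g z)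
    (i : Fin n) : pd f i y = pd g i y := by
  have : f =ᶠ[nhds y] g := Filter.eventuallyEq_of_mem (hU.mem_nhds hy) e
  simp only [pd, this.fderiv_eq]

theorem diffAt_of_contDiffOn {f : Euc n → F} (hf : ContDiffOn ℝ ∞ f U) (hU : IsOpen U) (hy : y ∈ U) :
    DifferentiableAt ℝ f y :=
  (hf.contDiffAt (hU.mem_nhds hy)).differentiableAt (by simp)

theorem contDiffOn_pd {f : Euc n → F} (hf : ContDiffOn ℝ ∞ f U) (hU : IsOpen U) (i : Fin n) :
    ContDiffOn ℝ ∞ (pd f i) U :=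
  (hf.fderiv_of_isOpen hU (by simp)).clm_apply contDiffOn_const

theorem pd_comm {f : Euc n → F} (hf : ContDiffOn ℝ ∞ f U) (hU : IsOpen U) (hy : y ∈ U)
    (i j : Fin n) : pd (pd f i) j y = pd (pd f j) i y := by
  have h1 : ContDiffAt ℝ ∞ f y := hf.contDiffAt (hU.mem_nhds hy)
  have h2 : DifferentiableAt ℝ (fderiv ℝ f) y :=
    diffAt_of_contDiffOn (hf.fderiv_of_isOpen hU (m := ∞) (by simp)) hU hy
  have h3 : ∀ i j, pd (pd f i) j y
      = fderiv ℝ (fderiv ℝ f) y (EuclideanSpace.single j 1) (EuclideanSpace.single i 1) := by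
    intro i j
    have : HasFDerivAt (pd f i) _ y := HasFDerivAt.comp y
      (ContinuousLinearMap.apply ℝ F (EuclideanSpace.single i (1 : ℝ))).hasFDerivAt h2.hasFDerivAt
    rw [pd, this.fderiv]
    rfl
  rw [h3, h3]
  exact (h1.isSymmSndFDerivAt (by simp; exact WithTop.coe_le_coe.2 (le_top : (2 : ℕ∞) ≤ ⊤))).eq _ _

end PartialDerivatives

/-! ### The Levi-Civita connection in coordinates -/

section LocalMetric

variable {n : ℕ}

/-- A smooth field of nondegenerate symmetric bilinear forms on an open set. -/
structure IsLocalMetric (U : Set (Euc n)) (h : Euc n → Matrix (Fin n) (Fin n) ℝ) : Prop where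
  isOpen : IsOpen U
  smooth : ∀ i j, ContDiffOn ℝ ∞ (fun z => h z i j) U
  symm : ∀ z ∈ U, ∀ i j, h z i j = h z j i
  det_ne_zero : ∀ z ∈ U, (h z).det ≠ 0

theorem contDiffOn_det {U : Set (Euc n)} {A : Euc n → Matrix (Fin n) (Fin n) ℝ}
    (hA : ∀ i j, ContDiffOn ℝ ∞ (fun z => A z i j) U) : ContDiffOn ℝ ∞ (fun z => (A z).det) U := by
  simp only [Matrix.det_apply']
  exact ContDiffOn.sum fun σ _ => contDiffOn_const.mul (contDiffOn_prod fun i _ => hA _ _)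

namespace IsLocalMetric

variable {U : Set (Euc n)} {h : Euc n → Matrix (Fin n) (Fin n) ℝ} (hh : IsLocalMetric U h)
  {y : Euc n} (hy : y ∈ U)
include hh

/-- Cramer's rule: the inverse is the adjugate over the determinant, and both are polynomial in the
entries. -/
theorem smooth_inv (i j : Fin n) : ContDiffOn ℝ ∞ (fun z => invMetric h z i j) U := by
  have h1 : ∀ z, invMetric h z i j = (h z).det⁻¹ * (h z).adjugate i j := fun z => by
    simp [invMetric, Matrix.inv_def]
  simp only [h1]
  refine (ContDiffOn.inv (contDiffOn_det hh.smooth) hh.det_ne_zero).mul ?_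
  simp only [Matrix.adjugate_apply]
  refine contDiffOn_det fun a b => ?_
  by_cases hb : a = j
  · subst hb
    simp only [Matrix.updateRow_self]
    exact contDiffOn_const
  · simp only [Matrix.updateRow_ne hb]
    exact hh.smooth a b

include hy

theorem isDualPair : IsDualPair (h y) (invMetric h y) where
  symm := hh.symm y hy
  symm_inv i j := by
    have h1 : (h y).transpose = h y := by ext i j; exact (hh.symm y hy j i)
    have h2 : (invMetric h y).transpose = invMetric h y := by
      rw [invMetric, Matrix.transpose_nonsing_inv, h1]
    exact congrFun (congrFun h2 j) i
  inv_mul a c := by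
    have h1 := congrFun (congrFun (Matrix.nonsing_inv_mul (h y)
      (isUnit_iff_ne_zero.2 (hh.det_ne_zero y hy))) a) c
    rw [Matrix.mul_apply, Matrix.one_apply] at h1
    exact h1

omit hy in
theorem smooth_christoffel (k i j : Fin n) :
    ContDiffOn ℝ ∞ (fun z => christoffel h z k i j) U := by
  have h1 : ∀ a b c, ContDiffOn ℝ ∞ (fun z => pd (fun z => h z a b) c z) U := fun a b c =>
    contDiffOn_pd (hh.smooth a b) hh.isOpen c
  exact contDiffOn_const.mul (ContDiffOn.sum fun l _ => (hh.smooth_inv k l).mul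
    (((h1 _ _ _).add (h1 _ _ _)).sub (h1 _ _ _)))

theorem christoffel_symm (k i j : Fin n) : christoffel h y k i j = christoffel h y k j i := by
  have h1 : ∀ l, pd (fun z => h z i j) l y = pd (fun z => h z j i) l y := fun l =>
    pd_congr hh.isOpen hy (fun z hz => hh.symm z hz i j) l
  simp only [christoffel, h1]
  congr 1
  exact Finset.sum_congr rfl fun l _ => by ring

theorem sum_christoffel_mul (i j k : Fin n) : ∑ m, christoffel h y m i j * h y m k
    = 1 / 2 * (pd (fun z => h z j k) i y + pd (fun z => h z i k) j y
      - pd (fun z => h z i j) k y) := by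
  have h1 := (hh.isDualPair hy).ctr_h_mul k fun l =>
    (pd (fun z => h z j l) i y + pd (fun z => h z i l) j y - pd (fun z => h z i j) l y)
  rw [← h1]
  simp only [christoffel, ctr, Finset.mul_sum, Finset.sum_mul]
  exact Finset.sum_congr rfl fun a _ => Finset.sum_congr rfl fun b _ => by
    rw [hh.symm y hy k a]; ring

/-- Metric compatibility `∇h = 0`, from two Christoffel symbols of the first kind: the derivatives
other than `∂ₗ h` cancel in their sum. -/
theorem pd_metric (i j l : Fin n) : pd (fun z => h z i j) l y
    = ∑ m, (christoffel h y m l i * h y m j + christoffel h y m l j * h y i m) := by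
  have h1 : ∀ a b l, pd (fun z => h z a b) l y = pd (fun z => h z b a) l y := fun a b l =>
    pd_congr hh.isOpen hy (fun z hz => hh.symm z hz a b) l
  have h2 := hh.sum_christoffel_mul hy l i j
  have h3 := hh.sum_christoffel_mul hy l j i
  simp only [hh.symm y hy i, Finset.sum_add_distrib]
  rw [h2, h3, h1 j i l]
  ring

/-- The inverse metric is parallel: the product of the inverse metric and the metric is
differentiated, and `pd_metric` is inserted. -/
theorem pd_inv (a d l : Fin n) : pd (fun z => invMetric h z a d) l y
    = -∑ m, (christoffel h y a l m * invMetric h y m d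
      + christoffel h y d l m * invMetric h y a m) := by
  have H := hh.isDualPair hy
  have e1 : ∀ c, ∑ b, (pd (fun z => invMetric h z a b) l y * h y b c
      + invMetric h y a b * pd (fun z => h z b c) l y) = 0 := fun c => by
    have h1 : pd (fun z => ∑ b, invMetric h z a b * h z b c) l y = 0 := by
      rw [pd_congr (g := fun _ => if a = c then (1 : ℝ) else 0) hh.isOpen hy
        fun z hz => (hh.isDualPair hz).inv_mul a c]
      simp [pd]
    rw [pd_sum_mul (fun b => diffAt_of_contDiffOn (hh.smooth_inv a b) hh.isOpen hy)
      (fun b => diffAt_of_contDiffOn (hh.smooth b c) hh.isOpen hy)] at h1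
    exact h1
  have e2 : ∀ (x : Fin n → ℝ), ∑ c, (∑ b, x b * h y b c) * invMetric h y c d = x d := fun x => by
    simp only [Finset.sum_mul, mul_assoc]
    rw [Finset.sum_comm]
    simp only [← Finset.mul_sum, H.mul_inv, mul_ite, mul_one, mul_zero, Finset.sum_ite_eq',
      Finset.mem_univ, if_true]
  have e3 : ∀ c, ∑ b, invMetric h y a b * pd (fun z => h z b c) l y
      = ∑ m, (∑ b, invMetric h y a b * christoffel h y m l b) * h y m c
        + christoffel h y a l c := fun c => by
    have h1 : ∀ b, invMetric h y a b * pd (fun z => h z b c) l y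
        = ∑ m, invMetric h y a b * christoffel h y m l b * h y m c
          + ∑ m, christoffel h y m l c * (invMetric h y a b * h y b m) := fun b => by
      rw [hh.pd_metric hy, Finset.mul_sum, ← Finset.sum_add_distrib]
      exact Finset.sum_congr rfl fun m _ => by ring
    simp only [h1, Finset.sum_add_distrib, Finset.sum_mul]
    congr 1
    · exact Finset.sum_comm
    · rw [Finset.sum_comm]
      simp only [← Finset.mul_sum, H.inv_mul, mul_ite, mul_one, mul_zero, Finset.sum_ite_eq,
        Finset.mem_univ, if_true]
  have e4 := Finset.sum_congr rfl fun c (_ : c ∈ Finset.univ) =>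
    congrArg (· * invMetric h y c d) (e1 c)
  simp only [Finset.sum_add_distrib, e3, add_mul, zero_mul, Finset.sum_const_zero, e2] at e4
  simp only [Finset.sum_add_distrib, mul_comm (christoffel h y d l _)]
  linarith

/-- Covariant differentiation commutes with raising an index, because the inverse metric is
parallel. -/
theorem pd_raise {S : Euc n → Fin n → Fin n → Fin n → ℝ}
    (hS : ∀ i j k, ContDiffOn ℝ ∞ (fun z => S z i j k) U) (i j k l : Fin n) :
    pd (fun z => raise h S z i j k) l y
      = raise h (fun z i j k => covDeriv h S z i j k l) y i j k
        + ∑ b, (christoffel h y b l i * raise h S y b j k + christoffel h y b l j * raise h S y i b k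
          - christoffel h y k l b * raise h S y i j b) := by
  have e1 : pd (fun z => raise h S z i j k) l y
      = ∑ m, (pd (fun z => S z i j m) l y * invMetric h y m k
        + S y i j m * pd (fun z => invMetric h z m k) l y) := by
    have h1 := fun m => diffAt_of_contDiffOn (hS i j m) hh.isOpen hy
    have h2 := fun m => diffAt_of_contDiffOn (hh.smooth_inv m k) hh.isOpen hy
    simp only [raise]
    exact pd_sum_mul h1 h2 l
  have e2 : ∀ m, pd (fun z => S z i j m) l y = covDeriv h S y i j m l
      + ∑ b, (christoffel h y b l i * S y b j m + christoffel h y b l j * S y i b m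
        + christoffel h y b l m * S y i j b) := fun m => by simp only [covDeriv]; ring
  have c1 : ∑ m, ∑ b, christoffel h y b l m * S y i j b * invMetric h y m k
      = ∑ m, ∑ b, S y i j m * (christoffel h y m l b * invMetric h y b k) := by
    rw [Finset.sum_comm]
    exact Finset.sum_congr rfl fun m _ => Finset.sum_congr rfl fun b _ => by ring
  have c2 : ∀ x : Fin n → Fin n → ℝ, ∑ b, ∑ m, x b m = ∑ m, ∑ b, x b m :=
    fun x => Finset.sum_comm
  rw [e1]
  simp only [e2, hh.pd_inv hy, raise, add_mul, mul_neg, Finset.sum_add_distrib,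
    Finset.sum_sub_distrib, Finset.sum_mul, Finset.mul_sum, mul_add, Finset.sum_neg_distrib]
  rw [c1, c2 fun b m => christoffel h y b l i * (S y b j m * invMetric h y m k),
    c2 fun b m => christoffel h y b l j * (S y i b m * invMetric h y m k),
    c2 fun b m => christoffel h y k l b * (S y i j m * invMetric h y m b)]
  simp only [← mul_assoc, mul_comm (S y i j _) (christoffel h y k l _)]
  ring

end IsLocalMetric
end LocalMetric

/-! ### Dual connections, and the Ricci tensor in constant curvature -/

section Curvature

variable {n : ℕ}

/-- Polarisation at `eᵢ + eⱼ`, with the diagonal values read off at `2 eᵢ` and `2 eⱼ`. No symmetry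
of `A` or `B` is assumed, so only symmetrised entries can be compared. -/
theorem add_swap_eq_of_quadratic_eq {A B : Fin n → Fin n → ℝ}
    (e : ∀ v : Fin n → ℝ, ∑ i, ∑ j, v i * v j * A i j = ∑ i, ∑ j, v i * v j * B i j)
    (i j : Fin n) : A i j + A j i = B i j + B j i := by
  have key : ∀ (C : Fin n → Fin n → ℝ) (a b : Fin n),
      ∑ i, ∑ j, (Pi.single a 1 + Pi.single b 1 : Fin n → ℝ) i
        * (Pi.single a 1 + Pi.single b 1 : Fin n → ℝ) j * C i j
      = C a a + C a b + C b a + C b b := fun C a b => by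
    simp only [Pi.add_apply, Pi.single_apply, add_mul, mul_add, Finset.sum_add_distrib, ite_mul,
      mul_ite, one_mul, mul_one, zero_mul, mul_zero, Finset.sum_ite_eq', Finset.mem_univ, if_true]
    ring
  have h1 := e (Pi.single i 1 + Pi.single j 1)
  have h2 := e (Pi.single i 1 + Pi.single i 1)
  have h3 := e (Pi.single j 1 + Pi.single j 1)
  rw [key, key] at h1 h2 h3
  linarith

theorem sum_comm₄ (F : Fin n → Fin n → Fin n → Fin n → ℝ) :
    ∑ j, ∑ k, ∑ l, ∑ m, F j k l m = ∑ l, ∑ m, ∑ j, ∑ k, F j k l m := by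
  have h1 : ∀ a, ∑ b, ∑ c, ∑ d, F a b c d = ∑ c, ∑ d, ∑ b, F a b c d := fun a => by
    rw [Finset.sum_comm]; exact Finset.sum_congr rfl fun c _ => Finset.sum_comm
  rw [Finset.sum_congr rfl fun a _ => h1 a, Finset.sum_comm]
  exact Finset.sum_congr rfl fun c _ => Finset.sum_comm

theorem sum_mul_inner_comm (f g : Fin n → ℝ) (A : Fin n → Fin n → ℝ) :
    ∑ m, f m * ∑ p, g p * A m p = ∑ p, g p * ∑ m, f m * A m p := by
  simp only [Finset.mul_sum]
  rw [Finset.sum_comm]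
  exact Finset.sum_congr rfl fun p _ => Finset.sum_congr rfl fun m _ => by ring

namespace IsLocalMetric

variable {U : Set (Euc n)} {h : Euc n → Matrix (Fin n) (Fin n) ℝ} (hh : IsLocalMetric U h)
  {y : Euc n} (hy : y ∈ U)
include hh hy

/-- The curvature tensors of dual connections are negatively adjoint to each other. -/
theorem curvature_dual {Γ Δ : Euc n → Fin n → Fin n → Fin n → ℝ}
    (hΓ : ∀ k i j, DifferentiableAt ℝ (fun z => Γ z k i j) y)
    (hΔ : ∀ k i j, DifferentiableAt ℝ (fun z => Δ z k i j) y)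
    (hd : ∀ z ∈ U, ∀ i j l, pd (fun z => h z i j) l z
      = ∑ m, (Γ z m l i * h z m j + Δ z m l j * h z i m)) (k l i j : Fin n) :
    ∑ m, (curvature Γ y k l i m * h y m j + curvature Δ y k l j m * h y i m) = 0 := by
  have hdiff : ∀ i j, DifferentiableAt ℝ (fun z => h z i j) y := fun i j =>
    diffAt_of_contDiffOn (hh.smooth i j) hh.isOpen hy
  -- The duality relation is used twice. The last two sums mix the connections and are exchanged by
  -- swapping `k` and `l`; equality of second derivatives therefore leaves exactly the two
  -- curvatures.
  have second : ∀ k l, pd (pd (fun z => h z i j) l) k y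
      = ∑ m, (pd (fun z => Γ z m l i) k y * h y m j + pd (fun z => Δ z m l j) k y * h y i m)
        + ∑ p, (∑ m, Γ y p k m * Γ y m l i) * h y p j + ∑ p, (∑ m, Δ y p k m * Δ y m l j) * h y i p
        + ∑ m, Γ y m l i * ∑ p, Δ y p k j * h y m p + ∑ m, Γ y m k i * ∑ p, Δ y p l j * h y m p := by
    intro k l
    rw [pd_congr hh.isOpen hy fun z hz => hd z hz i j l]
    rw [pd_sum fun m _ => ((hΓ m l i).fun_mul (hdiff m j)).fun_add ((hΔ m l j).fun_mul (hdiff i m))]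
    have e1 : ∀ m, pd (fun z => Γ z m l i * h z m j + Δ z m l j * h z i m) k y
        = (pd (fun z => Γ z m l i) k y * h y m j + pd (fun z => Δ z m l j) k y * h y i m)
          + Γ y m l i * ∑ p, Γ y p k m * h y p j + Δ y m l j * ∑ p, Δ y p k m * h y i p
          + Γ y m l i * ∑ p, Δ y p k j * h y m p + Δ y m l j * ∑ p, Γ y p k i * h y p m := by
      intro m
      rw [pd_add ((hΓ m l i).fun_mul (hdiff m j)) ((hΔ m l j).fun_mul (hdiff i m)),
        pd_mul (hΓ m l i) (hdiff m j), pd_mul (hΔ m l j) (hdiff i m), hd y hy, hd y hy]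
      simp only [Finset.sum_add_distrib]
      ring
    simp only [e1, Finset.sum_add_distrib]
    have e2 : ∀ (f g : Fin n → ℝ) (A : Fin n → Fin n → ℝ),
        ∑ m, f m * ∑ p, A p m * g p = ∑ p, (∑ m, A p m * f m) * g p := fun f g A => by
      simp only [Finset.mul_sum, Finset.sum_mul]
      rw [Finset.sum_comm]
      exact Finset.sum_congr rfl fun p _ => Finset.sum_congr rfl fun m _ => by ring
    have e3 := sum_mul_inner_comm (fun m => Δ y m l j) (fun p => Γ y p k i) fun m p => h y p m
    rw [e2, e2, e3]
  have hcomm := pd_comm (hh.smooth i j) hh.isOpen hy l k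
  rw [second, second] at hcomm
  simp only [curvature, Finset.sum_sub_distrib, Finset.sum_add_distrib, add_mul, sub_mul] at hcomm ⊢
  linarith

/-- The Levi-Civita connection is dual to itself, so its curvature operators are skew and have no
trace. -/
theorem sum_curvature_self (k l : Fin n) : ∑ i, curvature (christoffel h) y k l i i = 0 := by
  have hΓ : ∀ k i j, DifferentiableAt ℝ (fun z => christoffel h z k i j) y := fun k i j =>
    diffAt_of_contDiffOn (hh.smooth_christoffel k i j) hh.isOpen hy
  have H := hh.isDualPair hy
  have h1 := fun i j => hh.curvature_dual hy hΓ hΓ (fun z hz i j l => hh.pd_metric hz i j l) k l i j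
  have h2 : ctr (invMetric h y) (fun i j => ∑ m, curvature (christoffel h) y k l j m * h y i m)
      = ∑ i, curvature (christoffel h) y k l i i := by
    rw [← H.ctr_mul_metric, ← H.ctr_swap]
    exact ctr_congr fun i j => Finset.sum_congr rfl fun m _ => by rw [H.symm]
  have h4 := ctr_congr (G := invMetric h y) h1
  simp only [Finset.sum_add_distrib, ctr_add] at h4
  rw [h2, H.ctr_mul_metric] at h4
  simp only [ctr, mul_zero, Finset.sum_const_zero] at h4
  linarith

/-- The trace of the first Bianchi identity; the third term vanishes by `sum_curvature_self`. -/
theorem ricci_symm (i j : Fin n) :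
    ricci (christoffel h) y i j = ricci (christoffel h) y j i := by
  have bianchi : ∀ a, curvature (christoffel h) y a i j a - curvature (christoffel h) y a j i a
      + curvature (christoffel h) y i j a a = 0 := fun a => by
    have e1 : ∀ l i j k, pd (fun z => christoffel h z l i j) k y
        = pd (fun z => christoffel h z l j i) k y := fun l i j k =>
      pd_congr hh.isOpen hy (fun z hz => hh.christoffel_symm hz l i j) k
    simp only [curvature, Finset.sum_sub_distrib, e1 a j i, e1 a a i, e1 a a j,
      hh.christoffel_symm hy _ j i, hh.christoffel_symm hy _ a i, hh.christoffel_symm hy _ a j]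
    ring
  have h1 := Finset.sum_congr rfl fun a (_ : a ∈ Finset.univ) => bianchi a
  rw [Finset.sum_add_distrib, Finset.sum_sub_distrib, hh.sum_curvature_self hy] at h1
  simp only [ricci]
  simpa [sub_eq_zero] using h1

/-- For fixed `w` the hypothesis compares two quadratic forms in `v`. Polarising and tracing over
`v` gives `Ric(w, w) = (n-1) κ h(w, w)`, and symmetry of `Ric` permits a second polarisation in `w`.
The full curvature tensor need not be determined. -/
theorem ricci_of_constant_curvature {κ : ℝ} (hκ : ∀ v w : Fin n → ℝ,
    ∑ i, ∑ j, ∑ k, ∑ l, ∑ m, v i * w j * w k * v m * h y l m * curvature (christoffel h) y i j k l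
      = κ * ((∑ i, ∑ j, h y i j * v i * v j) * (∑ i, ∑ j, h y i j * w i * w j)
          - (∑ i, ∑ j, h y i j * v i * w j) ^ 2)) (i j : Fin n) :
    ricci (christoffel h) y i j = ((n : ℝ) - 1) * κ * h y i j := by
  have H := hh.isDualPair hy
  have key : ∀ w : Fin n → ℝ, ∑ j, ∑ k, w j * w k * ricci (christoffel h) y j k
      = ∑ j, ∑ k, w j * w k * (((n : ℝ) - 1) * κ * h y j k) := by
    intro w
    obtain ⟨N, hN⟩ : ∃ N, N = ∑ i, ∑ j, h y i j * w i * w j := ⟨_, rfl⟩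
    set Q : Fin n → Fin n → ℝ := fun i m => ∑ l, h y m l *
      ∑ j, ∑ k, w j * w k * curvature (christoffel h) y i j k l with hQ
    set x : Fin n → ℝ := fun i => ∑ j, h y i j * w j with hx
    have h1 : ∀ v : Fin n → ℝ, ∑ i, ∑ m, v i * v m * Q i m
        = ∑ i, ∑ m, v i * v m * (κ * (N * h y i m - x i * x m)) := fun v => by
      have e1 : ∑ i, ∑ m, v i * v m * (κ * (N * h y i m - x i * x m))
          = κ * ((∑ i, ∑ j, h y i j * v i * v j) * N - (∑ i, ∑ j, h y i j * v i * w j) ^ 2) := by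
        have e2 : ∑ i, ∑ j, h y i j * v i * w j = ∑ i, v i * x i := by
          simp only [hx, Finset.mul_sum]
          exact Finset.sum_congr rfl fun a _ => Finset.sum_congr rfl fun b _ => by ring
        rw [e2, sq, Finset.sum_mul_sum]
        simp only [Finset.sum_mul, Finset.mul_sum, mul_sub, Finset.sum_sub_distrib]
        congr 1 <;> exact Finset.sum_congr rfl fun a _ => Finset.sum_congr rfl fun b _ => by ring
      rw [e1, hN, ← hκ v w]
      refine Finset.sum_congr rfl fun i _ => ?_
      simp only [hQ, Finset.mul_sum]
      rw [sum_comm₄ fun j k l m =>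
        v i * w j * w k * v m * h y l m * curvature (christoffel h) y i j k l]
      rw [Finset.sum_comm]
      exact Finset.sum_congr rfl fun m _ => Finset.sum_congr rfl fun l _ =>
        Finset.sum_congr rfl fun j _ => Finset.sum_congr rfl fun k _ => by
          rw [H.symm m l]; ring
    have h2 := fun i m => add_swap_eq_of_quadratic_eq h1 i m
    have h3 := ctr_congr (G := invMetric h y) h2
    have h4 : ctr (invMetric h y) (fun i m => Q i m)
        = ∑ j, ∑ k, w j * w k * ricci (christoffel h) y j k := by
      have e1 := H.ctr_mul_metric fun i l => ∑ j, ∑ k, w j * w k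
        * curvature (christoffel h) y i j k l
      simp only [hQ, mul_comm (h y _ _)]
      simp only [H.symm _ (_ : Fin n)] at e1 ⊢
      rw [e1, Finset.sum_comm]
      refine Finset.sum_congr rfl fun j _ => ?_
      rw [Finset.sum_comm]
      refine Finset.sum_congr rfl fun k _ => ?_
      rw [ricci, Finset.mul_sum]
    have h5 : ctr (invMetric h y) (fun i m => x i * x m) = N := by
      have e1 := H.ctr_mul_metric fun i m => x i * w m
      have e2 : ∀ i j, ∑ m, x i * w m * h y m j = x i * x j := fun i j => by
        simp only [hx, mul_assoc, ← Finset.mul_sum]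
        congr 1
        exact Finset.sum_congr rfl fun m _ => by rw [H.symm m j]; ring
      simp only [e2] at e1
      rw [e1, hN]
      simp only [hx, Finset.sum_mul]
      exact Finset.sum_congr rfl fun a _ => Finset.sum_congr rfl fun b _ => by ring
    rw [ctr_add, ctr_add, H.ctr_swap Q, H.ctr_swap fun i m => κ * (N * h y i m - x i * x m),
      ctr_const_mul, ctr_sub, ctr_const_mul _ fun i m => h y i m, H.ctr_self, h5] at h3
    rw [h4] at h3
    have h7 : ∑ j, ∑ k, w j * w k * (((n : ℝ) - 1) * κ * h y j k) = ((n : ℝ) - 1) * κ * N := by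
      rw [hN]
      simp only [Finset.mul_sum]
      exact Finset.sum_congr rfl fun a _ => Finset.sum_congr rfl fun b _ => by ring
    rw [h7]
    linarith
  have h1 := add_swap_eq_of_quadratic_eq key i j
  rw [hh.ricci_symm hy j i, H.symm j i] at h1
  linarith

end IsLocalMetric
end Curvature

/-! ### Covariant derivatives of the structure tensors and the dual Ricci tensor -/

section LocalTheory

variable {n : ℕ} {U : Set (Euc n)} {h : Euc n → Matrix (Fin n) (Fin n) ℝ}
  {S : Euc n → Fin n → Fin n → Fin n → ℝ} {t : Euc n → ℝ} {y : Euc n}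

theorem IsDualPair.schouten_eq (H : IsDualPair (h y) (invMetric h y)) (hn : 3 ≤ n) {κ : ℝ}
    (hric : ∀ i j, ricci (christoffel h) y i j = ((n : ℝ) - 1) * κ * h y i j) (i j : Fin n) :
    schouten h y i j = κ / 2 * h y i j := by
  have hn' : (3 : ℝ) ≤ n := by exact_mod_cast hn
  have h1 : (n : ℝ) - 1 ≠ 0 := by linarith
  have h2 : (n : ℝ) - 2 ≠ 0 := by linarith
  have e1 : trace h y (ricci (christoffel h) y) = ((n : ℝ) - 1) * κ * n := by
    rw [trace_eq_ctr, ctr_congr hric, ctr_const_mul _ fun a b => h y a b, H.ctr_self]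
  rw [schouten, hric, e1]
  field_simp
  ring

namespace IsLocalMetric

variable (hh : IsLocalMetric U h)
include hh

theorem smooth_ctr {X : Euc n → Fin n → Fin n → ℝ}
    (hX : ∀ i j, ContDiffOn ℝ ∞ (fun z => X z i j) U) :
    ContDiffOn ℝ ∞ (fun z => ctr (invMetric h z) (X z)) U :=
  ContDiffOn.sum fun i _ => ContDiffOn.sum fun j _ => (hh.smooth_inv i j).mul (hX i j)

theorem smooth_raise (hS : ∀ i j k, ContDiffOn ℝ ∞ (fun z => S z i j k) U) (i j k : Fin n) :
    ContDiffOn ℝ ∞ (fun z => raise h S z i j k) U :=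
  ContDiffOn.sum fun l _ => (hS i j l).mul (hh.smooth_inv l k)

variable (hy : y ∈ U)
include hy

/-- The Leibniz rule for `tr (S_X S_Y)`. Christoffel terms on the two summed indices cancel between
the factors (`c1`, `c2`); only those on the free indices remain. -/
theorem pd_scrS (hS : ∀ i j k, ContDiffOn ℝ ∞ (fun z => S z i j k) U)
    (hr : ∀ i j k, S y i j k = S y i k j) (i j l : Fin n) :
    pd (fun z => scrS h S z i j) l y
      = ctr₂ (invMetric h y) (fun a b => covDeriv h S y i a b l) (S y j)
        + ctr₂ (invMetric h y) (S y i) (fun a b => covDeriv h S y j a b l)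
        + ∑ c, (christoffel h y c l i * scrS h S y c j
          + christoffel h y c l j * scrS h S y i c) := by
  have H := hh.isDualPair hy
  have hd : ∀ i j k, DifferentiableAt ℝ (fun z => raise h S z i j k) y := fun i j k =>
    diffAt_of_contDiffOn (hh.smooth_raise hS i j k) hh.isOpen hy
  set D : Euc n → Fin n → Fin n → Fin n → ℝ := fun z i j k => covDeriv h S z i j k l with hD
  have e1 : pd (fun z => scrS h S z i j) l y
      = ∑ a, ∑ b, (pd (fun z => raise h S z i a b) l y * raise h S y j b a
        + raise h S y i a b * pd (fun z => raise h S z j b a) l y) := by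
    simp only [scrS]
    rw [pd_sum fun a _ => DifferentiableAt.fun_sum fun b _ => (hd i a b).fun_mul (hd j b a)]
    exact Finset.sum_congr rfl fun a _ => pd_sum_mul (fun b => hd i a b) (fun b => hd j b a) l
  have e2 : ctr₂ (invMetric h y) (fun a b => covDeriv h S y i a b l) (S y j)
      = ∑ a, ∑ b, raise h D y i a b * raise h S y j b a := by
    rw [H.ctr₂_comm]
    refine (sum_raise_mul_raise (T := D) H (hr j) i).symm.trans ?_
    rw [Finset.sum_comm]
    exact Finset.sum_congr rfl fun a _ => Finset.sum_congr rfl fun b _ => mul_comm _ _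
  have e3 : ctr₂ (invMetric h y) (S y i) (fun a b => covDeriv h S y j a b l)
      = ∑ a, ∑ b, raise h S y i a b * raise h D y j b a :=
    (sum_raise_mul_raise (T := D) H (hr i) j).symm
  have e4 : ∀ (x : Fin n → ℝ) (F : Fin n → Fin n → Fin n → ℝ),
      ∑ c, x c * ∑ a, ∑ b, F a b c = ∑ a, ∑ b, ∑ c, x c * F a b c := fun x F => by
    simp only [Finset.mul_sum]
    rw [Finset.sum_comm]
    exact Finset.sum_congr rfl fun a _ => Finset.sum_comm
  have c1 : ∑ a, ∑ b, ∑ c, christoffel h y c l a * raise h S y i c b * raise h S y j b a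
      = ∑ a, ∑ b, ∑ c, raise h S y i a b * (christoffel h y a l c * raise h S y j b c) := by
    have : ∀ F : Fin n → Fin n → Fin n → ℝ, ∑ a, ∑ b, ∑ c, F a b c = ∑ c, ∑ b, ∑ a, F a b c :=
      fun F => by
        rw [Finset.sum_congr rfl fun a _ => Finset.sum_comm, Finset.sum_comm]
        exact Finset.sum_congr rfl fun a _ => Finset.sum_comm
    rw [this]
    exact Finset.sum_congr rfl fun a _ => Finset.sum_congr rfl fun b _ =>
      Finset.sum_congr rfl fun c _ => by ring
  have c2 : ∑ a, ∑ b, ∑ c, christoffel h y b l c * raise h S y i a c * raise h S y j b a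
      = ∑ a, ∑ b, ∑ c, raise h S y i a b * (christoffel h y c l b * raise h S y j c a) := by
    refine Finset.sum_congr rfl fun a _ => ?_
    rw [Finset.sum_comm]
    exact Finset.sum_congr rfl fun b _ => Finset.sum_congr rfl fun c _ => by ring
  rw [e1, e2, e3]
  simp only [hh.pd_raise hy hS, Finset.sum_add_distrib, Finset.sum_sub_distrib, add_mul, mul_add,
    sub_mul, mul_sub, Finset.sum_mul, scrS, e4]
  simp only [Finset.mul_sum]
  rw [c1, c2]
  simp only [mul_assoc, mul_left_comm (raise h S y i _ _) (christoffel h y _ _ _)]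
  ring

theorem pd_sum_grad_raise (hS : ∀ i j k, ContDiffOn ℝ ∞ (fun z => S z i j k) U)
    (ht : ContDiffOn ℝ ∞ t U) (i j l : Fin n) :
    pd (fun z => ∑ k, pd t k z * raise h S z i j k) l y
      = ctr (invMetric h y) (fun a b => hessian h t y l a * S y i j b)
        + ctr (invMetric h y) (fun a b => pd t a y * covDeriv h S y i j b l)
        + ∑ c, (christoffel h y c l i * ∑ k, pd t k y * raise h S y c j k
          + christoffel h y c l j * ∑ k, pd t k y * raise h S y i c k) := by
  have H := hh.isDualPair hy
  have hd : ∀ i j k, DifferentiableAt ℝ (fun z => raise h S z i j k) y := fun i j k =>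
    diffAt_of_contDiffOn (hh.smooth_raise hS i j k) hh.isOpen hy
  have hdt : ∀ k, DifferentiableAt ℝ (pd t k) y := fun k =>
    diffAt_of_contDiffOn (contDiffOn_pd ht hh.isOpen k) hh.isOpen hy
  have e1 : ctr (invMetric h y) (fun a b => hessian h t y l a * S y i j b)
      = ∑ k, hessian h t y l k * raise h S y i j k := by
    rw [← H.ctr_swap]
    simp only [mul_comm (hessian h t y l _)]
    exact (sum_raise_mul (S := S) i j _).symm
  have e2 : ctr (invMetric h y) (fun a b => pd t a y * covDeriv h S y i j b l)
      = ∑ k, pd t k y * raise h (fun z i j k => covDeriv h S z i j k l) y i j k := by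
    rw [← H.ctr_swap]
    simp only [mul_comm (pd t _ y)]
    exact (sum_raise_mul (S := fun z i j k => covDeriv h S z i j k l) i j _).symm
  have e3 : ∀ k, pd (pd t k) l y = hessian h t y l k + ∑ m, christoffel h y m l k * pd t m y :=
    fun k => by rw [hessian]; ring
  rw [pd_sum_mul hdt (hd i j), e1, e2]
  have c1 : ∑ k, ∑ m, christoffel h y m l k * pd t m y * raise h S y i j k
      = ∑ k, ∑ m, pd t k y * (christoffel h y k l m * raise h S y i j m) := by
    rw [Finset.sum_comm]
    exact Finset.sum_congr rfl fun b _ => Finset.sum_congr rfl fun c _ => by ring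
  have c2 : ∀ (x : Fin n → ℝ) (F : Fin n → Fin n → ℝ), ∑ c, x c * ∑ k, pd t k y * F c k
      = ∑ k, ∑ c, pd t k y * (x c * F c k) := fun x F => by
    simp only [Finset.mul_sum]
    rw [Finset.sum_comm]
    exact Finset.sum_congr rfl fun b _ => Finset.sum_congr rfl fun c _ => by ring
  simp only [e3, hh.pd_raise hy hS, Finset.sum_add_distrib, Finset.sum_sub_distrib, add_mul,
    mul_add, mul_sub, Finset.sum_mul, c2]
  rw [c1]
  simp only [Finset.mul_sum]
  ring

/-- The covariant derivative of the properness condition. -/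
theorem properness_covDeriv (hS : ∀ i j k, ContDiffOn ℝ ∞ (fun z => S z i j k) U)
    (hr : ∀ i j k, S y i j k = S y i k j) (ht : ContDiffOn ℝ ∞ t U) {ρ : Euc n → ℝ}
    (hρ : DifferentiableAt ℝ ρ y) (c : ℝ)
    (e : ∀ z ∈ U, ∀ i j, scrS h S z i j - c * ((∑ k, pd t k z * raise h S z i j k)
      + pd t i z * pd t j z) = ρ z * h z i j) (i j l : Fin n) :
    ctr₂ (invMetric h y) (fun a b => covDeriv h S y i a b l) (S y j)
      + ctr₂ (invMetric h y) (S y i) (fun a b => covDeriv h S y j a b l)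
      - c * (ctr (invMetric h y) (fun a b => hessian h t y l a * S y i j b)
        + ctr (invMetric h y) (fun a b => pd t a y * covDeriv h S y i j b l)
        + hessian h t y l i * pd t j y + pd t i y * hessian h t y l j) = pd ρ l y * h y i j := by
  have hdt : ∀ k, DifferentiableAt ℝ (pd t k) y := fun k =>
    diffAt_of_contDiffOn (contDiffOn_pd ht hh.isOpen k) hh.isOpen hy
  have hd : ∀ i j k, DifferentiableAt ℝ (fun z => raise h S z i j k) y := fun i j k =>
    diffAt_of_contDiffOn (hh.smooth_raise hS i j k) hh.isOpen hy
  have hA : DifferentiableAt ℝ (fun z => ∑ k, pd t k z * raise h S z i j k) y :=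
    DifferentiableAt.fun_sum fun k _ => (hdt k).fun_mul (hd i j k)
  have hB : DifferentiableAt ℝ (fun z => scrS h S z i j) y :=
    DifferentiableAt.fun_sum fun a _ => DifferentiableAt.fun_sum fun b _ =>
      (hd i a b).fun_mul (hd j b a)
  have hT : DifferentiableAt ℝ (fun z => pd t i z * pd t j z) y := (hdt i).fun_mul (hdt j)
  have h1 := pd_congr hh.isOpen hy (fun z hz => e z hz i j) l
  rw [pd_sub hB ((hA.fun_add hT).const_mul c), pd_const_mul (hA.fun_add hT), pd_add hA hT,
    pd_mul (hdt i) (hdt j), pd_mul hρ (diffAt_of_contDiffOn (hh.smooth i j) hh.isOpen hy),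
    hh.pd_scrS hy hS hr, hh.pd_sum_grad_raise hy hS ht, hh.pd_metric hy] at h1
  have e3 : ∀ k, pd (pd t k) l y = hessian h t y l k + ∑ m, christoffel h y m l k * pd t m y :=
    fun k => by rw [hessian]; ring
  -- The Christoffel terms on the free indices are the condition itself contracted with the
  -- connection, so they match the corresponding terms from `∂ₗ h` and drop out.
  have h2 : ∑ m, (christoffel h y m l i * (ρ y * h y m j) + christoffel h y m l j * (ρ y * h y i m))
      = ρ y * ∑ m, (christoffel h y m l i * h y m j + christoffel h y m l j * h y i m) := by
    rw [Finset.mul_sum]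
    exact Finset.sum_congr rfl fun m _ => by ring
  simp only [← e y hy] at h2
  rw [← h2, e3, e3] at h1
  have h3 : ∀ (x f g u : Fin n → ℝ) (s : ℝ), ∑ m, x m * (f m - c * (g m + u m * s))
      = ∑ m, x m * f m - c * (∑ m, x m * g m + (∑ m, x m * u m) * s) := fun x f g u s => by
    rw [Finset.sum_mul, ← Finset.sum_add_distrib, Finset.mul_sum, ← Finset.sum_sub_distrib]
    exact Finset.sum_congr rfl fun m _ => by ring
  simp only [Finset.sum_add_distrib, h3, mul_comm (pd t i y) (pd t _ y)] at h1
  linear_combination h1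

/-- The Ricci tensor of the dual connection. -/
theorem ricci_dual {C : Euc n → Fin n → Fin n → Fin n → ℝ}
    (hC : ∀ i j k, ContDiffOn ℝ ∞ (fun z => C z i j k) U) (i j : Fin n) :
    ricci (dualChristoffel h C) y i j = ricci (christoffel h) y i j
      - ctr (invMetric h y) (fun a b => covDeriv h C y i j a b)
      + ctr (invMetric h y) (fun a b => covDeriv h C y a j b i)
      + (∑ b, (∑ a, raise h C y a b a) * raise h C y i j b
        - ∑ a, ∑ b, raise h C y i b a * raise h C y a j b) := by
  have H := hh.isDualPair hy
  have hd : ∀ i j k, DifferentiableAt ℝ (fun z => raise h C z i j k) y := fun i j k =>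
    diffAt_of_contDiffOn (hh.smooth_raise hC i j k) hh.isOpen hy
  have hΓ : ∀ k i j, DifferentiableAt ℝ (fun z => christoffel h z k i j) y := fun k i j =>
    diffAt_of_contDiffOn (hh.smooth_christoffel k i j) hh.isOpen hy
  have e1 : ctr (invMetric h y) (fun a b => covDeriv h C y i j a b)
      = ∑ a, raise h (fun z i j k => covDeriv h C z i j k a) y i j a := by
    rw [← H.ctr_swap]
    simp only [ctr, raise]
    exact Finset.sum_congr rfl fun a _ => Finset.sum_congr rfl fun b _ => by
      rw [H.symm_inv, mul_comm]
  have e2 : ctr (invMetric h y) (fun a b => covDeriv h C y a j b i)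
      = ∑ a, raise h (fun z i' j k => covDeriv h C z i' j k i) y a j a := by
    simp only [ctr, raise]
    exact Finset.sum_congr rfl fun a _ => Finset.sum_congr rfl fun b _ => by
      rw [H.symm_inv, mul_comm]
  have e3 : ∑ b, (∑ a, raise h C y a b a) * raise h C y i j b
      = ∑ a, ∑ b, raise h C y a b a * raise h C y i j b := by
    simp only [Finset.sum_mul]
    exact Finset.sum_comm
  rw [e1, e2, e3]
  simp only [ricci, ← Finset.sum_sub_distrib, ← Finset.sum_add_distrib]
  refine Finset.sum_congr rfl fun a _ => ?_
  simp only [curvature, dualChristoffel]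
  rw [pd_sub (hΓ a i j) (hd i j a), pd_sub (hΓ a a j) (hd a j a), hh.pd_raise hy hC,
    hh.pd_raise hy hC]
  -- Once the derivatives of the raised cubic are covariant, the mixed products of Christoffel
  -- symbols and `C` cancel because the Levi-Civita connection is torsion-free.
  simp only [hh.christoffel_symm hy _ a _, sub_mul, mul_sub, Finset.sum_sub_distrib,
    Finset.sum_add_distrib]
  simp only [mul_comm (raise h C y _ _ _) (christoffel h y _ _ _)]
  ring

end IsLocalMetric
end LocalTheory

/-! ### Proper abundant structures in a chart: vanishing of the obstruction and of `Ric*` -/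

section LocalProper

variable {n : ℕ}

/-- The local form of a proper abundant structure over a metric with `Ric = (n - 1) κ h`. -/
structure IsLocalProper (U : Set (Euc n)) (h : Euc n → Matrix (Fin n) (Fin n) ℝ)
    (S : Euc n → Fin n → Fin n → Fin n → ℝ) (t : Euc n → ℝ) (κ : ℝ) : Prop where
  metric : IsLocalMetric U h
  smooth_S : ∀ i j k, ContDiffOn ℝ ∞ (fun z => S z i j k) U
  smooth_t : ContDiffOn ℝ ∞ t U
  harmonic : ∀ z ∈ U, IsHarmonicCubic (invMetric h z) (S z)
  ric : ∀ z ∈ U, ∀ i j, ricci (christoffel h) z i j = ((n : ℝ) - 1) * κ * h z i j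
  hess : ∀ z ∈ U, ∀ i j, hessian h t z i j = 3 * schouten h z i j
    + (1 / 3) * (pd t i z * pd t j z - (1 / 2) * gradSq h t z * h z i j)
    + 1 / (3 * ((n : ℝ) - 2)) * (scrS h S z i j + ((n : ℝ) - 6) * normSq h S z * h z i j
      / (2 * ((n : ℝ) - 1) * ((n : ℝ) + 2)))
  cov : ∀ z ∈ U, ∀ i j k l,
    covDeriv h S z i j k l = (1 / 3) * symTraceFree₃ h z (tensorS₁ h S t z) i j k l
  weyl : ∀ z ∈ U, ∀ i j k l, weylPart h z (frakS h S z) i j k l = 0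
  proper : ∀ z ∈ U, ∀ i j, tau h S t z i j = 0

namespace IsLocalProper

variable {U : Set (Euc n)} {h : Euc n → Matrix (Fin n) (Fin n) ℝ}
  {S : Euc n → Fin n → Fin n → Fin n → ℝ} {t : Euc n → ℝ} {κ : ℝ}
  (P : IsLocalProper U h S t κ) (hn : 3 ≤ n) {y : Euc n} (hy : y ∈ U)
include P

theorem smooth_pd (i : Fin n) : ContDiffOn ℝ ∞ (fun z => pd t i z) U :=
  contDiffOn_pd P.smooth_t P.metric.isOpen i

theorem smooth_normS : ContDiffOn ℝ ∞ (fun z => normS (invMetric h z) (S z)) U :=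
  P.metric.smooth_ctr fun i j => P.metric.smooth_ctr fun a b => P.metric.smooth_ctr fun c d =>
    (P.smooth_S i a c).mul (P.smooth_S j b d)

theorem smooth_normT : ContDiffOn ℝ ∞ (fun z => normT (invMetric h z) (fun a => pd t a z)) U :=
  P.metric.smooth_ctr fun i j => (P.smooth_pd i).mul (P.smooth_pd j)

theorem smooth_cubicOf (i j k : Fin n) : ContDiffOn ℝ ∞ (fun z => cubicOf h S t z i j k) U :=
  contDiffOn_const.mul ((((P.smooth_S i j k).add ((P.smooth_pd i).mul (P.metric.smooth j k))).add
    ((P.smooth_pd j).mul (P.metric.smooth i k))).add ((P.smooth_pd k).mul (P.metric.smooth i j)))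

include hy in
theorem cubicOf_symm (i j k : Fin n) : cubicOf h S t y i j k = cubicOf h S t y i k j := by
  simp only [cubicOf, (P.harmonic y hy).right i j k, P.metric.symm y hy j k]
  ring

include hn hy

theorem hess_eq (i j : Fin n) : hessian h t y i j = 3 * (κ / 2 * h y i j)
    + (1 / 3) * (pd t i y * pd t j y
      - (1 / 2) * normT (invMetric h y) (fun a => pd t a y) * h y i j)
    + 1 / (3 * ((n : ℝ) - 2)) * (gram (invMetric h y) (S y) i j
      + ((n : ℝ) - 6) * normS (invMetric h y) (S y) * h y i j
        / (2 * ((n : ℝ) - 1) * ((n : ℝ) + 2))) := by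
  have H := P.metric.isDualPair hy
  rw [P.hess y hy, H.schouten_eq hn (P.ric y hy), gradSq_eq, scrS_eq (P.harmonic y hy) H, normSq_eq]
  rfl

/-- The Schouten tensor is pure trace in constant curvature, so `τ = 0` only involves `𝒮`,
`S(·,·,grad t)` and `dt²`. Since `S(·,·,grad t)` is trace-free, the coefficient of the metric is
determined by `|S|²` and `|grad t|²`. -/
theorem gram_eq (i j : Fin n) : gram (invMetric h y) (S y) i j
    = ((n : ℝ) - 2) * (along (invMetric h y) (S y) (fun a => pd t a y) i j
      + pd t i y * pd t j y) + rhoOf (invMetric h y) (S y) (fun a => pd t a y) * h y i j := by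
  have hn' : (3 : ℝ) ≤ n := by exact_mod_cast hn
  have h2 : (n : ℝ) - 2 ≠ 0 := by linarith
  have h4 : (n : ℝ) ≠ 0 := by linarith
  have H := P.metric.isDualPair hy
  have K := P.harmonic y hy
  have e0 := P.proper y hy i j
  have e1 : schouten h y = fun i j => κ / 2 * h y i j := by
    funext i j; exact H.schouten_eq hn (P.ric y hy) i j
  have e2 : scrS h S y = gram (invMetric h y) (S y) := by
    funext i j; exact scrS_eq K H i j
  have e3 : ∀ p q, ∑ k, pd t k y * raise h S y p q k
      = along (invMetric h y) (S y) (fun a => pd t a y) p q := fun p q => by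
    simp only [mul_comm (pd t _ y) (raise h S y _ _ _), sum_raise_mul]
    rfl
  have e4 : ctr (invMetric h y) (fun i j => κ / 2 * h y i j) = κ / 2 * n := by
    rw [ctr_const_mul _ fun a b => h y a b, H.ctr_self]
  have e5 : ctr (invMetric h y) (gram (invMetric h y) (S y)) = normS (invMetric h y) (S y) := rfl
  have e6 : ctr (invMetric h y) (fun a b => pd t a y * pd t b y)
      = normT (invMetric h y) (fun a => pd t a y) := rfl
  simp only [tau, e3, e1, e2, traceFree, trace_eq_ctr, e4, e5, e6, ctr_add, K.along_trace] at e0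
  rw [rhoOf]
  field_simp at e0 ⊢
  linear_combination (1 / 2) * e0

theorem weyl_eq (i j k l : Fin n) :
    quad (invMetric h y) (S y) i k j l - quad (invMetric h y) (S y) i l j k
      = (muOf (invMetric h y) (S y) (fun a => pd t a y) * h y i k
          - (along (invMetric h y) (S y) (fun a => pd t a y) i k + pd t i y * pd t k y)) * h y j l
        + (muOf (invMetric h y) (S y) (fun a => pd t a y) * h y j l
          - (along (invMetric h y) (S y) (fun a => pd t a y) j l + pd t j y * pd t l y)) * h y i k
        - (muOf (invMetric h y) (S y) (fun a => pd t a y) * h y i l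
          - (along (invMetric h y) (S y) (fun a => pd t a y) i l + pd t i y * pd t l y)) * h y j k
        - (muOf (invMetric h y) (S y) (fun a => pd t a y) * h y j k
          - (along (invMetric h y) (S y) (fun a => pd t a y) j k + pd t j y * pd t k y)) * h y i l :=
  weyl_normal_form (t := fun a => pd t a y) hn (P.gram_eq hn hy)
    (weyl_quad (P.harmonic y hy) (P.metric.isDualPair hy) (P.weyl y hy i j k l))

omit hn in
theorem cov_eq (i j k l : Fin n) : covDeriv h S y i j k l
    = (1 / 3) * prolong (h y) (invMetric h y) (S y) (fun a => pd t a y) i j k l := by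
  have H := P.metric.isDualPair hy
  have K := P.harmonic y hy
  have e2 : scrS h S y = gram (invMetric h y) (S y) := by
    funext i j; exact scrS_eq K H i j
  rw [P.cov y hy, symTraceFree₃_tensorS₁ K H e2]

/-- `gram_eq` holds on all of `U` and its coefficient `rhoOf` is smooth, so it can be
differentiated; the differential of `rhoOf` plays the role of `L`. -/
theorem obstruction_mul : (∀ i, obstruction (invMetric h y) (S y) (fun a => pd t a y) κ * pd t i y = 0)
    ∧ ∀ i j k, obstruction (invMetric h y) (S y) (fun a => pd t a y) κ * S y i j k = 0 := by
  have H := P.metric.isDualPair hy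
  have K := P.harmonic y hy
  have hρ : ContDiffOn ℝ ∞ (fun z => rhoOf (invMetric h z) (S z) (fun a => pd t a z)) U :=
    (P.smooth_normS.sub (contDiffOn_const.mul P.smooth_normT)).div_const _
  have hL := P.metric.properness_covDeriv hy P.smooth_S K.right P.smooth_t
    (diffAt_of_contDiffOn hρ P.metric.isOpen hy) ((n : ℝ) - 2) (fun z hz i j => by
      rw [scrS_eq (P.harmonic z hz) (P.metric.isDualPair hz), P.gram_eq hn hz]
      simp only [mul_comm (pd t _ z) (raise h S z _ _ _), sum_raise_mul, along]
      ring)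
  exact obstruction_mul_eq_zero (t := fun a => pd t a y) K H hn (P.gram_eq hn hy)
    (P.weyl_eq hn hy) (P.cov_eq hy) (P.hess_eq hn hy) hL

/-- A nonzero value persists nearby and forces `dt = 0` and `S = 0` there. The Hessian equation then
reads `0 = (3κ/2) h`, so `κ = 0`, and all three terms of the obstruction vanish. -/
theorem obstruction_eq_zero : obstruction (invMetric h y) (S y) (fun a => pd t a y) κ = 0 := by
  by_contra hne
  have H := P.metric.isDualPair hy
  have hn' : (3 : ℝ) ≤ n := by exact_mod_cast hn
  have hc : ContinuousOn
      (fun z => obstruction (invMetric h z) (S z) (fun a => pd t a z) κ) U :=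
    ((P.smooth_normS.sub (contDiffOn_const.mul P.smooth_normT)).sub contDiffOn_const).continuousOn
  have hev := (hc.continuousAt (P.metric.isOpen.mem_nhds hy)).eventually_ne hne
  -- Vanishing of `dt` on a neighbourhood, not only at `y`, is needed for the second derivatives of
  -- `t` to vanish at `y`.
  have ht : ∀ i, ∀ᶠ z in nhds y, pd t i z = 0 := fun i => by
    filter_upwards [hev, P.metric.isOpen.mem_nhds hy] with z hz hzU
    exact (mul_eq_zero.1 ((P.obstruction_mul hn hzU).1 i)).resolve_left hz
  have ht0 : ∀ i, pd t i y = 0 := fun i => (ht i).self_of_nhds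
  have hS0 : ∀ i j k, S y i j k = 0 := fun i j k =>
    (mul_eq_zero.1 ((P.obstruction_mul hn hy).2 i j k)).resolve_left hne
  have htt : ∀ i j, pd (pd t j) i y = 0 := fun i j => by
    have : pd t j =ᶠ[nhds y] fun _ => 0 := ht j
    rw [pd, this.fderiv_eq]
    simp
  have g0 : ∀ i j, gram (invMetric h y) (S y) i j = 0 := fun i j => by
    simp [gram, quad, ctr, hS0]
  have s0 : normS (invMetric h y) (S y) = 0 := by
    rw [normS, ctr_congr g0]; simp [ctr]
  have n0 : normT (invMetric h y) (fun a => pd t a y) = 0 := by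
    simp [normT, ctr, ht0]
  have hκ : ∀ i j, κ * h y i j = 0 := fun i j => by
    have h1 := P.hess_eq hn hy i j
    rw [n0, s0, g0] at h1
    simp only [hessian, htt, ht0, mul_zero, zero_mul, zero_div, Finset.sum_const_zero, add_zero,
      sub_zero] at h1
    linarith
  have hκ0 : κ = 0 := by
    have h1 := ctr_congr (G := invMetric h y) hκ
    rw [ctr_const_mul _ fun a b => h y a b, H.ctr_self] at h1
    simp only [ctr, mul_zero, Finset.sum_const_zero] at h1
    exact (mul_eq_zero.1 h1).resolve_right (by linarith)
  exact hne (by rw [obstruction, s0, n0, hκ0]; ring)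

omit hn in
-- The Leibniz rule with a parallel metric: only `S` and `dt` are differentiated.
theorem covDeriv_cubicOf (i j k l : Fin n) : covDeriv h (cubicOf h S t) y i j k l
    = 1 / 3 * (covDeriv h S y i j k l + hessian h t y l i * h y j k + hessian h t y l j * h y i k
      + hessian h t y l k * h y i j) := by
  have hS : ∀ i j k, DifferentiableAt ℝ (fun z => S z i j k) y := fun i j k =>
    diffAt_of_contDiffOn (P.smooth_S i j k) P.metric.isOpen hy
  have ht : ∀ i, DifferentiableAt ℝ (pd t i) y := fun i =>
    diffAt_of_contDiffOn (P.smooth_pd i) P.metric.isOpen hy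
  have hh : ∀ i j, DifferentiableAt ℝ (fun z => h z i j) y := fun i j =>
    diffAt_of_contDiffOn (P.metric.smooth i j) P.metric.isOpen hy
  have e1 : pd (fun z => cubicOf h S t z i j k) l y
      = 1 / 3 * (pd (fun z => S z i j k) l y
        + (pd (pd t i) l y * h y j k + pd t i y * pd (fun z => h z j k) l y)
        + (pd (pd t j) l y * h y i k + pd t j y * pd (fun z => h z i k) l y)
        + (pd (pd t k) l y * h y i j + pd t k y * pd (fun z => h z i j) l y)) := by
    simp only [cubicOf]
    rw [pd_const_mul ((((hS i j k).fun_add ((ht i).fun_mul (hh j k))).fun_add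
        ((ht j).fun_mul (hh i k))).fun_add ((ht k).fun_mul (hh i j))),
      pd_add (((hS i j k).fun_add ((ht i).fun_mul (hh j k))).fun_add
        ((ht j).fun_mul (hh i k))) ((ht k).fun_mul (hh i j)),
      pd_add ((hS i j k).fun_add ((ht i).fun_mul (hh j k))) ((ht j).fun_mul (hh i k)),
      pd_add (hS i j k) ((ht i).fun_mul (hh j k)), pd_mul (ht i) (hh j k), pd_mul (ht j) (hh i k),
      pd_mul (ht k) (hh i j)]
  have e2 : ∀ k, pd (pd t k) l y = hessian h t y l k + ∑ m, christoffel h y m l k * pd t m y :=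
    fun k => by rw [hessian]; ring
  have e3 : ∑ m, (christoffel h y m l i * cubicOf h S t y m j k
        + christoffel h y m l j * cubicOf h S t y i m k
        + christoffel h y m l k * cubicOf h S t y i j m)
      = 1 / 3 * (∑ m, (christoffel h y m l i * S y m j k + christoffel h y m l j * S y i m k
          + christoffel h y m l k * S y i j m)
        + ((∑ m, christoffel h y m l i * pd t m y) * h y j k
          + pd t i y * ∑ m, (christoffel h y m l j * h y m k + christoffel h y m l k * h y j m))
        + ((∑ m, christoffel h y m l j * pd t m y) * h y i k
          + pd t j y * ∑ m, (christoffel h y m l i * h y m k + christoffel h y m l k * h y i m))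
        + ((∑ m, christoffel h y m l k * pd t m y) * h y i j
          + pd t k y * ∑ m, (christoffel h y m l i * h y m j + christoffel h y m l j * h y i m))) := by
    simp only [cubicOf, Finset.mul_sum, Finset.sum_mul, ← Finset.sum_add_distrib]
    exact Finset.sum_congr rfl fun m _ => by ring
  rw [covDeriv, e1, e3, e2, e2, e2, P.metric.pd_metric hy, P.metric.pd_metric hy,
    P.metric.pd_metric hy, covDeriv]
  ring

/-- In `ricci_dual` the trace of `Ĉ` is `(n+2)/3 dt`. The terms of first order thus become the
divergence of `C` and the Hessian of `t`, the quadratic terms become `along` and `gram` of the cubic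
form, and `dual_ricci_algebra` applies. -/
theorem dual_ricci_eq_zero (i j : Fin n) :
    ricci (dualChristoffel h (cubicOf h S t)) y i j = 0 := by
  have H := P.metric.isDualPair hy
  have K := P.harmonic y hy
  have cub : cubicOf h S t y = cubicForm (h y) (S y) (fun a => pd t a y) := rfl
  have csymm' : ∀ i a b, cubicOf h S t y i a b = cubicOf h S t y a i b := fun i a b => by
    simp only [cubicOf, K.left i a b, H.symm i a]; ring
  have e1 : ∀ b, ∑ a, raise h (cubicOf h S t) y a b a = ((n : ℝ) + 2) / 3 * pd t b y := fun b => by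
    refine Eq.trans ?_ (trace_cubicForm K H (t := fun a => pd t a y) b)
    rw [← cub]
    simp only [raise, ctr]
    exact Finset.sum_congr rfl fun a _ => Finset.sum_congr rfl fun c _ => by
      rw [H.symm_inv, mul_comm]
  have e2 : ∑ b, (∑ a, raise h (cubicOf h S t) y a b a) * raise h (cubicOf h S t) y i j b
      = ((n : ℝ) + 2) / 3 * along (invMetric h y) (cubicForm (h y) (S y) fun a => pd t a y)
        (fun a => pd t a y) i j := by
    rw [along, ← cub, ← sum_raise_mul, Finset.mul_sum]
    exact Finset.sum_congr rfl fun b _ => by rw [e1]; ring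
  have e3 : ∑ a, ∑ b, raise h (cubicOf h S t) y i b a * raise h (cubicOf h S t) y a j b
      = gram (invMetric h y) (cubicForm (h y) (S y) fun a => pd t a y) i j := by
    rw [gram_eq_ctr₂, ← cub, ← sum_raise_mul_raise H (P.cubicOf_symm hy i), Finset.sum_comm]
    refine Finset.sum_congr rfl fun a _ => Finset.sum_congr rfl fun b _ => ?_
    congr 1
    simp only [raise, csymm' b j]
  have e4 : ctr (invMetric h y) (fun a b => covDeriv h (cubicOf h S t) y a j b i)
      = ((n : ℝ) + 2) / 3 * hessian h t y i j := by
    have q1 : ctr (invMetric h y) (fun a b => hessian h t y i b * h y a j)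
        = hessian h t y i j := by
      rw [H.ctr_swap fun a b => hessian h t y i a * h y b j]
      simp only [H.symm _ j]
      exact H.ctr_mul_h j _
    have q2 : ctr (invMetric h y) (fun a b => hessian h t y i j * h y a b)
        = hessian h t y i j * n := by
      rw [ctr_const_mul _ fun a b => h y a b, H.ctr_self]
    have q3 : ctr (invMetric h y) (fun a b => hessian h t y i a * h y j b) = hessian h t y i j :=
      H.ctr_mul_h j _
    simp only [P.covDeriv_cubicOf hy, P.cov_eq hy, ctr_const_mul, ctr_add, q1, q2, q3,
      prolong_traceless K H]
    ring
  rw [P.metric.ricci_dual hy P.smooth_cubicOf, P.ric y hy, e2, e3, e4]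
  simp only [P.covDeriv_cubicOf hy]
  exact dual_ricci_algebra (t := fun a => pd t a y) K H hn (P.gram_eq hn hy) (P.cov_eq hy)
    (P.hess_eq hn hy) (P.obstruction_eq_zero hn hy) i j

end IsLocalProper
end LocalProper

/-! ### Structure equations of a hypersurface and its Weingarten operator -/

section LocalHypersurface

variable {n : ℕ}

namespace IsDualPair

variable {h G : Matrix (Fin n) (Fin n) ℝ} (H : IsDualPair h G)
include H

theorem sum_mul_metric_mul_inv (x : Fin n → ℝ) (m : Fin n) :
    ∑ k, (∑ l, x l * h l k) * G k m = x m := by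
  simp only [Finset.sum_mul, mul_assoc]
  rw [Finset.sum_comm]
  simp only [← Finset.mul_sum, H.mul_inv, mul_ite, mul_one, mul_zero, Finset.sum_ite_eq',
    Finset.mem_univ, if_true]

theorem sum_mul_inv_mul_metric (x : Fin n → ℝ) (m : Fin n) :
    ∑ k, (∑ l, x l * G l k) * h k m = x m := by
  simp only [Finset.sum_mul, mul_assoc]
  rw [Finset.sum_comm]
  simp only [← Finset.mul_sum, H.inv_mul, mul_ite, mul_one, mul_zero, Finset.sum_ite_eq',
    Finset.mem_univ, if_true]

end IsDualPair

section Frame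

variable {F X : Euc n → Euc (n + 1)} {y : Euc n}

theorem frameMap_eq (p : Euc n × ℝ) :
    frameMap F X y p = ∑ k, p.1 k • pd F k y + p.2 • X y := by
  have h1 : p.1 = ∑ k, p.1 k • EuclideanSpace.single k (1 : ℝ) := by
    ext i
    simp [Pi.single_apply]
  rw [frameMap]
  conv_lhs => rw [h1]
  simp only [map_sum, map_smul, pd]

theorem splitting_spec (hs : Function.Surjective (frameMap F X y)) (v : Euc (n + 1)) :
    v = ∑ k, (splitting F X y v).1 k • pd F k y + (splitting F X y v).2 • X y := by
  rw [← frameMap_eq]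
  exact (Function.rightInverse_invFun hs v).symm

theorem frame_coeff_unique (hi : Function.Injective (frameMap F X y)) {a b : Fin n → ℝ} {c d : ℝ}
    (e : ∑ k, a k • pd F k y + c • X y = ∑ k, b k • pd F k y + d • X y) : a = b := by
  have h1 : frameMap F X y (WithLp.toLp 2 a, c) = frameMap F X y (WithLp.toLp 2 b, d) := by
    simp only [frameMap_eq]
    exact e
  have h2 := congrArg Prod.fst (hi h1)
  funext k
  exact congrArg (fun v : Euc n => v k) h2

theorem pd_pd_eq (hs : Function.Surjective (frameMap F X y)) (i j : Fin n) :
    pd (pd F j) i y = ∑ k, inducedChristoffel F X y k i j • pd F k y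
      + fundamentalForm F X y i j • X y :=
  splitting_spec hs _

theorem pd_transversal_eq (hs : Function.Surjective (frameMap F X y)) (i : Fin n) :
    pd X i y = ∑ k, (-weingarten F X y k i) • pd F k y + transversalForm F X y i • X y := by
  simp only [weingarten, neg_neg]
  exact splitting_spec hs _

end Frame

variable {U : Set (Euc n)} {F X : Euc n → Euc (n + 1)} {y : Euc n}

/-- The Gauss equation of a relative normalisation. -/
theorem curvature_inducedChristoffel (hU : IsOpen U) (hy : y ∈ U) (hF : ContDiffOn ℝ ∞ F U)
    (hX : ContDiffOn ℝ ∞ X U) (hb : ∀ z ∈ U, Function.Bijective (frameMap F X z))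
    (hΓ : ∀ k i j, ContDiffOn ℝ ∞ (fun z => inducedChristoffel F X z k i j) U)
    (hG : ∀ i j, ContDiffOn ℝ ∞ (fun z => fundamentalForm F X z i j) U)
    (k i j m : Fin n) :
    curvature (inducedChristoffel F X) y k i j m
      = fundamentalForm F X y i j * weingarten F X y m k
        - fundamentalForm F X y k j * weingarten F X y m i := by
  have hdF : ∀ m, DifferentiableAt ℝ (pd F m) y := fun m =>
    diffAt_of_contDiffOn (contDiffOn_pd hF hU m) hU hy
  have hdX : DifferentiableAt ℝ X y := diffAt_of_contDiffOn hX hU hy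
  have hdΓ : ∀ k i j, DifferentiableAt ℝ (fun z => inducedChristoffel F X z k i j) y :=
    fun k i j => diffAt_of_contDiffOn (hΓ k i j) hU hy
  have hdG : ∀ i j, DifferentiableAt ℝ (fun z => fundamentalForm F X z i j) y :=
    fun i j => diffAt_of_contDiffOn (hG i j) hU hy
  have third : ∀ k i, pd (pd (pd F j) i) k y
      = ∑ a, (pd (fun z => inducedChristoffel F X z a i j) k y
          + ∑ m, inducedChristoffel F X y a k m * inducedChristoffel F X y m i j
          - fundamentalForm F X y i j * weingarten F X y a k) • pd F a y
        + (pd (fun z => fundamentalForm F X z i j) k y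
          + ∑ m, inducedChristoffel F X y m i j * fundamentalForm F X y k m
          + fundamentalForm F X y i j * transversalForm F X y k) • X y := by
    intro k i
    rw [pd_congr hU hy (fun z hz => pd_pd_eq (hb z hz).2 i j) k,
      pd_add (DifferentiableAt.fun_sum fun m _ => (hdΓ m i j).fun_smul (hdF m))
        ((hdG i j).fun_smul hdX),
      pd_sum fun m _ => (hdΓ m i j).fun_smul (hdF m), pd_smul (hdG i j) hdX,
      pd_transversal_eq (hb y hy).2]
    have e1 : ∀ m, pd (fun z => inducedChristoffel F X z m i j • pd F m z) k y
        = pd (fun z => inducedChristoffel F X z m i j) k y • pd F m y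
          + (∑ a, (inducedChristoffel F X y a k m * inducedChristoffel F X y m i j) • pd F a y
            + (inducedChristoffel F X y m i j * fundamentalForm F X y k m) • X y) := fun m => by
      rw [pd_smul (hdΓ m i j) (hdF m), pd_pd_eq (hb y hy).2 k m, smul_add, Finset.smul_sum,
        smul_smul]
      simp only [smul_smul, mul_comm (inducedChristoffel F X y m i j) (inducedChristoffel F X y _ k m)]
    simp only [e1, Finset.sum_add_distrib, add_smul, sub_smul, smul_add, Finset.smul_sum, smul_smul,
      Finset.sum_smul, Finset.sum_sub_distrib, neg_smul, smul_neg, Finset.sum_neg_distrib]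
    rw [Finset.sum_comm (f := fun m a => (inducedChristoffel F X y a k m
      * inducedChristoffel F X y m i j) • pd F a y)]
    abel
  -- Third derivatives of `F` are symmetric. Comparing tangential coefficients is the Gauss
  -- equation; the coefficient along `X`, the only place where `Θ` enters, is discarded.
  have h1 := pd_comm (contDiffOn_pd hF hU j) hU hy i k
  rw [third, third] at h1
  have h2 := congrFun (frame_coeff_unique (hb y hy).1 h1) m
  rw [curvature, Finset.sum_sub_distrib]
  linear_combination h2

/-- The metric and the cubic determine the induced connection: raising the last index of `C`
recovers its difference from the Levi-Civita connection. -/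
theorem IsLocalMetric.inducedChristoffel_eq {h : Euc n → Matrix (Fin n) (Fin n) ℝ}
    (hh : IsLocalMetric U h) (hy : y ∈ U) (hG : ∀ z ∈ U, fundamentalForm F X z = h z)
    {C : Euc n → Fin n → Fin n → Fin n → ℝ}
    (hC : ∀ i j k, hypersurfaceCubic F X y i j k = C y i j k) (l i j : Fin n) :
    inducedChristoffel F X y l i j = christoffel h y l i j + raise h C y i j l := by
  have e1 : ∀ l i j, christoffel (fundamentalForm F X) y l i j = christoffel h y l i j :=
    fun l i j => by
      have : ∀ a b c, pd (fun z => fundamentalForm F X z a b) c y = pd (fun z => h z a b) c y :=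
        fun a b c => pd_congr hh.isOpen hy (fun z hz => by rw [hG z hz]) c
      simp only [christoffel, invMetric, this, hG y hy]
  have h1 := (hh.isDualPair hy).sum_mul_metric_mul_inv
    (fun l => inducedChristoffel F X y l i j - christoffel h y l i j) l
  have h2 : ∀ k, ∑ l, (inducedChristoffel F X y l i j - christoffel h y l i j) * h y l k
      = C y i j k := fun k => by
    rw [← hC, hypersurfaceCubic]
    simp only [e1, hG y hy]
  simp only [h2] at h1
  rw [raise, h1]
  ring

/-- A relative normalisation whose dual connection is Ricci-flat has vanishing Weingarten
operator. -/
theorem IsLocalMetric.weingarten_eq_zero (hn : 3 ≤ n) {h : Euc n → Matrix (Fin n) (Fin n) ℝ}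
    (hh : IsLocalMetric U h) (hy : y ∈ U) (hF : ContDiffOn ℝ ∞ F U)
    (hX : ContDiffOn ℝ ∞ X U) (hb : ∀ z ∈ U, Function.Bijective (frameMap F X z))
    (hG : ∀ z ∈ U, fundamentalForm F X z = h z) {C : Euc n → Fin n → Fin n → Fin n → ℝ}
    (smooth_C : ∀ i j k, ContDiffOn ℝ ∞ (fun z => C z i j k) U)
    (symm_C : ∀ z ∈ U, ∀ i j k, C z i j k = C z i k j)
    (hC : ∀ z ∈ U, ∀ i j k, hypersurfaceCubic F X z i j k = C z i j k)
    (hric : ∀ i j, ricci (dualChristoffel h C) y i j = 0) (k i : Fin n) :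
    weingarten F X y k i = 0 := by
  have hn' : (3 : ℝ) ≤ n := by exact_mod_cast hn
  have H := hh.isDualPair hy
  have hind : ∀ z ∈ U, ∀ l i j, inducedChristoffel F X z l i j
      = christoffel h z l i j + raise h C z i j l := fun z hz l i j =>
    hh.inducedChristoffel_eq hz hG (hC z hz) l i j
  have smooth_Γ : ∀ k i j, ContDiffOn ℝ ∞ (fun z => inducedChristoffel F X z k i j) U :=
    fun k i j => ((hh.smooth_christoffel k i j).add (hh.smooth_raise smooth_C i j k)).congr
      fun z hz => hind z hz k i j
  have smooth_Δ : ∀ k i j, ContDiffOn ℝ ∞ (fun z => dualChristoffel h C z k i j) U :=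
    fun k i j => (hh.smooth_christoffel k i j).sub (hh.smooth_raise smooth_C i j k)
  have gauss := curvature_inducedChristoffel hh.isOpen hy hF hX hb smooth_Γ
    fun i j => (hh.smooth i j).congr fun z hz => by rw [hG z hz]
  rw [hG y hy] at gauss
  -- Adding `Ĉ` for one argument and subtracting it for the other changes `∇h = 0` by `C(l,i,j) -
  -- C(l,j,i)`, which is zero. Hence the induced connection and `∇*` are dual.
  have dual : ∀ z ∈ U, ∀ i j l, pd (fun z => h z i j) l z
      = ∑ m, (inducedChristoffel F X z m l i * h z m j + dualChristoffel h C z m l j * h z i m) := by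
    intro z hz i j l
    have h1 := (hh.isDualPair hz).sum_mul_inv_mul_metric (fun m => C z l i m) j
    have h2 := (hh.isDualPair hz).sum_mul_inv_mul_metric (fun m => C z l j m) i
    have h3 : ∑ m, raise h C z l i m * h z m j = ∑ m, raise h C z l j m * h z i m := by
      simp only [(hh.isDualPair hz).symm i]
      simp only [raise]
      rw [h1, h2, symm_C z hz]
    rw [hh.pd_metric hz]
    simp only [hind z hz, dualChristoffel, add_mul, sub_mul, Finset.sum_add_distrib,
      Finset.sum_sub_distrib]
    rw [h3]
    ring
  set A : Fin n → Fin n → ℝ := fun k j => ∑ m, weingarten F X y m k * h y m j with hA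
  -- Duality carries the Gauss equation over to the curvature of `∇*`, where `A` is the Weingarten
  -- operator with its index lowered.
  have key : ∀ k l i j, ∑ m, curvature (dualChristoffel h C) y k l j m * h y m i
      = h y k i * A l j - h y l i * A k j := fun k l i j => by
    have h1 := hh.curvature_dual hy
      (fun k i j => diffAt_of_contDiffOn (smooth_Γ k i j) hh.isOpen hy)
      (fun k i j => diffAt_of_contDiffOn (smooth_Δ k i j) hh.isOpen hy) dual k l i j
    simp only [gauss, Finset.sum_add_distrib, sub_mul, Finset.sum_sub_distrib, mul_assoc,
      ← Finset.mul_sum] at h1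
    simp only [H.symm _ i] at h1 ⊢
    linear_combination h1
  -- The trace over `k` and `i` turns the two terms into `n A` and `A`, that is, `Ric* = (n-1) A`.
  have hA0 : ∀ l j, A l j = 0 := fun l j => by
    have h1 := H.ctr_mul_metric fun k m => curvature (dualChristoffel h C) y k l j m
    have h2 : ctr (invMetric h y) (fun k i => h y k i * A l j) = n * A l j := by
      rw [ctr_mul_const (A l j) fun k i => h y k i, H.ctr_self]
    have h3 : ctr (invMetric h y) (fun k i => h y l i * A k j) = A l j := by
      rw [← H.ctr_swap]
      exact H.ctr_h_mul l fun k => A k j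
    have h4 := hric l j
    rw [ricci, ← h1, ctr_congr fun k i => key k l i j, ctr_sub, h2, h3] at h4
    have h5 : ((n : ℝ) - 1) * A l j = 0 := by linear_combination h4
    exact (mul_eq_zero.1 h5).resolve_left (by linarith)
  have h1 := H.sum_mul_metric_mul_inv (fun m => weingarten F X y m i) k
  have h2 : ∀ j, ∑ m, weingarten F X y m i * h y m j = 0 := fun j => hA0 i j
  simp only [h2, zero_mul, Finset.sum_const_zero] at h1
  exact h1.symm

end LocalHypersurface

/-! ### Passage between the manifold and its charts -/

section Charts

variable {n : ℕ} {M : Type*} [TopologicalSpace M] [ChartedSpace (Euc n) M]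
  {φ : OpenPartialHomeomorph M (Euc n)} {y : Euc n}

theorem sum_smul_single (v : Euc n) : ∑ i, v i • EuclideanSpace.single i (1 : ℝ) = v := by
  ext i
  simp [Pi.single_apply]

theorem map_eq_sum_smul_single {V : Type*} [AddCommGroup V] [Module ℝ V] [TopologicalSpace V]
    (L : Euc n →L[ℝ] V) (v : Euc n) : L v = ∑ i, v i • L (EuclideanSpace.single i 1) := by
  conv_lhs => rw [← sum_smul_single v]
  simp only [map_sum, map_smul]

theorem mfderiv_symm_apply (v : Euc n) :
    (mfderiv (𝓡 n) (𝓡 n) φ.symm y v : TangentSpace (𝓡 n) (φ.symm y))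
      = ∑ i, v i • coordVec φ y i :=
  map_eq_sum_smul_single (V := TangentSpace (𝓡 n) (φ.symm y)) (mfderiv (𝓡 n) (𝓡 n) φ.symm y) v

section Smoothness

variable (hφ : φ ∈ charts n M)
include hφ

theorem chart_mdifferentiable : φ.MDifferentiable (𝓡 n) (𝓡 n) :=
  ⟨(contMDiffOn_of_mem_maximalAtlas hφ).mdifferentiableOn (by simp),
    (contMDiffOn_symm_of_mem_maximalAtlas hφ).mdifferentiableOn (by simp)⟩

theorem mfderiv_symm_bijective (hy : y ∈ φ.target) :
    Function.Bijective (mfderiv (𝓡 n) (𝓡 n) φ.symm y) :=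
  (chart_mdifferentiable hφ).symm.mfderiv_bijective hy

theorem inChart_smooth {m : ℕ} {f : M → Euc m} (hf : ContMDiff (𝓡 n) (𝓡 m) ∞ f) :
    ContDiffOn ℝ ∞ (inChart φ f) φ.target :=
  (hf.comp_contMDiffOn (contMDiffOn_symm_of_mem_maximalAtlas hφ)).contDiffOn

theorem inChart_smooth_real {f : M → ℝ} (hf : ContMDiff (𝓡 n) 𝓘(ℝ) ∞ f) :
    ContDiffOn ℝ ∞ (inChart φ f) φ.target :=
  (hf.comp_contMDiffOn (contMDiffOn_symm_of_mem_maximalAtlas hφ)).contDiffOn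

theorem fderiv_inChart {m : ℕ} {f : M → Euc m} (hf : ContMDiff (𝓡 n) (𝓡 m) ∞ f)
    (hy : y ∈ φ.target) (v : Euc n) : fderiv ℝ (inChart φ f) y v
      = mfderiv (𝓡 n) (𝓡 m) f (φ.symm y) (mfderiv (𝓡 n) (𝓡 n) φ.symm y v) := by
  have h1 : MDifferentiableAt (𝓡 n) (𝓡 n) φ.symm y :=
    (chart_mdifferentiable hφ).symm.mdifferentiableAt hy
  have h2 : MDifferentiableAt (𝓡 n) (𝓡 m) f (φ.symm y) := hf.mdifferentiable (by simp) _
  have h3 := mfderiv_comp y h2 h1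
  rw [← mfderiv_eq_fderiv]
  exact DFunLike.congr_fun h3 v

/-- Transversality kills the coefficient of `ξ` and the immersion property kills the tangential
part, so the frame map is injective. Source and target both have dimension `n + 1`. -/
theorem IsNormalisation.frameMap_bijective {f ξ : M → Euc (n + 1)} (N : IsNormalisation f ξ)
    (hy : y ∈ φ.target) : Function.Bijective (frameMap (inChart φ f) (inChart φ ξ) y) := by
  let L : Euc n × ℝ →ₗ[ℝ] Euc (n + 1) :=
    (fderiv ℝ (inChart φ f) y : Euc n →ₗ[ℝ] Euc (n + 1)).coprod
      (LinearMap.toSpanSingleton ℝ _ (inChart φ ξ y))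
  have hL : ∀ p, L p = frameMap (inChart φ f) (inChart φ ξ) y p := fun p => rfl
  have hinj : Function.Injective L := by
    rw [injective_iff_map_eq_zero]
    rintro ⟨v, a⟩ h0
    have h1 : fderiv ℝ (inChart φ f) y v + a • inChart φ ξ y = 0 := h0
    have ha : a = 0 := by
      by_contra hne
      -- If `F_* v + a ξ = 0` with `a ≠ 0`, then `F_* (-a⁻¹ v) = ξ`, so `ξ` would be tangent.
      refine N.transversal (φ.symm y) ⟨mfderiv (𝓡 n) (𝓡 n) φ.symm y (-a⁻¹ • v), ?_⟩
      have h2 := fderiv_inChart hφ N.smooth_f hy (-a⁻¹ • v)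
      refine h2.symm.trans ?_
      have h3 : fderiv ℝ (inChart φ f) y v = -(a • inChart φ ξ y) := eq_neg_of_add_eq_zero_left h1
      rw [map_smul, h3, smul_neg, neg_smul, neg_neg, smul_smul, inv_mul_cancel₀ hne, one_smul]
      rfl
    subst ha
    rw [zero_smul, add_zero, fderiv_inChart hφ N.smooth_f hy] at h1
    have h2 := N.immersion _ (h1.trans (map_zero _).symm)
    have h3 := (mfderiv_symm_bijective hφ hy).1 (h2.trans (map_zero _).symm)
    exact Prod.ext h3 rfl
  have hsurj : Function.Surjective L :=
    (LinearMap.injective_iff_surjective_of_finrank_eq_finrank (by simp)).1 hinj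
  exact ⟨hinj, hsurj⟩

end Smoothness

variable [IsManifold (𝓡 n) ∞ M] (hφ : φ ∈ charts n M)
include hφ

/-- A coordinate field is the tangent map of the inverse chart applied to a constant section. -/
theorem coordVec_smooth (i : Fin n) :
    ContMDiffOn (𝓡 n) (𝓡 n).tangent ∞
      (fun y => (⟨φ.symm y, coordVec φ y i⟩ : TangentBundle (𝓡 n) M)) φ.target := by
  have h1 : ContMDiffOn (𝓡 n) (𝓡 n) ∞ φ.symm φ.target := contMDiffOn_symm_of_mem_maximalAtlas hφ
  have h2 := h1.contMDiffOn_tangentMapWithin (m := ∞) (by simp) φ.open_target.uniqueMDiffOn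
  have h3 : ContMDiffOn (𝓡 n) (𝓡 n).tangent ∞
      (fun y : Euc n => (⟨y, EuclideanSpace.single i 1⟩ : TangentBundle (𝓡 n) (Euc n)))
      φ.target :=
    contMDiffOn_vectorSpace_iff_contDiffOn.2 contDiffOn_const
  refine (h2.comp h3 fun y hy => hy).congr fun y hy => ?_
  simp only [Function.comp, tangentMapWithin, coordVec]
  rw [mfderivWithin_of_isOpen φ.open_target hy]

theorem metricComp_smooth (g : Metric n M) (i j : Fin n) :
    ContDiffOn ℝ ∞ (fun y => metricComp g φ y i j) φ.target := by
  intro y hy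
  have hb : ContMDiffWithinAt (𝓡 n) (𝓡 n) ∞ φ.symm φ.target y :=
    contMDiffOn_symm_of_mem_maximalAtlas hφ y hy
  have h1 : ContMDiffWithinAt (𝓡 n) ((𝓡 n).prod 𝓘(ℝ)) ∞
      (fun y => Bundle.TotalSpace.mk' ℝ (E := Bundle.Trivial M ℝ) (φ.symm y)
        (g.inner (φ.symm y) (coordVec φ y i) (coordVec φ y j))) φ.target y := by
    apply ContMDiffWithinAt.clm_bundle_apply₂ (F₁ := Euc n) (F₂ := Euc n)
    · exact ContMDiffAt.comp_contMDiffWithinAt y g.contMDiff.contMDiffAt hb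
    · exact coordVec_smooth hφ i y hy
    · exact coordVec_smooth hφ j y hy
  simp only [Bundle.contMDiffWithinAt_totalSpace] at h1
  exact h1.2.contDiffWithinAt

/-- A null vector of the matrix would be the coordinates of a nonzero tangent vector of length zero.
-/
theorem metricComp_det_ne_zero (g : Metric n M) (hy : y ∈ φ.target) :
    (metricComp g φ y).det ≠ 0 := by
  intro h0
  obtain ⟨v, hv, hv0⟩ := Matrix.exists_mulVec_eq_zero_iff.2 h0
  set V : TangentSpace (𝓡 n) (φ.symm y) := ∑ i, v i • coordVec φ y i with hV
  have h1 : V ≠ 0 := fun h => by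
    have h2 : (mfderiv (𝓡 n) (𝓡 n) φ.symm y (WithLp.toLp 2 v : Euc n)
        : TangentSpace (𝓡 n) (φ.symm y)) = 0 :=
      (mfderiv_symm_apply _).trans h
    have h3 : (WithLp.toLp 2 v : Euc n) = 0 :=
      (mfderiv_symm_bijective hφ hy).1 (h2.trans (map_zero _).symm)
    exact hv (by simpa using congrArg WithLp.ofLp h3)
  have h2 : g.inner (φ.symm y) V V = ∑ i, v i * ∑ j, metricComp g φ y i j * v j := by
    rw [hV]
    simp only [map_sum, sum_apply, map_smul, smul_apply, smul_eq_mul, Finset.mul_sum, metricComp]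
    rw [Finset.sum_comm]
    exact Finset.sum_congr rfl fun i _ => Finset.sum_congr rfl fun j _ => by ring
  have h3 := g.pos _ V h1
  have h4 : ∀ i, ∑ j, metricComp g φ y i j * v j = 0 := fun i => congrFun hv0 i
  simp only [h2, h4, mul_zero, Finset.sum_const_zero, lt_self_iff_false] at h3

theorem isLocalMetric_metricComp (g : Metric n M) : IsLocalMetric φ.target (metricComp g φ) where
  isOpen := φ.open_target
  smooth := metricComp_smooth hφ g
  symm _ _ _ _ := g.symm _ _ _
  det_ne_zero _ hz := metricComp_det_ne_zero hφ g hz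

theorem IsAbundantManifold.isLocalProper {g : Metric n M} {κ : ℝ}
    (hκ : HasConstantSectionalCurvature g κ) {S : CubicField n M} {t : M → ℝ}
    (hab : IsAbundantManifold g S t) (hp : IsProper g S t) :
    IsLocalProper φ.target (metricComp g φ) (S.comp φ) (inChart φ t) κ where
  metric := isLocalMetric_metricComp hφ g
  smooth_S := hab.smooth_S φ hφ
  smooth_t := inChart_smooth_real hφ hab.smooth_t
  harmonic z hz :=
    { left := fun _ _ _ => hab.symm_left _ _ _ _
      right := fun _ _ _ => hab.symm_right _ _ _ _
      traceless := hab.traceFree_S φ hφ z hz }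
  ric z hz := (isLocalMetric_metricComp hφ g).ricci_of_constant_curvature hz (hκ φ hφ z hz)
  hess := hab.hessian_t φ hφ
  cov := hab.covDeriv_S φ hφ
  weyl := hab.weyl_S φ hφ
  proper := hp φ hφ

omit hφ in
-- The derivative vanishes on a coordinate ball, which is convex, so the map is locally constant;
-- preconnectedness makes it constant.
theorem exists_const_of_pd_eq_zero [PreconnectedSpace M] {m : ℕ} {f : M → Euc m}
    (hf : ContMDiff (𝓡 n) (𝓡 m) ∞ f)
    (h0 : ∀ φ ∈ charts n M, ∀ y ∈ φ.target, ∀ i, pd (inChart φ f) i y = 0) (x x' : M) :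
    f x = f x' := by
  refine IsLocallyConstant.apply_eq_of_preconnectedSpace
    ((IsLocallyConstant.iff_eventually_eq f).2 fun x => ?_) x x'
  set φ := chartAt (Euc n) x
  have hφ : φ ∈ charts n M := IsManifold.chart_mem_maximalAtlas x
  have hx : x ∈ φ.source := mem_chart_source _ x
  obtain ⟨ε, hε, hball⟩ := Metric.isOpen_iff.1 φ.open_target (φ x) (φ.map_source hx)
  have hd : DifferentiableOn ℝ (inChart φ f) (Metric.ball (φ x) ε) :=
    ((inChart_smooth hφ hf).differentiableOn (by simp)).mono hball
  have hd0 : Set.EqOn (fderiv ℝ (inChart φ f)) 0 (Metric.ball (φ x) ε) := fun y hy => by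
    ext1 v
    have h1 := h0 φ hφ y (hball hy)
    simp only [pd] at h1
    simp [map_eq_sum_smul_single (fderiv ℝ (inChart φ f) y) v, h1]
  filter_upwards [(φ.continuousAt hx).preimage_mem_nhds (Metric.ball_mem_nhds _ hε),
    φ.open_source.mem_nhds hx] with z hz hzs
  have h2 := Metric.isOpen_ball.is_const_of_fderiv_eq_zero
    (convex_ball (φ x) ε).isPreconnected hd hd0 hz (Metric.mem_ball_self hε)
  simpa only [inChart, Function.comp, φ.left_inv hzs, φ.left_inv hx] using h2

end Charts

end Abundant

end

/-! ### The proposition -/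

theorem mainTheorem6 (n : ℕ) (hn : 3 ≤ n)
    (M : Type*) [TopologicalSpace M] [ConnectedSpace M]
    [ChartedSpace (Abundant.Euc n) M] [IsManifold (𝓡 n) ∞ M]
    (g : Abundant.Metric n M) (κ : ℝ) (hκ : Abundant.HasConstantSectionalCurvature g κ)
    (S : Abundant.CubicField n M) (t : M → ℝ)
    (hab : Abundant.IsAbundantManifold g S t) (hproper : Abundant.IsProper g S t) :
    Abundant.DualRicciVanishes g S t ∧
    ∀ f ξ : M → Abundant.Euc (n + 1), Abundant.IsAssociatedNormalisation g S t f ξ →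
      Abundant.IsImproperRelativeSphere f ξ ∧ Abundant.WeingartenVanishes f ξ := by
  have P := fun φ (hφ : φ ∈ Abundant.charts n M) => hab.isLocalProper hφ hκ hproper
  have hdual : Abundant.DualRicciVanishes g S t := fun φ hφ y hy =>
    (P φ hφ).dual_ricci_eq_zero hn hy
  refine ⟨hdual, fun f ξ hf => ?_⟩
  have hb := fun φ (hφ : φ ∈ Abundant.charts n M) y (hy : y ∈ φ.target) =>
    hf.toIsNormalisation.frameMap_bijective hφ hy
  have hA : Abundant.WeingartenVanishes f ξ := fun φ hφ y hy =>
    (P φ hφ).metric.weingarten_eq_zero hn hy (Abundant.inChart_smooth hφ hf.smooth_f)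
      (Abundant.inChart_smooth hφ hf.smooth_ξ) (hb φ hφ) (hf.metric_eq φ hφ) (P φ hφ).smooth_cubicOf
      (fun z hz => (P φ hφ).cubicOf_symm hz) (hf.cubic_eq φ hφ) (hdual φ hφ y hy)
  refine ⟨⟨hf.toIsRelativeNormalisation, ?_⟩, hA⟩
  obtain ⟨x₀⟩ : Nonempty M := inferInstance
  -- A transversal vector is nonzero, since the zero vector lies in the range of the differential of
  -- `f`.
  refine ⟨ξ x₀, fun h0 => hf.transversal x₀ ⟨0, by rw [h0]; exact map_zero _⟩, fun x => ?_⟩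
  refine Abundant.exists_const_of_pd_eq_zero hf.smooth_ξ (fun φ hφ y hy i => ?_) x x₀
  -- The Weingarten equation, whose tangential and transversal parts both vanish.
  rw [Abundant.pd_transversal_eq (hb φ hφ y hy).2, hf.relative φ hφ y hy]
  simp [hA φ hφ y hy]
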